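/- **Setting.** Let $d\ge 1$, $T>0$ and $I=[0,T]$. Let $\rho^f,\nu^f,\rho^s>0$ be the fluid density, fluid viscosity and solid density. Let $\Omega^s\subset\mathbb R^d$ (reference configuration of the solid) and $\Omega^f_t\subset\mathbb R^d$, $t\in I$ (fluid domain at time $t$), be bounded Lipschitz open sets, and let $\Gamma=\partial\Omega^f_0\cap\partial\Omega^s$ be the interface. Let $\Sigma_1,\Sigma_2$ be disjoint, let $\Sigma_3,\Sigma_4$ be disjoint, all four measurable and independent of time, with $\partial\Omega^s\setminus\Gamma=\Sigma_3\cup\Sigma_4$. Given are body forces $\mathbf g^f,\mathbf g^s$, boundary data $\mathbf u_b$ on $\Sigma_1$, $\boldsymbol\sigma^f_b$ on $\Sigma_2$, $\varphi_b$ on $\Sigma_3$, $\boldsymbol\sigma^s_b$ on $\Sigma_4$, an initial solid position $\varphi_0\in W^{1,\infty}(\Omega^s)$, and a solid stress law $F\mapsto\boldsymbol\sigma^s(F)$ on $d\times d$ matrices. Put $(\nabla u)_{ij}=\partial_ju_i$, $A:B=\operatorname{tr}(A^\top B)$ and $\boldsymbol\sigma^f(\mathbf u,p)=\rho^f\nu^f(\nabla\mathbf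 u+\nabla\mathbf u^\top)-pI$. Write $\langle\cdot,\cdot\rangle_\Omega$ and $\|\cdot\|_\Omega$ for the $L^2(\Omega)$ product and norm, and $\langle\cdot,\cdot\rangle_{\Sigma_i}$ for the integral over $\Sigma_i$ with respect to surface measure. Elements of $W^{1,\infty}(\Omega^s)$ are represented by functions continuous on $\overline{\Omega^s}$. Boundary values of $H^1(\Omega^f_t)$ functions are traces (limits in $L^2(\partial\Omega^f_t)$ of the boundary values of $C^1(\mathbb R^d)$ functions that converge in $H^1(\Omega^f_t)$). For $\varphi:\overline{\Omega^s}\to\mathbb R^d$ let $$V_t^{\varphi}=\{(\mathbf u;p;\mathbf v):\ \mathbf u\in H^1(\Omega^f_t),\ p\in L^2(\Omega^f_t),\ \mathbf v\in W^{1,\infty}(\Omega^s),\ \mathbf u(\varphi(\mathbf z))=\mathbf v(\mathbf z)\ \ \forall \mathbf z\in\Gamma\}.$$ **Weak solution.** For $(\mathbf u;p;\mathbf v)$ on $I$ put $\varphi(\mathbf z,t)=\varphi_0(\mathbf z)+\int_0^t\mathbf v(\mathbf z,\tau)\,d\tau$. It is a solution of the combined-field weak form if the following hold. 1. (Domain and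 interface.) For every $t\in I$, $\varphi(\Gamma,t)\subset\partial\Omega^f_t$ and $\partial\Omega^f_t\setminus\varphi(\Gamma,t)=\Sigma_1\cup\Sigma_2$. There are bi-Lipschitz maps $\Phi_t:\overline{\Omega^f_0}\to\mathbb R^d$ (ALE maps), with $\Phi_0=\mathrm{id}$, $\Phi_t(\Omega^f_0)=\Omega^f_t$ and $\Phi_t(\varphi_0(\mathbf z))=\varphi(\mathbf z,t)$ for $\mathbf z\in\Gamma$, such that $t\mapsto\Phi_t\in C^{0,1}(\overline{\Omega^f_0};\mathbb R^d)$ is differentiable on $I$, with derivative $\mathbf w_t$. 2. (Spaces and boundary conditions.) For every $t\in I$, $(\mathbf u;p;\mathbf v)(\cdot,t)\in V_t^{\varphi(\cdot,t)}$, $\mathbf u|_{\Sigma_1}=\mathbf u_b$ and $\mathbf v|_{\Sigma_3}=\partial_t\varphi_b$. 3. (Time regularity.) The function $t\mapsto \mathbf u(\Phi_t(\cdot),t)\in L^2(\Omega^f_0)$ is differentiable on $I$; the Eulerian derivative $\partial_t\mathbf u$ is defined by $\frac{d}{dt}\big[\mathbf u(\Phi_t(\cdot),t)\big]=\big(\partial_t\mathbf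 u\big)(\Phi_t(\cdot),t)+\nabla\mathbf u(\Phi_t(\cdot),t)\,\mathbf w_t$. The function $t\mapsto\mathbf v(\cdot,t)\in L^2(\Omega^s)$ is differentiable on $I$ with derivative $\partial_t\mathbf v$. Moreover $\mathbf v$ is continuous on $I\times\overline{\Omega^s}$, and $\nabla\mathbf v$ is bounded on $\Omega^s$ uniformly in $t$ and continuous in $t$ with values in $L^2(\Omega^s)$. 4. (Weak equation.) For every $t\in I$ and every $(\phi^f;q^f;\phi^s)\in V_t^{\varphi(\cdot,t)}$ with $\phi^f|_{\Sigma_1}=0$ and $\phi^s|_{\Sigma_3}=0$, all the integrals below exist and $$\begin{aligned}&\langle\rho^f(\partial_t\mathbf u+\mathbf u\cdot\nabla\mathbf u),\phi^f\rangle_{\Omega^f_t}+\langle\boldsymbol\sigma^f(\mathbf u,p),\nabla\phi^f\rangle_{\Omega^f_t}-\langle\nabla\cdot\mathbf u,q^f\rangle_{\Omega^f_t}+\langle\rho^s\partial_t\mathbf v,\phi^s\rangle_{\Omega^s}+\langle\boldsymbol\sigma^s(\nabla\varphi),\nabla\phi^s\rangle_{\Omega^s}\\&\quad=\langle\rho^f\mathbf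 g^f,\phi^f\rangle_{\Omega^f_t}+\langle\boldsymbol\sigma^f_b,\phi^f\rangle_{\Sigma_2}+\langle\rho^s\mathbf g^s,\phi^s\rangle_{\Omega^s}+\langle\boldsymbol\sigma^s_b,\phi^s\rangle_{\Sigma_4}.\end{aligned}$$ **Theorem.** Assume that the solid has a strain energy, that is, $\boldsymbol\sigma^s(F)=\partial W(F)/\partial F$ for a $C^1$ function $W$ on the $d\times d$ matrices, and put $I_s(\varphi)=\int_{\Omega^s}W(\nabla\varphi)\,d\mathbf z$. Assume also $\mathbf u_b=0$, $\Sigma_2=\emptyset$ and $\partial_t\varphi_b=0$. Then for every solution $(\mathbf u;p;\mathbf v)$ of the weak form, the functions $t\mapsto\|\mathbf u(\cdot,t)\|^2_{\Omega^f_t}$, $t\mapsto\|\mathbf v(\cdot,t)\|^2_{\Omega^s}$ and $t\mapsto I_s(\varphi(\cdot,t))$ are differentiable on $[0,T]$ (one-sidedly at the end points), and for every $t\in[0,T]$ $$\frac{\rho^f}{2}\frac{d}{dt}\|\mathbf u\|^2_{\Omega^f_t}+\frac{\rho^f\nu^f}{2}\|\nabla\mathbf u+\nabla\mathbf u^\top\|^2_{\Omega^f_t}+\frac{\rho^s}{2}\frac{d}{dt}\|\mathbf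 v\|^2_{\Omega^s}+\frac{d}{dt}I_s(\varphi)=\langle\rho^f\mathbf g^f,\mathbf u\rangle_{\Omega^f_t}+\langle\rho^s\mathbf g^s,\mathbf v\rangle_{\Omega^s}+\langle\boldsymbol\sigma^s_b,\mathbf v\rangle_{\Sigma_4}.$$ -/

import Mathlib

open MeasureTheory Set Filter Topology
open scoped ContDiff NNReal

namespace FSI

noncomputable section

/-- Points and vectors of `ℝ^d`, with the Euclidean norm. -/
abbrev Vec (d : ℕ) := EuclideanSpace ℝ (Fin d)

/-- Real `d × d` matrices with the Frobenius inner product: `inner ℝ A B = A : B = tr (Aᵀ B)`. -/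
abbrev Tensor (d : ℕ) := EuclideanSpace ℝ (Fin d × Fin d)

/-! ### Matrix algebra -/

/-- The transpose of a matrix. -/
def transp {d : ℕ} (A : Tensor d) : Tensor d := WithLp.toLp 2 fun ij => A (ij.2, ij.1)

/-- The identity matrix. -/
def idTensor (d : ℕ) : Tensor d := WithLp.toLp 2 fun ij => if ij.1 = ij.2 then 1 else 0

/-- The trace of a matrix. -/
def trTensor {d : ℕ} (A : Tensor d) : ℝ := ∑ i, A (i, i)

/-- The matrix-vector product `(A w)_i = ∑_j A_ij w_j`; if `A = ∇u`, this is `w · ∇u`. -/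
def mulVec {d : ℕ} (A : Tensor d) (w : Vec d) : Vec d := WithLp.toLp 2 fun i => ∑ j, A (i, j) * w j

/-! ### Sobolev spaces and traces -/

/-- Bounded Lipschitz domain: near each boundary point, `Ω` is the region above the graph of a
Lipschitz function over the hyperplane orthogonal to some unit vector `e`. -/
def IsLipschitzDomain {d : ℕ} (Ω : Set (Vec d)) : Prop :=
  IsOpen Ω ∧ Bornology.IsBounded Ω ∧
    ∀ x ∈ frontier Ω, ∃ (e : Vec d) (r : ℝ) (K : ℝ≥0) (h : Vec d → ℝ),
      ‖e‖ = 1 ∧ 0 < r ∧ LipschitzWith K h ∧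
      ∀ y ∈ Metric.ball x r, y ∈ Ω ↔ h (y - inner ℝ e y • e) < inner ℝ e y

/-- `G` is the weak (distributional) gradient of `u` in the open set `Ω`: `G_ij = ∂_j u_i`. -/
def HasWeakGrad {d : ℕ} (Ω : Set (Vec d)) (u : Vec d → Vec d) (G : Vec d → Tensor d) : Prop :=
  LocallyIntegrableOn u Ω ∧ LocallyIntegrableOn G Ω ∧
    ∀ ψ : Vec d → ℝ, ContDiff ℝ ∞ ψ → HasCompactSupport ψ → tsupport ψ ⊆ Ω →
      ∀ i j : Fin d,
        ∫ x in Ω, u x i * fderiv ℝ ψ x (EuclideanSpace.single j 1) = - ∫ x in Ω, G x (i, j) * ψ x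

open Classical in
/-- The weak gradient `∇u` in `Ω` (a.e. unique when it exists; `0` if there is none). -/
def weakGrad {d : ℕ} (Ω : Set (Vec d)) (u : Vec d → Vec d) : Vec d → Tensor d :=
  if h : ∃ G, HasWeakGrad Ω u G then h.choose else 0

/-- The divergence of `u`, as the trace of the weak gradient. -/
def weakDiv {d : ℕ} (Ω : Set (Vec d)) (u : Vec d → Vec d) (x : Vec d) : ℝ :=
  trTensor (weakGrad Ω u x)

/-- `u ∈ H¹(Ω)`. -/
def MemH1 {d : ℕ} (Ω : Set (Vec d)) (u : Vec d → Vec d) : Prop :=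
  (∃ G, HasWeakGrad Ω u G) ∧ MemLp u 2 (volume.restrict Ω) ∧
    MemLp (weakGrad Ω u) 2 (volume.restrict Ω)

/-- `v ∈ W^{1,∞}(Ω)`, represented by a function that is continuous on the closure of `Ω`
(on a bounded Lipschitz domain every class has exactly one such representative). -/
def MemW1inf {d : ℕ} (Ω : Set (Vec d)) (v : Vec d → Vec d) : Prop :=
  ContinuousOn v (closure Ω) ∧ (∃ G, HasWeakGrad Ω v G) ∧ MemLp v ⊤ (volume.restrict Ω) ∧
    MemLp (weakGrad Ω v) ⊤ (volume.restrict Ω)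

/-- Surface measure on `∂Ω`: the `(d-1)`-dimensional Hausdorff measure, normalized to agree with
Lebesgue measure on hyperplanes. -/
def surf {d : ℕ} (Ω : Set (Vec d)) : Measure (Vec d) :=
  (Measure.euclideanHausdorffMeasure (d - 1) : Measure (Vec d)).restrict (frontier Ω)

/-- The classical gradient `(∇U)_ij = ∂_j U_i`. -/
def classicalGrad {d : ℕ} (U : Vec d → Vec d) (x : Vec d) : Tensor d :=
  WithLp.toLp 2 fun ij => fderiv ℝ U x (EuclideanSpace.single ij.2 1) ij.1

/-- `γ` is (a representative of) the boundary trace of `u ∈ H¹(Ω)`: there are `U_n ∈ C¹(ℝ^d)`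
with `U_n → u` in `H¹(Ω)` and `U_n → γ` in `L²(∂Ω)`. -/
def HasTrace {d : ℕ} (Ω : Set (Vec d)) (u γ : Vec d → Vec d) : Prop :=
  MemLp γ 2 (surf Ω) ∧ ∃ U : ℕ → Vec d → Vec d, (∀ n, ContDiff ℝ 1 (U n)) ∧
    Tendsto (fun n => eLpNorm (fun x => U n x - u x) 2 (volume.restrict Ω)) atTop (𝓝 0) ∧
    Tendsto (fun n => eLpNorm (fun x => classicalGrad (U n) x - weakGrad Ω u x) 2
      (volume.restrict Ω)) atTop (𝓝 0) ∧
    Tendsto (fun n => eLpNorm (fun x => U n x - γ x) 2 (surf Ω)) atTop (𝓝 0)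

/-! ### Time dependence -/

/-- `s ↦ f s` is differentiable at `t`, within `I`, as a map into `L²(Ω)`, with derivative `f'`. -/
def HasL2DerivWithinAt {d : ℕ} (Ω : Set (Vec d)) (f : ℝ → Vec d → Vec d) (f' : Vec d → Vec d)
    (I : Set ℝ) (t : ℝ) : Prop :=
  MemLp f' 2 (volume.restrict Ω) ∧
    Tendsto (fun s => eLpNorm (fun x => (s - t)⁻¹ • (f s x - f t x) - f' x) 2 (volume.restrict Ω))
      (𝓝[I \ {t}] t) (𝓝 0)

/-- The family `Φ t` of bi-Lipschitz maps carries `Ωf 0` to `Ωf t` (an ALE map), and `t ↦ Φ t` is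
differentiable in the `C^{0,1}` norm on the closure of `Ωf 0`, with derivative `w t`. -/
structure IsDomainMotion {d : ℕ} (T : ℝ) (Ωf : ℝ → Set (Vec d)) (Φ w : ℝ → Vec d → Vec d) :
    Prop where
  init : ∀ X ∈ closure (Ωf 0), Φ 0 X = X
  image : ∀ t ∈ Icc 0 T, Φ t '' Ωf 0 = Ωf t
  biLipschitz : ∀ t ∈ Icc 0 T, ∃ K : ℝ, ∀ X ∈ closure (Ωf 0), ∀ Y ∈ closure (Ωf 0),
    ‖Φ t X - Φ t Y‖ ≤ K * ‖X - Y‖ ∧ ‖X - Y‖ ≤ K * ‖Φ t X - Φ t Y‖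
  deriv : ∀ t ∈ Icc 0 T, ∀ ε > 0, ∀ᶠ s in 𝓝[Icc 0 T] t, ∀ X ∈ closure (Ωf 0),
    ‖Φ s X - Φ t X - (s - t) • w t X‖ ≤ ε * |s - t| ∧
    ∀ Y ∈ closure (Ωf 0),
      ‖(Φ s X - Φ t X - (s - t) • w t X) - (Φ s Y - Φ t Y - (s - t) • w t Y)‖
        ≤ ε * |s - t| * ‖X - Y‖

/-! ### The fluid-structure interaction problem -/

/-- The data of the problem. The fields with a time argument take it first. -/
structure Data (d : ℕ) where
  /-- final time -/
  T : ℝ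
  /-- fluid density -/
  ρf : ℝ
  /-- fluid kinematic viscosity -/
  νf : ℝ
  /-- solid density -/
  ρs : ℝ
  /-- fluid domain at each time -/
  Ωf : ℝ → Set (Vec d)
  /-- reference configuration of the solid -/
  Ωs : Set (Vec d)
  /-- fluid boundary with prescribed velocity -/
  S₁ : Set (Vec d)
  /-- fluid boundary with prescribed traction -/
  S₂ : Set (Vec d)
  /-- solid boundary with prescribed position -/
  S₃ : Set (Vec d)
  /-- solid boundary with prescribed traction -/
  S₄ : Set (Vec d)
  /-- body force on the fluid -/
  gf : ℝ → Vec d → Vec d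
  /-- body force on the solid -/
  gs : ℝ → Vec d → Vec d
  /-- prescribed fluid velocity on `S₁` -/
  ub : ℝ → Vec d → Vec d
  /-- prescribed fluid traction on `S₂` -/
  σbf : ℝ → Vec d → Vec d
  /-- prescribed solid position on `S₃` -/
  φb : ℝ → Vec d → Vec d
  /-- prescribed solid traction on `S₄` -/
  σbs : ℝ → Vec d → Vec d
  /-- initial position of the solid -/
  φ₀ : Vec d → Vec d
  /-- constitutive law of the solid: stress as a function of the deformation gradient -/
  σs : Tensor d → Tensor d

namespace Data

variable {d : ℕ}

/-- The fluid-structure interface in the reference configuration. -/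
def Γ (D : Data d) : Set (Vec d) := frontier (D.Ωf 0) ∩ frontier D.Ωs

/-- The position `φ(z, t) = φ₀(z) + ∫₀ᵗ v(z, τ) dτ` of the solid. -/
def pos (D : Data d) (v : ℝ → Vec d → Vec d) (t : ℝ) (z : Vec d) : Vec d :=
  D.φ₀ z + ∫ τ in (0 : ℝ)..t, v τ z

/-- The Newtonian fluid stress `ρf νf (∇u + ∇uᵀ) - p I`, as a function of `∇u` and `p`. -/
def σf (D : Data d) (G : Tensor d) (p : ℝ) : Tensor d :=
  (D.ρf * D.νf) • (G + transp G) - p • idTensor d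

/-- Standing assumptions on the data. -/
structure Admissible (D : Data d) : Prop where
  T_pos : 0 < D.T
  ρf_pos : 0 < D.ρf
  νf_pos : 0 < D.νf
  ρs_pos : 0 < D.ρs
  lipschitz_f : ∀ t ∈ Icc 0 D.T, IsLipschitzDomain (D.Ωf t)
  lipschitz_s : IsLipschitzDomain D.Ωs
  boundary_s : frontier D.Ωs \ D.Γ = D.S₃ ∪ D.S₄
  disjoint_f : Disjoint D.S₁ D.S₂
  disjoint_s : Disjoint D.S₃ D.S₄
  measurable₁ : MeasurableSet D.S₁
  measurable₂ : MeasurableSet D.S₂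
  measurable₃ : MeasurableSet D.S₃
  measurable₄ : MeasurableSet D.S₄
  φ₀_mem : MemW1inf D.Ωs D.φ₀

/-- `(u; p; v) ∈ V_t^φ`, where `γ` is the boundary trace of `u`: `u ∈ H¹(Ω_t)`, `p ∈ L²(Ω_t)`,
`v ∈ W^{1,∞}(Ωs)` and `u(φ(z)) = v(z)` on the interface. -/
def MemV (D : Data d) (t : ℝ) (φ : Vec d → Vec d) (u γ : Vec d → Vec d) (p : Vec d → ℝ)
    (v : Vec d → Vec d) : Prop :=
  MemH1 (D.Ωf t) u ∧ HasTrace (D.Ωf t) u γ ∧ MemLp p 2 (volume.restrict (D.Ωf t)) ∧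
    MemW1inf D.Ωs v ∧ ∀ z ∈ D.Γ, γ (φ z) = v z

/-- The weak equation at time `t`, where `φ` is the position of the solid, `u, p` are the
fluid velocity and pressure at time `t`, and `ut, vt` the time derivatives at time `t` of the fluid
and solid velocities: for every test triple, all integrals exist and the identity holds. -/
def WeakForm (D : Data d) (t : ℝ) (φ : Vec d → Vec d) (u ut : Vec d → Vec d) (p : Vec d → ℝ)
    (vt : Vec d → Vec d) : Prop :=
  ∀ (φf γ : Vec d → Vec d) (q : Vec d → ℝ) (φs : Vec d → Vec d),
    D.MemV t φ φf γ q φs → (∀ x ∈ D.S₁, γ x = 0) → (∀ z ∈ D.S₃, φs z = 0) →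
    IntegrableOn (fun x => inner ℝ (ut x + mulVec (weakGrad (D.Ωf t) u x) (u x)) (φf x))
      (D.Ωf t) ∧
    IntegrableOn (fun x => inner ℝ (D.gf t x) (φf x)) (D.Ωf t) ∧
    IntegrableOn (fun x => inner ℝ (D.σbf t x) (γ x)) D.S₂ (surf (D.Ωf t)) ∧
    IntegrableOn (fun z => inner ℝ (D.gs t z) (φs z)) D.Ωs ∧
    IntegrableOn (fun z => inner ℝ (D.σbs t z) (φs z)) D.S₄ (surf D.Ωs) ∧
    IntegrableOn (fun z => inner ℝ (D.σs (weakGrad D.Ωs φ z)) (weakGrad D.Ωs φs z)) D.Ωs ∧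
    D.ρf * (∫ x in D.Ωf t, inner ℝ (ut x + mulVec (weakGrad (D.Ωf t) u x) (u x)) (φf x))
      + (∫ x in D.Ωf t, inner ℝ (D.σf (weakGrad (D.Ωf t) u x) (p x)) (weakGrad (D.Ωf t) φf x))
      - (∫ x in D.Ωf t, weakDiv (D.Ωf t) u x * q x)
      + D.ρs * (∫ z in D.Ωs, inner ℝ (vt z) (φs z))
      + (∫ z in D.Ωs, inner ℝ (D.σs (weakGrad D.Ωs φ z)) (weakGrad D.Ωs φs z))
    = D.ρf * (∫ x in D.Ωf t, inner ℝ (D.gf t x) (φf x))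
      + (∫ x in D.S₂, inner ℝ (D.σbf t x) (γ x) ∂(surf (D.Ωf t)))
      + D.ρs * (∫ z in D.Ωs, inner ℝ (D.gs t z) (φs z))
      + (∫ z in D.S₄, inner ℝ (D.σbs t z) (φs z) ∂(surf D.Ωs))

/-- `(u; p; v)` solves the combined-field weak formulation on `[0, T]`, with time derivatives
`ut = ∂_t u`, `vt = ∂_t v`; the fluid domain is moved by the maps `Φ t` with material velocity
`w t`. -/
structure IsWeakSolution (D : Data d) (Φ w : ℝ → Vec d → Vec d) (u ut : ℝ → Vec d → Vec d)
    (p : ℝ → Vec d → ℝ) (v vt : ℝ → Vec d → Vec d) : Prop where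
  /-- the fluid boundary consists of the current interface and of the fixed parts -/
  interface_subset : ∀ t ∈ Icc 0 D.T, D.pos v t '' D.Γ ⊆ frontier (D.Ωf t)
  boundary_f : ∀ t ∈ Icc 0 D.T, frontier (D.Ωf t) \ D.pos v t '' D.Γ = D.S₁ ∪ D.S₂
  /-- the fluid domain moves regularly, and its interface moves with the solid -/
  motion : IsDomainMotion D.T D.Ωf Φ w
  motion_interface : ∀ t ∈ Icc 0 D.T, ∀ z ∈ D.Γ, Φ t (D.φ₀ z) = D.pos v t z
  /-- function space, interface condition and fluid velocity boundary condition -/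
  mem : ∀ t ∈ Icc 0 D.T, ∃ γ, D.MemV t (D.pos v t) (u t) γ (p t) (v t) ∧
    ∀ x ∈ D.S₁, γ x = D.ub t x
  /-- `v = ∂_t φb` on `S₃` -/
  dirichlet_s : ∀ t ∈ Icc 0 D.T, ∀ z ∈ D.S₃,
    HasDerivWithinAt (fun s => D.φb s z) (v t z) (Icc 0 D.T) t
  /-- `ut = ∂_t u`: the pullback `u(Φ(X, t), t)` to the fixed domain is differentiable in `L²`,
  with derivative `∂_t u + w · ∇u` (chain rule) -/
  deriv_u : ∀ t ∈ Icc 0 D.T, HasL2DerivWithinAt (D.Ωf 0) (fun s X => u s (Φ s X))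
    (fun X => ut t (Φ t X) + mulVec (weakGrad (D.Ωf t) (u t) (Φ t X)) (w t X)) (Icc 0 D.T) t
  /-- `vt = ∂_t v` in `L²(Ωs)` -/
  deriv_v : ∀ t ∈ Icc 0 D.T, HasL2DerivWithinAt D.Ωs v (vt t) (Icc 0 D.T) t
  cont_v : ContinuousOn (fun tz : ℝ × Vec d => v tz.1 tz.2) (Icc 0 D.T ×ˢ closure D.Ωs)
  /-- `∇v` is bounded on `Ωs × [0, T]` and continuous in time with values in `L²(Ωs)` -/
  bdd_grad_v : ∃ M : ℝ, ∀ t ∈ Icc 0 D.T,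
    ∀ᵐ z ∂(volume.restrict D.Ωs), ‖weakGrad D.Ωs (v t) z‖ ≤ M
  cont_grad_v : ∀ t ∈ Icc 0 D.T,
    Tendsto (fun s => eLpNorm (fun z => weakGrad D.Ωs (v s) z - weakGrad D.Ωs (v t) z) 2
      (volume.restrict D.Ωs)) (𝓝[Icc 0 D.T] t) (𝓝 0)
  weak : ∀ t ∈ Icc 0 D.T, D.WeakForm t (D.pos v t) (u t) (ut t) (p t) (vt t)

end Data

/-- `‖f‖²` in `L²(Ω)`. -/
def sqNorm {d n : ℕ} (Ω : Set (Vec d)) (f : Vec d → Vec n) : ℝ := ∫ x in Ω, ‖f x‖ ^ 2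

/-- The strain energy `I_s(φ) = ∫_Ωs W(∇φ)`. -/
def strainEnergy {d : ℕ} (W : Tensor d → ℝ) (Ωs : Set (Vec d)) (φ : Vec d → Vec d) : ℝ :=
  ∫ z in Ωs, W (weakGrad Ωs φ z)

end

end FSI

/-!
The energy identity comes from testing the weak equation with the solution itself, after which two
things remain: the terms that carry no energy must be seen to vanish, and the kinetic energy of the
fluid must be differentiated on a moving domain.

*The pressure does no work.* Testing with `(0; q; 0)` for `q = ∇ · u` gives `∇ · u = 0` almost
everywhere (`Data.WeakForm.weakDiv_ae_eq_zero`). The solution is itself an admissible test triple,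
because its boundary values on `S₁` and `S₃` vanish.

*Transport.* Pulled back to the domain at time `t` by the Lipschitz maps `Ψ_s = Φ_s ∘ Φ_t⁻¹`, the
kinetic energy is `∫ |det ∇Ψ_s| |u_s ∘ Ψ_s|²` by the area formula. Differentiability of `Φ` in the
Lipschitz norm makes the Jacobian `1 + (s - t) ∇ · b + o(s - t)` uniformly almost everywhere, with
`b` the Eulerian velocity of the domain, extended to a Lipschitz field on `ℝ^d`. Hence
`d/dt ‖u‖² = 2 ⟨u, ∂_t u + b · ∇u⟩ + ⟨∇ · b, |u|²⟩`
(`IsDomainMotion.exists_hasDerivWithinAt_sqNorm`).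

*No kinetic energy crosses the boundary.* This derivative agrees with `2 ⟨u, ∂_t u + u · ∇u⟩`
provided that `∫ ∇ · (|u|² (b - u)) = 0` (`integral_kineticFlux_eq_zero`). That holds because on
the boundary either the trace of `u` vanishes, or it equals the velocity `v` of the interface,
which is `b` (`Data.IsWeakSolution.velocity_interface`). Since `u` is only in `H¹`, the flux
`|u|² (b - u)` need not be in `W^{1,1}`: it is replaced by `β(|u|²) (b - u)` with
`β(r) = r / (1 + δ r)`, approximated through the `C¹` fields that define the trace, and `δ → 0` is
taken by dominated convergence, the limit being integrable because the weak form supplies the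
integrability of `(u · ∇u) · u`. In place of the divergence theorem on a Lipschitz domain a
one-sided estimate suffices: the mean of `∇ · F` is bounded by an integral of `|F|` over the
boundary (`exists_abs_integral_div_le`). It follows from difference quotients, since a translation
by `η` changes the integral over `Ω` only within the `η`-neighbourhood of the boundary, and that
neighbourhood is a thin strip around a graph.

*Strain energy.* The gradient of the position is `∇φ₀ + ∫₀ᵗ ∇v`, with the time integral taken in
`L²`; it is bounded and Lipschitz in time, so that `d/dt ∫ W(∇φ) = ∫ W'(∇φ) : ∇v`
(`hasDerivWithinAt_strainEnergy`).
-/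

namespace FSI

/-! ### Weak gradients -/

variable {d : ℕ}

/-- Weak gradients are unique almost everywhere. -/
theorem HasWeakGrad.ae_eq {Ω : Set (Vec d)} (hΩ : IsOpen Ω) {u : Vec d → Vec d}
    {G H : Vec d → Tensor d} (hG : HasWeakGrad Ω u G) (hH : HasWeakGrad Ω u H) :
    G =ᵐ[volume.restrict Ω] H := by
  have key : ∀ ij : Fin d × Fin d, ∀ᵐ x, x ∈ Ω → G x ij - H x ij = 0 := by
    rintro ⟨i, j⟩
    have hloc : ∀ {F : Vec d → Tensor d}, LocallyIntegrableOn F Ω →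
        LocallyIntegrableOn (fun x => F x (i, j)) Ω := by
      intro F hF x hx
      obtain ⟨s, hs, h⟩ := hF x hx
      exact ⟨s, hs, (EuclideanSpace.proj (𝕜 := ℝ) (i, j)).integrable_comp h⟩
    have hGl := hloc hG.2.1
    have hHl := hloc hH.2.1
    refine hΩ.ae_eq_zero_of_integral_contDiff_smul_eq_zero (hGl.sub hHl) ?_
    intro ψ hψ hc hs
    have e := (hG.2.2 ψ hψ hc hs i j).symm.trans (hH.2.2 ψ hψ hc hs i j)
    have hint : ∀ {f : Vec d → ℝ}, LocallyIntegrableOn f Ω →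
        IntegrableOn (fun x => f x * ψ x) Ω := by
      intro f hf
      have h1 : IntegrableOn (fun x => f x * ψ x) (tsupport ψ) :=
        (hf.integrableOn_compact_subset hs hc).mul_continuousOn hψ.continuous.continuousOn hc
      refine h1.of_forall_sdiff_eq_zero hΩ.measurableSet fun x hx => ?_
      rw [image_eq_zero_of_notMem_tsupport hx.2, mul_zero]
    have h2 : ∫ x, ψ x • (G x (i, j) - H x (i, j)) = ∫ x in Ω, ψ x • (G x (i, j) - H x (i, j)) := by
      symm
      apply setIntegral_eq_integral_of_forall_compl_eq_zero
      intro x hx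
      rw [image_eq_zero_of_notMem_tsupport (fun h => hx (hs h)), zero_smul]
    have h3 : ∫ x in Ω, ψ x • (G x (i, j) - H x (i, j))
        = (∫ x in Ω, G x (i, j) * ψ x) - ∫ x in Ω, H x (i, j) * ψ x := by
      rw [← integral_sub (hint hGl) (hint hHl)]
      congr 1; ext x; simp; ring
    simp only at h2 ⊢
    rw [h2, h3]; linarith
  have := ae_all_iff.2 key
  rw [Filter.EventuallyEq, ae_restrict_iff' hΩ.measurableSet]
  filter_upwards [this] with x hx hxΩ
  ext ij
  have := hx ij hxΩ
  linarith

theorem hasWeakGrad_weakGrad {Ω : Set (Vec d)} {u : Vec d → Vec d}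
    (h : ∃ G, HasWeakGrad Ω u G) : HasWeakGrad Ω u (weakGrad Ω u) := by
  rw [weakGrad, dif_pos h]; exact h.choose_spec

theorem HasWeakGrad.weakGrad_ae_eq {Ω : Set (Vec d)} (hΩ : IsOpen Ω) {u : Vec d → Vec d}
    {G : Vec d → Tensor d} (hG : HasWeakGrad Ω u G) :
    weakGrad Ω u =ᵐ[volume.restrict Ω] G :=
  (hasWeakGrad_weakGrad ⟨G, hG⟩).ae_eq hΩ hG

theorem hasWeakGrad_zero (Ω : Set (Vec d)) :
    HasWeakGrad Ω (fun _ => (0 : Vec d)) (fun _ => (0 : Tensor d)) := by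
  refine ⟨(integrable_zero _ _ _).locallyIntegrable.locallyIntegrableOn _,
    (integrable_zero _ _ _).locallyIntegrable.locallyIntegrableOn _, ?_⟩
  intros; simp

theorem weakGrad_zero_ae {Ω : Set (Vec d)} (hΩ : IsOpen Ω) :
    weakGrad Ω (fun _ => (0 : Vec d)) =ᵐ[volume.restrict Ω] fun _ => 0 :=
  (hasWeakGrad_zero Ω).weakGrad_ae_eq hΩ

theorem memH1_zero {Ω : Set (Vec d)} (hΩ : IsOpen Ω) : MemH1 Ω (fun _ => (0 : Vec d)) :=
  ⟨⟨_, hasWeakGrad_zero Ω⟩, MemLp.zero', (memLp_congr_ae (weakGrad_zero_ae hΩ)).2 MemLp.zero'⟩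

theorem memW1inf_zero {Ω : Set (Vec d)} (hΩ : IsOpen Ω) : MemW1inf Ω (fun _ => (0 : Vec d)) :=
  ⟨continuousOn_const, ⟨_, hasWeakGrad_zero Ω⟩, MemLp.zero',
    (memLp_congr_ae (weakGrad_zero_ae hΩ)).2 MemLp.zero'⟩

theorem hasTrace_zero {Ω : Set (Vec d)} (hΩ : IsOpen Ω) :
    HasTrace Ω (fun _ => (0 : Vec d)) (fun _ => 0) := by
  refine ⟨MemLp.zero', fun _ _ => 0, fun _ => contDiff_const, by simp, ?_, by simp⟩
  have : (fun x => classicalGrad (fun _ : Vec d => (0 : Vec d)) x - weakGrad Ω (fun _ => 0) x)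
      =ᵐ[volume.restrict Ω] fun _ => 0 := by
    filter_upwards [weakGrad_zero_ae hΩ] with x hx
    rw [hx]; ext ij; simp [classicalGrad]
  simp [eLpNorm_congr_ae this]

/-! ### Tensor algebra -/

theorem inner_tensor (A B : Tensor d) : inner ℝ A B = ∑ i, ∑ j, A (i, j) * B (i, j) := by
  rw [PiLp.inner_apply, Fintype.sum_prod_type]
  simp [mul_comm]

theorem norm_add_transp_sq (A : Tensor d) :
    ‖A + transp A‖ ^ 2 = 2 * inner ℝ (A + transp A) A := by
  have h : ∀ B : Tensor d, (inner ℝ B (transp A) : ℝ) = inner ℝ (transp B) A := by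
    intro B
    rw [inner_tensor, inner_tensor, Finset.sum_comm]; rfl
  have h2 : transp (A + transp A) = A + transp A := by
    ext ij; simp [transp]; ring
  rw [← real_inner_self_eq_norm_sq]
  conv_lhs => rw [inner_add_right, h, h2]
  ring

theorem inner_idTensor (A : Tensor d) : inner ℝ (idTensor d) A = trTensor A := by
  rw [inner_tensor]; simp [idTensor, trTensor]

/-- The power of the fluid stress: viscous dissipation minus the work of the pressure. -/
theorem Data.inner_σf (D : Data d) (G : Tensor d) (p : ℝ) :
    inner ℝ (D.σf G p) G = D.ρf * D.νf / 2 * ‖G + transp G‖ ^ 2 - trTensor G * p := by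
  rw [Data.σf, inner_sub_left, inner_smul_left, inner_smul_left, inner_idTensor,
    norm_add_transp_sq]
  simp; ring

/-- Contraction of a matrix with two vectors: `y · A x`. -/
theorem inner_mulVec_tensor (A : Tensor d) (x y : Vec d) :
    inner ℝ (mulVec A x) y = ∑ i, ∑ j, A (i, j) * x j * y i := by
  rw [PiLp.inner_apply]
  simp [mulVec, Finset.mul_sum, mul_comm]

theorem norm_mulVec_le (A : Tensor d) (x : Vec d) : ‖mulVec A x‖ ≤ ‖A‖ * ‖x‖ := by
  rw [EuclideanSpace.norm_eq, EuclideanSpace.norm_eq, EuclideanSpace.norm_eq,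
    ← Real.sqrt_mul (by positivity)]
  apply Real.sqrt_le_sqrt
  rw [Fintype.sum_prod_type, Finset.sum_mul]
  refine Finset.sum_le_sum fun i _ => ?_
  simpa [mulVec] using Finset.sum_mul_sq_le_sq_mul_sq Finset.univ (fun j => A (i, j)) (fun j => x j)

theorem continuous_mulVec : Continuous fun q : Tensor d × Vec d => mulVec q.1 q.2 := by
  refine (PiLp.continuous_toLp 2 _).comp (continuous_pi fun i => ?_)
  fun_prop

theorem continuous_trTensor : Continuous fun A : Tensor d => trTensor A := by
  unfold trTensor; fun_prop

theorem abs_trTensor_le (A : Tensor d) : |trTensor A| ≤ d * ‖A‖ := by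
  calc |trTensor A| ≤ ∑ i, |A (i, i)| := Finset.abs_sum_le_sum_abs _ _
    _ ≤ ∑ _i : Fin d, ‖A‖ := Finset.sum_le_sum fun i _ => by
        simpa using PiLp.norm_apply_le A (i, i)
    _ = d * ‖A‖ := by simp

/-! ### Time derivatives of quadratic functionals -/

section L2

variable {α E : Type*} [MeasurableSpace α] {μ : Measure α} [NormedAddCommGroup E]
  [InnerProductSpace ℝ E]

theorem integrable_inner_of_memLp {f g : α → E} (hf : MemLp f 2 μ) (hg : MemLp g 2 μ) :
    Integrable (fun x => (inner ℝ (f x) (g x) : ℝ)) μ := by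
  refine (L2.integrable_inner (𝕜 := ℝ) (hf.toLp f) (hg.toLp g)).congr ?_
  filter_upwards [hf.coeFn_toLp, hg.coeFn_toLp] with x h1 h2
  rw [h1, h2]

theorem L2_inner_eq_integral {F G : Lp E 2 μ} {f g : α → E} (hF : F =ᵐ[μ] f) (hG : G =ᵐ[μ] g) :
    (inner ℝ F G : ℝ) = ∫ x, inner ℝ (f x) (g x) ∂μ := by
  rw [L2.inner_def]
  refine integral_congr_ae ?_
  filter_upwards [hF, hG] with x h1 h2
  rw [h1, h2]

/-- Differentiability in the mean-square sense, as differentiability of a curve in `L²`. -/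
theorem exists_hasDerivWithinAt_Lp {I : Set ℝ} {t : ℝ} (ht : t ∈ I) {f : ℝ → α → E} {f' : α → E}
    (hf : ∀ s ∈ I, MemLp (f s) 2 μ) (hf' : MemLp f' 2 μ)
    (hlim : Tendsto (fun s => eLpNorm (fun x => (s - t)⁻¹ • (f s x - f t x) - f' x) 2 μ)
      (𝓝[I \ {t}] t) (𝓝 0)) :
    ∃ F : ℝ → Lp E 2 μ, (∀ s ∈ I, F s =ᵐ[μ] f s) ∧ HasDerivWithinAt F (hf'.toLp f') I t := by
  classical
  refine ⟨fun s => if h : s ∈ I then (hf s h).toLp (f s) else 0, fun s hs => ?_, ?_⟩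
  · simpa [hs] using (hf s hs).coeFn_toLp
  · rw [hasDerivWithinAt_iff_tendsto_slope, Lp.tendsto_Lp_iff_tendsto_eLpNorm']
    refine hlim.congr' ?_
    filter_upwards [self_mem_nhdsWithin] with s hs
    refine eLpNorm_congr_ae ?_
    simp only [slope, hs.1, ht, dif_pos, vsub_eq_sub]
    filter_upwards [Lp.coeFn_sub ((s - t)⁻¹ • ((hf s hs.1).toLp (f s) - (hf t ht).toLp (f t)))
        (hf'.toLp f'), Lp.coeFn_smul (s - t)⁻¹ ((hf s hs.1).toLp (f s) - (hf t ht).toLp (f t)),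
      Lp.coeFn_sub ((hf s hs.1).toLp (f s)) ((hf t ht).toLp (f t)), (hf s hs.1).coeFn_toLp,
      (hf t ht).coeFn_toLp, hf'.coeFn_toLp] with x h1 h2 h3 h4 h5 h6
    simp only [Pi.sub_apply, Pi.smul_apply] at h1 h2 h3 ⊢
    rw [h2, h3, h4, h5, h6]

/-- Derivative of `∫ J_s |f_s|²` at `s = t`, where `J_s = 1 + (s - t) c + o(s - t)` uniformly and
`f` is differentiable in `L²`. -/
theorem hasDerivWithinAt_integral_mul_norm_sq {I : Set ℝ} {t : ℝ} (ht : t ∈ I)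
    {f : ℝ → α → E} {f' : α → E}
    (hf : ∀ s ∈ I, MemLp (f s) 2 μ) (hf' : MemLp f' 2 μ)
    (hlim : Tendsto (fun s => eLpNorm (fun x => (s - t)⁻¹ • (f s x - f t x) - f' x) 2 μ)
      (𝓝[I \ {t}] t) (𝓝 0))
    {J : ℝ → α → ℝ} {c : α → ℝ} (hc : MemLp c ⊤ μ)
    (hJm : ∀ s ∈ I, AEStronglyMeasurable (J s) μ)
    (hJ : ∀ ε > 0, ∀ᶠ s in 𝓝[I] t, ∀ᵐ x ∂μ, |J s x - 1 - (s - t) * c x| ≤ ε * |s - t|) :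
    HasDerivWithinAt (fun s => ∫ x, J s x * ‖f s x‖ ^ 2 ∂μ)
      (2 * (∫ x, inner ℝ (f t x) (f' x) ∂μ) + ∫ x, c x * ‖f t x‖ ^ 2 ∂μ) I t := by
  obtain ⟨F, hF, hFd⟩ := exists_hasDerivWithinAt_Lp ht hf hf' hlim
  let M : Lp E 2 μ →L[ℝ] Lp E 2 μ :=
    (ContinuousLinearMap.lsmul ℝ ℝ : ℝ →L[ℝ] E →L[ℝ] E).holderL μ ⊤ 2 2 (hc.toLp c)
  have hM : ∀ s ∈ I, M (F s) =ᵐ[μ] fun x => c x • f s x := by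
    intro s hs
    have := (ContinuousLinearMap.lsmul ℝ ℝ : ℝ →L[ℝ] E →L[ℝ] E).coeFn_holder (r := 2)
      (hc.toLp c) (F s)
    filter_upwards [this, hc.coeFn_toLp, hF s hs] with x h1 h2 h3
    change (ContinuousLinearMap.holder 2 (ContinuousLinearMap.lsmul ℝ ℝ) (hc.toLp c) (F s)) x = _
    rw [h1, h2, h3]; rfl
  have hsq : ∀ s ∈ I, ‖F s‖ ^ 2 = ∫ x, ‖f s x‖ ^ 2 ∂μ := by
    intro s hs
    rw [← real_inner_self_eq_norm_sq, L2_inner_eq_integral (hF s hs) (hF s hs)]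
    simp
  have hQ : ∀ s ∈ I, (inner ℝ (M (F s)) (F s) : ℝ) = ∫ x, c x * ‖f s x‖ ^ 2 ∂μ := by
    intro s hs
    rw [L2_inner_eq_integral (hM s hs) (hF s hs)]
    simp [inner_smul_left]
  have hint : ∀ s ∈ I, Integrable (fun x => ‖f s x‖ ^ 2) μ := fun s hs => by
    simpa using integrable_inner_of_memLp (hf s hs) (hf s hs)
  have hintc : ∀ s ∈ I, Integrable (fun x => c x * ‖f s x‖ ^ 2) μ := fun s hs => by
    refine (L2.integrable_inner (𝕜 := ℝ) (M (F s)) (F s)).congr ?_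
    filter_upwards [hM s hs, hF s hs] with x h1 h2
    rw [h1, h2]; simp [inner_smul_left]
  -- the principal part
  have hcont : ContinuousWithinAt (fun s => (inner ℝ (M (F s)) (F s) : ℝ)) I t :=
    (M.continuous.continuousAt.comp_continuousWithinAt hFd.continuousWithinAt).inner
      hFd.continuousWithinAt
  have hd1 : HasDerivWithinAt (fun s => (s - t) * (inner ℝ (M (F s)) (F s) : ℝ))
      (inner ℝ (M (F t)) (F t)) I t := by
    rw [hasDerivWithinAt_iff_tendsto_slope]
    refine (hcont.mono sdiff_subset).tendsto.congr' ?_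
    filter_upwards [self_mem_nhdsWithin] with s hs
    have : s - t ≠ 0 := sub_ne_zero.2 hs.2
    simp [slope, this]
  have hd2 := hFd.norm_sq.add hd1
  -- the remainder
  have hd3 : HasDerivWithinAt
      (fun s => (∫ x, J s x * ‖f s x‖ ^ 2 ∂μ) - (‖F s‖ ^ 2 + (s - t) * inner ℝ (M (F s)) (F s)))
      0 I t := by
    have hrem : ∀ ε > 0, ∀ᶠ s in 𝓝[I] t,
        |(∫ x, J s x * ‖f s x‖ ^ 2 ∂μ) - (‖F s‖ ^ 2 + (s - t) * inner ℝ (M (F s)) (F s))|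
          ≤ ε * |s - t| * ‖F s‖ ^ 2 := by
      intro ε hε
      filter_upwards [hJ ε hε, self_mem_nhdsWithin] with s hs hsI
      have hb : ∀ᵐ x ∂μ, ‖J s x * ‖f s x‖ ^ 2 - (‖f s x‖ ^ 2 + (s - t) * (c x * ‖f s x‖ ^ 2))‖
          ≤ ε * |s - t| * ‖f s x‖ ^ 2 := by
        filter_upwards [hs] with x hx
        have : J s x * ‖f s x‖ ^ 2 - (‖f s x‖ ^ 2 + (s - t) * (c x * ‖f s x‖ ^ 2))
            = (J s x - 1 - (s - t) * c x) * ‖f s x‖ ^ 2 := by ring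
        rw [this, norm_mul, Real.norm_eq_abs, norm_pow, norm_norm]
        gcongr
      have hi2 : Integrable (fun x => ‖f s x‖ ^ 2 + (s - t) * (c x * ‖f s x‖ ^ 2)) μ :=
        (hint s hsI).add ((hintc s hsI).const_mul _)
      have hi1 : Integrable (fun x => J s x * ‖f s x‖ ^ 2) μ := by
        have h3 : Integrable (fun x => J s x * ‖f s x‖ ^ 2
            - (‖f s x‖ ^ 2 + (s - t) * (c x * ‖f s x‖ ^ 2))) μ :=
          ((hint s hsI).const_mul (ε * |s - t|)).mono'
            (((hJm s hsI).mul (hint s hsI).1).sub hi2.1) hb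
        exact (h3.add hi2).congr (Eventually.of_forall fun x => by simp)
      rw [hsq s hsI, hQ s hsI, ← integral_const_mul, ← integral_add (hint s hsI)
        ((hintc s hsI).const_mul _), ← integral_sub hi1 hi2, ← integral_const_mul]
      exact norm_integral_le_of_norm_le ((hint s hsI).const_mul _) hb
    have ht0 : (∫ x, J t x * ‖f t x‖ ^ 2 ∂μ) - (‖F t‖ ^ 2 + (t - t) * inner ℝ (M (F t)) (F t))
        = 0 := by
      have := mem_of_mem_nhdsWithin ht (hrem 1 one_pos)
      simpa using this
    rw [hasDerivWithinAt_iff_isLittleO]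
    simp only [ht0, sub_zero, smul_zero]
    rw [Asymptotics.isLittleO_iff]
    intro ε hε
    have hbd : ∀ᶠ s in 𝓝[I] t, ‖F s‖ ^ 2 < ‖F t‖ ^ 2 + 1 :=
      (hFd.continuousWithinAt.norm.pow 2).eventually (gt_mem_nhds (by simp))
    have hpos : 0 < ‖F t‖ ^ 2 + 1 := by positivity
    filter_upwards [hrem (ε / (‖F t‖ ^ 2 + 1)) (by positivity), hbd] with s h1 h2
    rw [Real.norm_eq_abs, Real.norm_eq_abs]
    refine h1.trans ?_
    calc ε / (‖F t‖ ^ 2 + 1) * |s - t| * ‖F s‖ ^ 2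
        ≤ ε / (‖F t‖ ^ 2 + 1) * |s - t| * (‖F t‖ ^ 2 + 1) := by gcongr
      _ = ε * |s - t| := by field_simp
  have hsum := hd3.add hd2
  refine (hsum.congr (f₁ := fun s => ∫ x, J s x * ‖f s x‖ ^ 2 ∂μ) (fun s _ => by simp)
    (by simp)).congr_deriv ?_
  rw [hQ t ht, L2_inner_eq_integral (hF t ht) hf'.coeFn_toLp]
  ring

theorem hasDerivWithinAt_integral_norm_sq {I : Set ℝ} {t : ℝ} (ht : t ∈ I)
    {f : ℝ → α → E} {f' : α → E}
    (hf : ∀ s ∈ I, MemLp (f s) 2 μ) (hf' : MemLp f' 2 μ)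
    (hlim : Tendsto (fun s => eLpNorm (fun x => (s - t)⁻¹ • (f s x - f t x) - f' x) 2 μ)
      (𝓝[I \ {t}] t) (𝓝 0)) :
    HasDerivWithinAt (fun s => ∫ x, ‖f s x‖ ^ 2 ∂μ) (2 * ∫ x, inner ℝ (f t x) (f' x) ∂μ) I t := by
  have := hasDerivWithinAt_integral_mul_norm_sq ht hf hf' hlim (J := fun _ _ => 1) (c := fun _ => 0)
    MemLp.zero' (fun _ _ => aestronglyMeasurable_const)
    (fun ε hε => Eventually.of_forall fun s => Eventually.of_forall fun x => by simp; positivity)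
  simpa using this

end L2

/-! ### The strain energy along a motion of the solid -/

section Average

variable {α E : Type*} [MeasurableSpace α] {μ : Measure α} [NormedAddCommGroup E]

/-- Pointwise bounds pass to limits in `L²`. -/
theorem isClosed_setOf_ae_norm_le (M : ℝ) : IsClosed {F : Lp E 2 μ | ∀ᵐ x ∂μ, ‖F x‖ ≤ M} := by
  refine IsSeqClosed.isClosed fun F G hF hG => ?_
  have hF' : ∀ n, ∀ᵐ x ∂μ, ‖F n x‖ ≤ M := hF
  change ∀ᵐ x ∂μ, ‖G x‖ ≤ M
  have h1 : Tendsto (fun n => eLpNorm (⇑(F n) - ⇑G) 2 μ) atTop (𝓝 0) :=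
    (Lp.tendsto_Lp_iff_tendsto_eLpNorm' F G).1 hG
  have h2 : TendstoInMeasure μ (fun n => (F n : α → E)) atTop G :=
    tendstoInMeasure_of_tendsto_eLpNorm (by norm_num) (fun n => (Lp.memLp (F n)).1)
      (Lp.memLp G).1 h1
  obtain ⟨ns, -, hns⟩ := h2.exists_seq_tendsto_ae
  filter_upwards [hns, ae_all_iff.2 hF'] with x hx hb
  exact le_of_tendsto hx.norm (Eventually.of_forall fun n => hb (ns n))

variable [NormedSpace ℝ E]

theorem convex_setOf_ae_norm_le (M : ℝ) : Convex ℝ {F : Lp E 2 μ | ∀ᵐ x ∂μ, ‖F x‖ ≤ M} := by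
  intro F (hF : ∀ᵐ x ∂μ, ‖F x‖ ≤ M) G (hG : ∀ᵐ x ∂μ, ‖G x‖ ≤ M) a b ha hb hab
  change ∀ᵐ x ∂μ, ‖(a • F + b • G : Lp E 2 μ) x‖ ≤ M
  filter_upwards [hF, hG, Lp.coeFn_add (a • F) (b • G), Lp.coeFn_smul a F, Lp.coeFn_smul b G]
    with x h1 h2 h3 h4 h5
  rw [h3, Pi.add_apply, h4, h5, Pi.smul_apply, Pi.smul_apply]
  have := convex_closedBall (0 : E) M (mem_closedBall_zero_iff.2 h1) (mem_closedBall_zero_iff.2 h2)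
    ha hb hab
  exact mem_closedBall_zero_iff.1 this

/-- A pointwise bound of the integrand passes to the `L²`-valued integral: its mean lies in the
closed convex set of functions obeying the bound. -/
theorem ae_norm_intervalIntegral_le [CompleteSpace E] {G : ℝ → Lp E 2 μ} (hG : Continuous G) {M : ℝ}
    (hM : ∀ τ, ∀ᵐ x ∂μ, ‖G τ x‖ ≤ M) {a b : ℝ} :
    ∀ᵐ x ∂μ, ‖(∫ τ in a..b, G τ : Lp E 2 μ) x‖ ≤ M * |b - a| := by
  wlog hab : a ≤ b generalizing a b
  · have h := this (le_of_not_ge hab)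
    rw [intervalIntegral.integral_symm, abs_sub_comm]
    filter_upwards [h, Lp.coeFn_neg (∫ τ in b..a, G τ : Lp E 2 μ)] with x h1 h2
    rw [h2, Pi.neg_apply, norm_neg]; exact h1
  rcases hab.eq_or_lt with rfl | hlt
  · rw [intervalIntegral.integral_same]
    filter_upwards [Lp.coeFn_zero E 2 μ] with x hx
    rw [hx]; simp
  have hmem : ∀ S : Set (Lp E 2 μ), Convex ℝ S → IsClosed S → (∀ τ, G τ ∈ S) →
      (b - a)⁻¹ • (∫ τ in a..b, G τ) ∈ S := by
    intro S hS hSc hGS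
    rw [← interval_average_eq, uIoc_of_le hab]
    exact hS.set_average_mem hSc (by simp [hlt]) (by simp) (Eventually.of_forall hGS)
      ((hG.integrableOn_Icc).mono_set Ioc_subset_Icc_self)
  have hmem' : ∀ᵐ x ∂μ, ‖((b - a)⁻¹ • (∫ τ in a..b, G τ) : Lp E 2 μ) x‖ ≤ M :=
    hmem _ (convex_setOf_ae_norm_le M) (isClosed_setOf_ae_norm_le M) hM
  filter_upwards [hmem', Lp.coeFn_smul (b - a)⁻¹ (∫ τ in a..b, G τ : Lp E 2 μ)] with x h1 h2
  have hpos : 0 < b - a := sub_pos.2 hlt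
  rw [h2, Pi.smul_apply, norm_smul, norm_inv, Real.norm_eq_abs, abs_of_pos hpos,
    inv_mul_le_iff₀ hpos] at h1
  rw [abs_of_pos hpos]; linarith

end Average


/-- Weak gradients commute with integration in time: if the weak gradients `∇v_τ` form a continuous
curve `G` in `L²(Ω)`, then `φ₀ + ∫₀ᵗ v_τ dτ` has the weak gradient `∇φ₀ + ∫₀ᵗ G_τ dτ`. The time
integral of the gradients is taken in `L²(Ω)`, because the representatives `weakGrad Ω (v τ)`
need not be jointly measurable in space and time. -/
theorem hasWeakGrad_add_intervalIntegral {Ω : Set (Vec d)} (hΩ : IsOpen Ω)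
    (hb : Bornology.IsBounded Ω) {T : ℝ} {φ₀ : Vec d → Vec d} {v : ℝ → Vec d → Vec d}
    (hφ₀ : HasWeakGrad Ω φ₀ (weakGrad Ω φ₀))
    (hcont : ContinuousOn (fun tz : ℝ × Vec d => v tz.1 tz.2) (Icc 0 T ×ˢ closure Ω))
    (hv : ∀ t ∈ Icc 0 T, HasWeakGrad Ω (v t) (weakGrad Ω (v t)))
    {E₀ : Lp (Tensor d) 2 (volume.restrict Ω)} (hE₀ : E₀ =ᵐ[volume.restrict Ω] weakGrad Ω φ₀)
    {G : ℝ → Lp (Tensor d) 2 (volume.restrict Ω)} (hG : Continuous G)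
    (hGv : ∀ t ∈ Icc 0 T, G t =ᵐ[volume.restrict Ω] weakGrad Ω (v t)) {t : ℝ} (ht : t ∈ Icc 0 T) :
    HasWeakGrad Ω (fun z => φ₀ z + ∫ τ in (0 : ℝ)..t, v τ z) (E₀ + ∫ τ in (0 : ℝ)..t, G τ :) := by
  have hfin : IsFiniteMeasure (volume.restrict Ω) :=
    ⟨by simpa using hb.measure_lt_top⟩
  set ν := (volume : Measure ℝ).restrict (Ioc 0 t) with hν
  have hsub : Ioc 0 t ×ˢ Ω ⊆ Icc 0 T ×ˢ closure Ω :=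
    prod_mono (fun s hs => ⟨hs.1.le, hs.2.trans ht.2⟩) subset_closure
  have hprod : Integrable (fun q : ℝ × Vec d => v q.1 q.2) (ν.prod (volume.restrict Ω)) := by
    have hK : IsCompact (Icc 0 T ×ˢ closure Ω) := isCompact_Icc.prod hb.isCompact_closure
    obtain ⟨C, hC⟩ := hK.exists_bound_of_continuousOn hcont
    rw [hν, Measure.prod_restrict]
    refine IntegrableOn.mono_set ?_ hsub
    exact hcont.integrableOn_compact hK
  have hvint : Integrable (fun z => ∫ τ in (0 : ℝ)..t, v τ z) (volume.restrict Ω) := by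
    have := hprod.swap.integral_prod_left
    refine this.congr (Eventually.of_forall fun z => ?_)
    simp [intervalIntegral.integral_of_le ht.1, hν]
  have hLint : ∀ F : Lp (Tensor d) 2 (volume.restrict Ω),
      Integrable F (volume.restrict Ω) := fun F =>
    (Lp.memLp F).integrable (by norm_num)
  refine ⟨?_, ?_, ?_⟩
  · exact hφ₀.1.add (IntegrableOn.locallyIntegrableOn hvint)
  · exact IntegrableOn.locallyIntegrableOn (hLint _)
  intro ψ hψ hc hs i j
  have hψ' : Continuous (fun x => fderiv ℝ ψ x (EuclideanSpace.single j 1)) :=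
    (hψ.continuous_fderiv (by simp)).clm_apply continuous_const
  have hψ'c : HasCompactSupport (fun x => fderiv ℝ ψ x (EuclideanSpace.single j 1)) :=
    hc.fderiv_apply (𝕜 := ℝ) _
  obtain ⟨C, hC⟩ := hψ'c.exists_bound_of_continuous hψ'
  obtain ⟨C₂, hC₂⟩ := hc.exists_bound_of_continuous hψ.continuous
  -- testing with `ψ` is pairing with `ψ e_ij` in `L²`
  have hemem : MemLp (fun z => ψ z • (EuclideanSpace.single (i, j) (1 : ℝ) : Tensor d)) 2
      (volume.restrict Ω) :=
    MemLp.of_bound (hψ.continuous.smul continuous_const).aestronglyMeasurable C₂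
      (Eventually.of_forall fun z => by simpa [norm_smul] using hC₂ z)
  set e := hemem.toLp _ with he
  have hpair : ∀ (F : Lp (Tensor d) 2 (volume.restrict Ω)) (g : Vec d → Tensor d),
      F =ᵐ[volume.restrict Ω] g →
      (inner ℝ e F : ℝ) = ∫ z in Ω, g z (i, j) * ψ z := by
    intro F g hF
    rw [L2_inner_eq_integral hemem.coeFn_toLp hF]
    refine integral_congr_ae (Eventually.of_forall fun z => ?_)
    simp [inner_smul_left, EuclideanSpace.inner_single_left, mul_comm]
  have hφ₀int : Integrable (fun z => φ₀ z i * fderiv ℝ ψ z (EuclideanSpace.single j 1))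
      (volume.restrict Ω) := by
    have h0 : tsupport (fun x => fderiv ℝ ψ x (EuclideanSpace.single j 1)) ⊆ tsupport ψ :=
      tsupport_fderiv_apply_subset ℝ _
    have h1 : IntegrableOn (fun z => φ₀ z i * fderiv ℝ ψ z (EuclideanSpace.single j 1))
        (tsupport ψ) :=
      IntegrableOn.mul_continuousOn ((EuclideanSpace.proj (𝕜 := ℝ) i).integrable_comp
        (hφ₀.1.integrableOn_compact_subset hs hc)) hψ'.continuousOn hc
    refine IntegrableOn.of_forall_sdiff_eq_zero h1 hΩ.measurableSet fun x hx => ?_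
    rw [image_eq_zero_of_notMem_tsupport (f := fun x => fderiv ℝ ψ x (EuclideanSpace.single j 1))
      (fun h => hx.2 (h0 h)), mul_zero]
  have hvψ : Integrable (fun q : ℝ × Vec d =>
      v q.1 q.2 i * fderiv ℝ ψ q.2 (EuclideanSpace.single j 1)) (ν.prod (volume.restrict Ω)) :=
    ((EuclideanSpace.proj (𝕜 := ℝ) i).integrable_comp hprod).mul_bdd
      (hψ'.comp continuous_snd).aestronglyMeasurable (Eventually.of_forall fun q => hC q.2)
  have hinner : ∀ᵐ z ∂(volume.restrict Ω),
      (∫ τ in (0 : ℝ)..t, v τ z) i * fderiv ℝ ψ z (EuclideanSpace.single j 1)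
      = ∫ τ, v τ z i * fderiv ℝ ψ z (EuclideanSpace.single j 1) ∂ν := by
    filter_upwards [hprod.swap.prod_right_ae] with z hz
    rw [integral_mul_const, intervalIntegral.integral_of_le ht.1]
    congr 1
    exact ((EuclideanSpace.proj (𝕜 := ℝ) i).integral_comp_comm hz).symm
  have hstep : ∀ τ ∈ Ioc 0 t, ∫ z in Ω, v τ z i * fderiv ℝ ψ z (EuclideanSpace.single j 1)
      = - inner ℝ e (G τ) := by
    intro τ hτ
    have hτ' : τ ∈ Icc 0 T := ⟨hτ.1.le, hτ.2.trans ht.2⟩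
    rw [hpair _ _ (hGv τ hτ'), (hv τ hτ').2.2 ψ hψ hc hs i j]
  have hvint2 : Integrable (fun z => (∫ τ in (0 : ℝ)..t, v τ z) i
      * fderiv ℝ ψ z (EuclideanSpace.single j 1)) (volume.restrict Ω) :=
    ((EuclideanSpace.proj (𝕜 := ℝ) i).integrable_comp hvint).mul_bdd
      hψ'.aestronglyMeasurable (Eventually.of_forall hC)
  calc ∫ z in Ω, (φ₀ z + ∫ τ in (0 : ℝ)..t, v τ z) i * fderiv ℝ ψ z (EuclideanSpace.single j 1)
      = (∫ z in Ω, φ₀ z i * fderiv ℝ ψ z (EuclideanSpace.single j 1))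
        + ∫ z in Ω, (∫ τ in (0 : ℝ)..t, v τ z) i * fderiv ℝ ψ z (EuclideanSpace.single j 1) := by
        rw [← integral_add hφ₀int hvint2]
        simp only [PiLp.add_apply, add_mul]
    _ = - inner ℝ e E₀
        + ∫ τ, ∫ z, v τ z i * fderiv ℝ ψ z (EuclideanSpace.single j 1) ∂(volume.restrict Ω) ∂ν := by
        rw [hφ₀.2.2 ψ hψ hc hs i j, ← hpair _ _ hE₀, integral_congr_ae hinner]
        congr 1
        exact integral_integral_swap (f := fun a τ => v τ a i * fderiv ℝ ψ a
          (EuclideanSpace.single j 1)) hvψ.swap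
    _ = - inner ℝ e E₀ + ∫ τ in Ioc 0 t, - inner ℝ e (G τ) := by
        congr 1
        exact setIntegral_congr_fun measurableSet_Ioc hstep
    _ = - inner ℝ e (E₀ + ∫ τ in (0 : ℝ)..t, G τ) := by
        rw [inner_add_right, integral_neg, intervalIntegral.integral_of_le ht.1,
          integral_inner (𝕜 := ℝ)
            ((hG.integrableOn_Icc (a := 0) (b := t)).mono_set Ioc_subset_Icc_self) e]
        ring
    _ = _ := by rw [hpair _ _ (EventuallyEq.refl _ _)]

/-- First-order expansion of a `C¹` function, uniformly on a ball. -/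
theorem exists_forall_abs_sub_sub_inner_gradient_le {E : Type*} [NormedAddCommGroup E]
    [InnerProductSpace ℝ E] [FiniteDimensional ℝ E] {W : E → ℝ} (hW : ContDiff ℝ 1 W) (R : ℝ)
    {ε : ℝ} (hε : 0 < ε) :
    ∃ δ > 0, ∀ A ∈ Metric.closedBall (0 : E) R, ∀ B ∈ Metric.closedBall (0 : E) R,
      ‖B - A‖ < δ → |W B - W A - inner ℝ (gradient W A) (B - A)| ≤ ε * ‖B - A‖ := by
  have : CompleteSpace E := FiniteDimensional.complete ℝ E
  have hc : IsCompact (Metric.closedBall (0 : E) R) := isCompact_closedBall 0 R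
  have huc : UniformContinuousOn (fderiv ℝ W) (Metric.closedBall (0 : E) R) :=
    hc.uniformContinuousOn_of_continuous (hW.continuous_fderiv one_ne_zero).continuousOn
  obtain ⟨δ, hδ, h⟩ := Metric.uniformContinuousOn_iff.1 huc ε hε
  refine ⟨δ, hδ, fun A hA B hB hAB => ?_⟩
  have hconv : Convex ℝ (Metric.closedBall (0 : E) R ∩ Metric.ball A δ) :=
    (convex_closedBall _ _).inter (convex_ball _ _)
  have hmv := hconv.norm_image_sub_le_of_norm_hasFDerivWithin_le' (f := W) (f' := fderiv ℝ W)
    (φ := fderiv ℝ W A) (C := ε) (x := A) (y := B)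
    (fun x _ => ((hW.differentiable one_ne_zero) x).hasFDerivAt.hasFDerivWithinAt)
    (fun x hx => by
      have := h x hx.1 A hA hx.2
      rw [dist_eq_norm] at this; exact this.le)
    ⟨hA, Metric.mem_ball_self hδ⟩ ⟨hB, by rwa [Metric.mem_ball, dist_eq_norm]⟩
  rw [inner_gradient_left]
  exact hmv

theorem continuous_gradient {E : Type*} [NormedAddCommGroup E]
    [InnerProductSpace ℝ E] [CompleteSpace E] {W : E → ℝ} (hW : ContDiff ℝ 1 W) :
    Continuous (gradient W) :=
  (InnerProductSpace.toDual ℝ E).symm.continuous.comp (hW.continuous_fderiv one_ne_zero)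

/-- Chain rule for an integral functional `∫ W(E_s)` along a curve `E` that is differentiable in
`L²`, bounded, and Lipschitz in time almost everywhere in space. -/
theorem hasDerivWithinAt_integral_comp {α E : Type*} [MeasurableSpace α] {μ : Measure α}
    [IsFiniteMeasure μ] [NormedAddCommGroup E] [InnerProductSpace ℝ E] [FiniteDimensional ℝ E]
    {W : E → ℝ} (hW : ContDiff ℝ 1 W) {I : Set ℝ} {t : ℝ} (ht : t ∈ I)
    {F : ℝ → Lp E 2 μ} {F' : Lp E 2 μ} (hF : HasDerivWithinAt F F' I t) {R M : ℝ}
    (hR : ∀ s ∈ I, ∀ᵐ x ∂μ, ‖F s x‖ ≤ R)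
    (hM : ∀ s ∈ I, ∀ᵐ x ∂μ, ‖F s x - F t x‖ ≤ M * |s - t|) :
    HasDerivWithinAt (fun s => ∫ x, W (F s x) ∂μ) (∫ x, inner ℝ (gradient W (F t x)) (F' x) ∂μ)
      I t := by
  have : CompleteSpace E := FiniteDimensional.complete ℝ E
  have hcomp : IsCompact (Metric.closedBall (0 : E) R) := isCompact_closedBall 0 R
  obtain ⟨C, hC⟩ := hcomp.exists_bound_of_continuousOn (continuous_gradient hW).continuousOn
  obtain ⟨C₂, hC₂⟩ := hcomp.exists_bound_of_continuousOn hW.continuous.continuousOn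
  have hNmem : MemLp (fun x => gradient W (F t x)) 2 μ :=
    MemLp.of_bound ((continuous_gradient hW).comp_aestronglyMeasurable (Lp.memLp (F t)).1) C
      ((hR t ht).mono fun x hx => hC _ (mem_closedBall_zero_iff.2 hx))
  set N := hNmem.toLp _ with hN
  have hWint : ∀ s ∈ I, Integrable (fun x => W (F s x)) μ := fun s hs =>
    Integrable.of_bound (hW.continuous.comp_aestronglyMeasurable (Lp.memLp (F s)).1) C₂
      ((hR s hs).mono fun x hx => hC₂ _ (mem_closedBall_zero_iff.2 hx))
  have hpair : ∀ G : Lp E 2 μ, (inner ℝ N G : ℝ) = ∫ x, inner ℝ (gradient W (F t x)) (G x) ∂μ :=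
    fun G => L2_inner_eq_integral hNmem.coeFn_toLp (EventuallyEq.refl _ _)
  have hd : HasDerivWithinAt (fun s => (inner ℝ N (F s) : ℝ)) (inner ℝ N F') I t := by
    simpa using (hasDerivWithinAt_const t I N).inner ℝ hF
  have hrem : HasDerivWithinAt (fun s => (∫ x, W (F s x) ∂μ) - inner ℝ N (F s)) 0 I t := by
    rw [hasDerivWithinAt_iff_isLittleO, Asymptotics.isLittleO_iff]
    intro ε hε
    have hm : 0 ≤ μ.real univ := measureReal_nonneg
    set M' := max M 0 with hM'
    have hM'0 : 0 ≤ M' := le_max_right _ _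
    have hden : 0 < M' * μ.real univ + 1 := by positivity
    obtain ⟨δ, hδ, hδW⟩ := exists_forall_abs_sub_sub_inner_gradient_le hW R (div_pos hε hden)
    have hnear : ∀ᶠ s in 𝓝[I] t, M' * |s - t| < δ := by
      have : Tendsto (fun s => M' * |s - t|) (𝓝[I] t) (𝓝 (M' * |t - t|)) := by
        refine Continuous.tendsto' (by fun_prop) _ _ rfl |>.mono_left nhdsWithin_le_nhds
      exact this.eventually (gt_mem_nhds (by simpa using hδ))
    filter_upwards [hnear, self_mem_nhdsWithin] with s hs hsI
    have e1 : (∫ x, W (F s x) ∂μ) - inner ℝ N (F s) - ((∫ x, W (F t x) ∂μ) - inner ℝ N (F t))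
        - (s - t) • 0 = ∫ x, (W (F s x) - W (F t x)
          - inner ℝ (gradient W (F t x)) (F s x - F t x)) ∂μ := by
      have hi : ∀ G : Lp E 2 μ, Integrable (fun x => (inner ℝ (gradient W (F t x)) (G x) : ℝ)) μ :=
        fun G => integrable_inner_of_memLp hNmem (Lp.memLp G)
      simp only [inner_sub_right]
      have e2 := integral_sub ((hWint s hsI).sub (hWint t ht)) ((hi (F s)).sub (hi (F t)))
      simp only [Pi.sub_apply] at e2
      rw [e2, integral_sub (hWint s hsI) (hWint t ht), integral_sub (hi (F s)) (hi (F t)), hpair,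
        hpair, smul_zero]
      ring
    rw [e1]
    have hb : ∀ᵐ x ∂μ, ‖W (F s x) - W (F t x) - inner ℝ (gradient W (F t x)) (F s x - F t x)‖
        ≤ ε / (M' * μ.real univ + 1) * (M' * |s - t|) := by
      filter_upwards [hR s hsI, hR t ht, hM s hsI] with x h1 h2 h3
      have h4 : ‖F s x - F t x‖ ≤ M' * |s - t| :=
        h3.trans (mul_le_mul_of_nonneg_right (le_max_left _ _) (abs_nonneg _))
      refine (hδW _ (mem_closedBall_zero_iff.2 h2) _ (mem_closedBall_zero_iff.2 h1)
        (h4.trans_lt hs)).trans ?_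
      gcongr
    refine (norm_integral_le_of_norm_le_const hb).trans ?_
    rw [Real.norm_eq_abs]
    calc ε / (M' * μ.real univ + 1) * (M' * |s - t|) * μ.real univ
        = ε * |s - t| * (M' * μ.real univ / (M' * μ.real univ + 1)) := by ring
      _ ≤ ε * |s - t| * 1 := by
        gcongr
        rw [div_le_one hden]; linarith
      _ = ε * |s - t| := mul_one _
  have := hrem.add hd
  rw [← hpair, ← zero_add (inner ℝ N F')]
  exact this.congr_of_mem (fun s _ => by simp) ht


/-- Power of the elastic forces: `d/dt I_s(φ) = ∫ (∂W/∂F)(∇φ) : ∇v`. -/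
theorem hasDerivWithinAt_strainEnergy {Ω : Set (Vec d)} (hΩ : IsOpen Ω)
    (hb : Bornology.IsBounded Ω) {W : Tensor d → ℝ} (hW : ContDiff ℝ 1 W) {T : ℝ}
    {φ₀ : Vec d → Vec d} {v : ℝ → Vec d → Vec d} (hφ₀ : MemW1inf Ω φ₀)
    (hv : ∀ t ∈ Icc 0 T, MemW1inf Ω (v t))
    (hcont : ContinuousOn (fun tz : ℝ × Vec d => v tz.1 tz.2) (Icc 0 T ×ˢ closure Ω))
    {M : ℝ} (hM : ∀ t ∈ Icc 0 T, ∀ᵐ z ∂(volume.restrict Ω), ‖weakGrad Ω (v t) z‖ ≤ M)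
    (hgrad : ∀ t ∈ Icc 0 T, Tendsto (fun s => eLpNorm (fun z => weakGrad Ω (v s) z
      - weakGrad Ω (v t) z) 2 (volume.restrict Ω)) (𝓝[Icc 0 T] t) (𝓝 0))
    {t : ℝ} (ht : t ∈ Icc 0 T) :
    HasDerivWithinAt
      (fun s => strainEnergy W Ω (fun z => φ₀ z + ∫ τ in (0 : ℝ)..s, v τ z))
      (∫ z in Ω, inner ℝ (gradient W (weakGrad Ω (fun z => φ₀ z + ∫ τ in (0 : ℝ)..t, v τ z) z))
        (weakGrad Ω (v t) z)) (Icc 0 T) t := by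
  have hT : 0 ≤ T := ht.1.trans ht.2
  have hfin : IsFiniteMeasure (volume.restrict Ω) := ⟨by simpa using hb.measure_lt_top⟩
  have hmem : ∀ s ∈ Icc 0 T, MemLp (weakGrad Ω (v s)) 2 (volume.restrict Ω) := fun s hs =>
    (hv s hs).2.2.2.mono_exponent le_top
  have hmem₀ : MemLp (weakGrad Ω φ₀) 2 (volume.restrict Ω) := hφ₀.2.2.2.mono_exponent le_top
  let G₀ : Icc 0 T → Lp (Tensor d) 2 (volume.restrict Ω) := fun s => (hmem s s.2).toLp _
  have hG₀ : Continuous G₀ := by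
    rw [continuous_iff_continuousAt]
    intro s
    rw [ContinuousAt, Lp.tendsto_Lp_iff_tendsto_eLpNorm']
    have h1 := (hgrad s s.2).comp (tendsto_nhdsWithin_iff.2
      ⟨(continuous_subtype_val (p := fun r => r ∈ Icc 0 T)).tendsto s,
        Eventually.of_forall fun r => r.2⟩)
    refine h1.congr fun r => eLpNorm_congr_ae ?_
    filter_upwards [(hmem r r.2).coeFn_toLp, (hmem s s.2).coeFn_toLp] with x h2 h3
    simp only [Pi.sub_apply, G₀, h2, h3]
  -- `∇v` as a curve in `L²`, constant outside `[0, T]`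
  let G : ℝ → Lp (Tensor d) 2 (volume.restrict Ω) := IccExtend hT G₀
  have hG : Continuous G := hG₀.Icc_extend'
  have hGv : ∀ s ∈ Icc 0 T, G s =ᵐ[volume.restrict Ω] weakGrad Ω (v s) := by
    intro s hs
    have : G s = (hmem s hs).toLp _ := IccExtend_of_mem hT G₀ hs
    rw [this]; exact (hmem s hs).coeFn_toLp
  have hGM : ∀ τ, ∀ᵐ x ∂(volume.restrict Ω), ‖G τ x‖ ≤ M := by
    intro τ
    filter_upwards [(hmem _ (projIcc 0 T hT τ).2).coeFn_toLp, hM _ (projIcc 0 T hT τ).2]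
      with x h1 h2
    change ‖(hmem _ (projIcc 0 T hT τ).2).toLp _ x‖ ≤ M
    rw [h1]; exact h2
  let E₀ : Lp (Tensor d) 2 (volume.restrict Ω) := hmem₀.toLp _
  let F : ℝ → Lp (Tensor d) 2 (volume.restrict Ω) := fun s => E₀ + ∫ τ in (0 : ℝ)..s, G τ
  have hFd : HasDerivWithinAt F (G t) (Icc 0 T) t := by
    have := (hG.integral_hasStrictDerivAt 0 t).hasDerivAt.const_add E₀
    exact this.hasDerivWithinAt
  have hFgrad : ∀ s ∈ Icc 0 T,
      weakGrad Ω (fun z => φ₀ z + ∫ τ in (0 : ℝ)..s, v τ z) =ᵐ[volume.restrict Ω] F s :=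
    fun s hs => (hasWeakGrad_add_intervalIntegral hΩ hb (hasWeakGrad_weakGrad hφ₀.2.1) hcont
      (fun r hr => hasWeakGrad_weakGrad (hv r hr).2.1) hmem₀.coeFn_toLp hG hGv hs).weakGrad_ae_eq hΩ
  have hM0 : ∀ᵐ x ∂(volume.restrict Ω), ‖weakGrad Ω φ₀ x‖
      ≤ (eLpNorm (weakGrad Ω φ₀) ⊤ (volume.restrict Ω)).toReal := by
    have h := ae_le_eLpNormEssSup (f := weakGrad Ω φ₀) (μ := volume.restrict Ω)
    filter_upwards [h] with x hx
    rw [← eLpNorm_exponent_top] at hx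
    have := ENNReal.toReal_mono hφ₀.2.2.2.2.ne hx
    simpa using this
  have hdiff : ∀ a b, ∀ᵐ x ∂(volume.restrict Ω), ‖F b x - F a x‖ ≤ M * |b - a| := by
    intro a b
    have h1 : F b - F a = ∫ τ in a..b, G τ := by
      have := intervalIntegral.integral_add_adjacent_intervals (hG.intervalIntegrable 0 a)
        (hG.intervalIntegrable (μ := volume) a b)
      simp only [F]; rw [← this]; abel
    filter_upwards [ae_norm_intervalIntegral_le hG hGM (a := a) (b := b), Lp.coeFn_sub (F b) (F a)]
      with x h2 h3
    rw [← h1, h3] at h2; exact h2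
  have hF0 : F 0 = E₀ := by simp [F]
  have hFR : ∀ s ∈ Icc 0 T, ∀ᵐ x ∂(volume.restrict Ω), ‖F s x‖
      ≤ (eLpNorm (weakGrad Ω φ₀) ⊤ (volume.restrict Ω)).toReal + |M| * T := by
    intro s hs
    filter_upwards [hM0, hdiff 0 s, hmem₀.coeFn_toLp] with x h1 h2 h3
    rw [hF0] at h2
    have h4 : ‖E₀ x‖ ≤ (eLpNorm (weakGrad Ω φ₀) ⊤ (volume.restrict Ω)).toReal := by
      simp only [E₀]; rw [h3]; exact h1
    have h5 : M * |s - 0| ≤ |M| * T := by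
      rw [sub_zero, abs_of_nonneg hs.1]
      exact mul_le_mul (le_abs_self M) hs.2 hs.1 (abs_nonneg M)
    calc ‖F s x‖ = ‖E₀ x + (F s x - E₀ x)‖ := by simp
      _ ≤ ‖E₀ x‖ + ‖F s x - E₀ x‖ := norm_add_le _ _
      _ ≤ _ := by linarith
  have key := hasDerivWithinAt_integral_comp hW ht hFd hFR (fun s _ => hdiff t s)
  refine (key.congr (f₁ := fun s => strainEnergy W Ω (fun z => φ₀ z + ∫ τ in (0 : ℝ)..s, v τ z))
    (fun s hs => ?_) ?_).congr_deriv ?_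
  · refine integral_congr_ae ?_
    filter_upwards [hFgrad s hs] with x hx
    rw [hx]
  · refine integral_congr_ae ?_
    filter_upwards [hFgrad t ht] with x hx
    rw [hx]
  · refine integral_congr_ae ?_
    filter_upwards [hFgrad t ht, hGv t ht] with x hx hx2
    rw [hx, hx2]

/-! ### Boundary estimates on Lipschitz domains -/


/-- Orthogonal coordinates along a unit vector preserve volume. -/
theorem measurePreserving_orthogonal_add_smul {e : Vec d} (he : ‖e‖ = 1) :
    MeasurePreserving (fun q : (Submodule.span ℝ {e})ᗮ × ℝ => (q.1 : Vec d) + q.2 • e)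
      (volume.prod volume) volume := by
  have h1 := ((Submodule.span ℝ {e}).measurePreserving_measurableEquivProd (0 : Vec d)).symm
  have hdim : Module.finrank ℝ (Vec d) = d := finrank_euclideanSpace_fin
  rw [InnerProductSpace.euclideanHausdorffMeasure_eq_volume] at h1
  have h2 := (LinearIsometryEquiv.toSpanUnitSingleton (𝕜 := ℝ) e he).measurePreserving
  have h3 := h2.prod (MeasurePreserving.id (volume : Measure (Submodule.span ℝ {e})ᗮ))
  have h4 := (h1.comp h3).comp
    (Measure.measurePreserving_swap (μ := (volume : Measure (Submodule.span ℝ {e})ᗮ))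
      (ν := (volume : Measure ℝ)))
  have hfun : (fun q : (Submodule.span ℝ {e})ᗮ × ℝ => (q.1 : Vec d) + q.2 • e)
      = (((Submodule.span ℝ {e}).measurableEquivProd (0 : Vec d)).symm ∘
        Prod.map (LinearIsometryEquiv.toSpanUnitSingleton (𝕜 := ℝ) e he) id) ∘ Prod.swap := by
    funext q
    simp [LinearIsometryEquiv.toSpanUnitSingleton_apply, add_comm]
  rw [hfun]
  exact h4

theorem mem_frontier_iff_of_graph {Ω : Set (Vec d)} (hΩ : IsOpen Ω) {x e : Vec d} {r : ℝ}
    {h : Vec d → ℝ} (hh : Continuous h) (he : ‖e‖ = 1)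
    (hgr : ∀ y ∈ Metric.ball x r, y ∈ Ω ↔ h (y - inner ℝ e y • e) < inner ℝ e y)
    {y : Vec d} (hy : y ∈ Metric.ball x r) :
    y ∈ frontier Ω ↔ h (y - inner ℝ e y • e) = inner ℝ e y := by
  rw [hΩ.frontier_eq]
  constructor
  · rintro ⟨hyc, hyn⟩
    rw [hgr y hy, not_lt] at hyn
    refine le_antisymm ?_ hyn
    by_contra hlt
    push Not at hlt
    have hopen : IsOpen {z : Vec d | inner ℝ e z < h (z - inner ℝ e z • e)} :=
      isOpen_lt (by fun_prop) (by fun_prop)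
    obtain ⟨z, hz, hzΩ⟩ := mem_closure_iff.1 hyc _ (hopen.inter Metric.isOpen_ball) ⟨hlt, hy⟩
    exact absurd ((hgr z hz.2).1 hzΩ) (not_lt.2 (le_of_lt hz.1))
  · intro heq
    refine ⟨?_, fun hyΩ => absurd ((hgr y hy).1 hyΩ) (by rw [heq]; exact lt_irrefl _)⟩
    have hlim : Tendsto (fun δ : ℝ => y + δ • e) (𝓝[>] 0) (𝓝 y) := by
      refine (Continuous.tendsto' (by fun_prop) _ _ (by simp)).mono_left nhdsWithin_le_nhds
    refine mem_closure_of_tendsto hlim ?_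
    filter_upwards [hlim.eventually (Metric.isOpen_ball.mem_nhds hy), self_mem_nhdsWithin]
      with δ h1 h2
    rw [hgr _ h1]
    have h3 : (inner ℝ e (y + δ • e) : ℝ) = inner ℝ e y + δ := by
      rw [inner_add_right, inner_smul_right, real_inner_self_eq_norm_sq, he]; ring
    have h4 : y + δ • e - (inner ℝ e y + δ) • e = y - inner ℝ e y • e := by
      rw [add_smul]; abel
    rw [h3, h4, heq]
    exact lt_add_of_pos_right _ h2

/-- The part of the surface measure seen by the orthogonal projection along `e`: the image of
`(d-1)`-dimensional Lebesgue measure under a parametrization as a graph is at most the surface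
measure, since the projection onto the hyperplane does not increase Hausdorff measure. -/
theorem map_graph_le_surf {Ω : Set (Vec d)} {e : Vec d} (he : ‖e‖ = 1)
    {g : (Submodule.span ℝ {e})ᗮ → Vec d} (hg : Continuous g)
    (hgp : ∀ y, ((Submodule.span ℝ {e})ᗮ).orthogonalProjectionOnto (g y) = y)
    {A : Set (Submodule.span ℝ {e})ᗮ} (hA : ∀ y ∈ A, g y ∈ frontier Ω) :
    (volume.restrict A).map g ≤ surf Ω := by
  have hdim : Module.finrank ℝ (Submodule.span ℝ {e})ᗮ = d - 1 := by
    have h1 := (Submodule.span ℝ {e}).finrank_add_finrank_orthogonal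
    have h2 : Module.finrank ℝ (Submodule.span ℝ {e}) = 1 :=
      finrank_span_singleton (by rintro rfl; simp at he)
    rw [h2, finrank_euclideanSpace_fin] at h1
    omega
  refine Measure.le_iff.2 fun s hs => ?_
  rw [Measure.map_apply hg.measurable hs, Measure.restrict_apply (hg.measurable hs), surf,
    Measure.restrict_apply hs]
  have hvol : (volume : Measure (Submodule.span ℝ {e})ᗮ)
      = Measure.euclideanHausdorffMeasure (d - 1) := by
    rw [← InnerProductSpace.euclideanHausdorffMeasure_eq_volume, hdim]
  have hsub : g ⁻¹' s ∩ A ⊆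
      ((Submodule.span ℝ {e})ᗮ).orthogonalProjectionOnto '' (s ∩ frontier Ω) :=
    fun y hy => ⟨g y, ⟨hy.1, hA y hy.2⟩, hgp y⟩
  have hlip : LipschitzWith 1 (fun x : Vec d =>
      ((Submodule.span ℝ {e})ᗮ).orthogonalProjectionOnto x) := by
    refine ((((Submodule.span ℝ {e})ᗮ).orthogonalProjectionOnto (𝕜 := ℝ)).lipschitz).weaken ?_
    exact Submodule.orthogonalProjectionOnto_norm_le _
  refine (measure_mono hsub).trans ?_
  rw [hvol, Measure.euclideanHausdorffMeasure_def, Measure.euclideanHausdorffMeasure_def,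
    Measure.smul_apply, Measure.smul_apply]
  refine smul_le_smul_of_nonneg_left ?_ (zero_le)
  have := hlip.hausdorffMeasure_image_le (d := ((d - 1 : ℕ) : ℝ)) (by positivity) (s ∩ frontier Ω)
  simpa using this

/-- Integral over a thin neighbourhood of a Lipschitz boundary, in a coordinate patch. The measure
`ν` is `2 (1 + K)` times the image of Lebesgue measure under the graph parametrization. -/
theorem exists_lintegral_cthickening_le_local {Ω : Set (Vec d)} (hΩ : IsLipschitzDomain Ω)
    {x : Vec d} (hx : x ∈ frontier Ω) :
    ∃ ρ > 0, ∃ ν : Measure (Vec d), IsFiniteMeasure ν ∧ (∃ c : ℝ≥0, ν ≤ c • surf Ω) ∧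
      ∃ C : ℝ≥0, ∃ η₀ > 0, ∀ η, 0 < η → η < η₀ → ∀ (L : ℝ≥0) (F : Vec d → ℝ), LipschitzWith L F →
        ∫⁻ y in Metric.ball x ρ ∩ Metric.cthickening η (frontier Ω), ‖F y‖ₑ
          ≤ ENNReal.ofReal η * (∫⁻ y, ‖F y‖ₑ ∂ν) + C * L * ENNReal.ofReal η ^ 2 := by
  obtain ⟨hopen, hbdd, hloc⟩ := hΩ
  obtain ⟨e, r, K, h, he, hr, hh, hgr⟩ := hloc x hx
  have hfc : IsCompact (frontier Ω) :=
    (hbdd.isCompact_closure).of_isClosed_subset isClosed_frontier frontier_subset_closure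
  have hee : (inner ℝ e e : ℝ) = 1 := by rw [real_inner_self_eq_norm_sq, he]; norm_num
  have hproj : ∀ z : Vec d, ((Submodule.span ℝ {e})ᗮ.orthogonalProjectionOnto z : Vec d)
      = z - inner ℝ e z • e := by
    intro z
    rw [Submodule.coe_orthogonalProjectionOnto_apply, Submodule.starProjection_orthogonal_val,
      Submodule.starProjection_unit_singleton ℝ he]
  set S := (Submodule.span ℝ {e})ᗮ with hS
  have hey : ∀ y : S, (inner ℝ e (y : Vec d) : ℝ) = 0 := fun y =>
    (Submodule.mem_orthogonal_singleton_iff_inner_right).1 y.2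
  let g : S → Vec d := fun y => (y : Vec d) + h y • e
  have hg : Continuous g := by
    have := hh.continuous; fun_prop
  have hgp : ∀ y, S.orthogonalProjectionOnto (g y) = y := by
    intro y
    have h1 : S.orthogonalProjectionOnto e = 0 := by
      rw [Submodule.orthogonalProjectionOnto_eq_zero_iff, hS, Submodule.orthogonal_orthogonal]
      exact Submodule.mem_span_singleton_self e
    simp only [g, map_add, map_smul, h1, smul_zero, add_zero]
    exact Submodule.orthogonalProjectionOnto_mem_subspace_eq_self y
  let A : Set S := g ⁻¹' Metric.ball x r
  have hAm : MeasurableSet A := (Metric.isOpen_ball.preimage hg).measurableSet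
  have hAfr : ∀ y ∈ A, g y ∈ frontier Ω := by
    intro y hy
    rw [mem_frontier_iff_of_graph hopen hh.continuous he hgr hy]
    simp [g, inner_add_right, inner_smul_right, hey, he]
  have hAfin : volume A < ⊤ := by
    have hAb : Bornology.IsBounded A := by
      refine (Metric.isBounded_closedBall (x := (0 : S)) (r := ‖x‖ + r)).subset fun y hy => ?_
      rw [mem_closedBall_zero_iff]
      have h1 : ‖g y‖ ≤ ‖x‖ + r := by
        have : ‖g y - x‖ < r := by rw [← dist_eq_norm]; exact hy
        calc ‖g y‖ = ‖x + (g y - x)‖ := by simp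
          _ ≤ ‖x‖ + ‖g y - x‖ := norm_add_le _ _
          _ ≤ _ := by linarith
      calc ‖y‖ = ‖S.orthogonalProjectionOnto (g y)‖ := by rw [hgp]
        _ ≤ ‖g y‖ := S.norm_orthogonalProjectionOnto_apply_le _
        _ ≤ _ := h1
    exact hAb.measure_lt_top
  have hAfin' : IsFiniteMeasure (volume.restrict A) := ⟨by simpa using hAfin⟩
  refine ⟨r / 2, by positivity, (2 * (1 + K) : ℝ≥0) • (volume.restrict A).map g, ?_,
    ⟨2 * (1 + K), ?_⟩, 2 * (1 + K) * (1 + K) * (volume A).toNNReal, r / (2 * (1 + K)),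
    by positivity,
    fun η hη hηr L F hF => ?_⟩
  · infer_instance
  · have := map_graph_le_surf he hg hgp hAfr
    refine Measure.le_iff.2 fun s _ => ?_
    rw [Measure.smul_apply, Measure.smul_apply]
    exact smul_le_smul_of_nonneg_left (this s) zero_le
  set η' : ℝ := (1 + K) * η with hη'
  have hK : (0 : ℝ) ≤ K := K.2
  have hη'0 : 0 ≤ η' := by positivity
  have hη'r : η' < r / 2 := by
    rw [lt_div_iff₀ (by positivity)] at hηr
    rw [hη']; linarith
  have hηη' : η ≤ η' := by rw [hη']; nlinarith
  -- points close to the boundary lie in a thin strip around the graph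
  have hstrip : ∀ y : S, ∀ s : ℝ, (y : Vec d) + s • e ∈
      Metric.ball x (r / 2) ∩ Metric.cthickening η (frontier Ω) → |s - h y| ≤ η' := by
    rintro y s ⟨h1, h2⟩
    rw [hfc.cthickening_eq_biUnion_closedBall hη.le] at h2
    simp only [mem_iUnion, Metric.mem_closedBall, exists_prop] at h2
    obtain ⟨b, hb, hyb⟩ := h2
    have hbr : b ∈ Metric.ball x r := by
      rw [Metric.mem_ball] at h1 ⊢
      calc dist b x ≤ dist b (y + s • e) + dist ((y : Vec d) + s • e) x := dist_triangle _ _ _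
        _ < r := by rw [dist_comm b]; linarith
    rw [mem_frontier_iff_of_graph hopen hh.continuous he hgr hbr] at hb
    have h3 : |s - inner ℝ e b| ≤ η := by
      have : s - inner ℝ e b = inner ℝ e ((y : Vec d) + s • e - b) := by
        rw [inner_sub_right, inner_add_right, inner_smul_right, hey, hee]; ring
      rw [this]
      calc |inner ℝ e ((y : Vec d) + s • e - b)| ≤ ‖e‖ * ‖(y : Vec d) + s • e - b‖ :=
            abs_real_inner_le_norm _ _
        _ ≤ η := by rw [he, one_mul, ← dist_eq_norm]; exact hyb
    have h4 : |h (b - inner ℝ e b • e) - h y| ≤ K * η := by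
      rw [← Real.dist_eq]
      refine (hh.dist_le_mul _ _).trans ?_
      gcongr
      rw [dist_eq_norm]
      have h5 : ((y : Vec d) - (b - inner ℝ e b • e)) =
          S.orthogonalProjectionOnto ((y : Vec d) + s • e - b) := by
        rw [hproj, inner_sub_right, inner_add_right, inner_smul_right, hey, hee, zero_add, mul_one,
          sub_smul]
        abel
      rw [norm_sub_rev, h5]
      calc ‖((S.orthogonalProjectionOnto ((y : Vec d) + s • e - b) : S) : Vec d)‖
          ≤ ‖(y : Vec d) + s • e - b‖ := S.norm_orthogonalProjectionOnto_apply_le _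
        _ ≤ η := by rw [← dist_eq_norm]; exact hyb
    rw [hb] at h4
    calc |s - h y| ≤ |s - inner ℝ e b| + |inner ℝ e b - h y| := abs_sub_le _ _ _
      _ ≤ η' := by rw [hη']; linarith
  have hFm : Measurable fun y : Vec d => ‖F y‖ₑ := hF.continuous.measurable.enorm
  have hmp := measurePreserving_orthogonal_add_smul he
  set N := Metric.ball x (r / 2) ∩ Metric.cthickening η (frontier Ω) with hN
  have hNm : MeasurableSet N :=
    Metric.isOpen_ball.measurableSet.inter Metric.isClosed_cthickening.measurableSet
  have hpt : ∀ q : S × ℝ, N.indicator (fun y => ‖F y‖ₑ) ((q.1 : Vec d) + q.2 • e) ≤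
      A.indicator (fun y => ‖F (g y)‖ₑ + L * ENNReal.ofReal η') q.1 *
        (Icc (h q.1 - η') (h q.1 + η')).indicator 1 q.2 := by
    rintro ⟨y, s⟩
    by_cases hq : (y : Vec d) + s • e ∈ N
    · have h1 := hstrip y s hq
      have hdist : dist ((y : Vec d) + s • e) (g y) ≤ η' := by
        rw [dist_eq_norm]
        have : (y : Vec d) + s • e - g y = (s - h y) • e := by
          simp only [g, sub_smul]; abel
        rw [this, norm_smul, he, mul_one]; exact h1
      have hyA : y ∈ A := by
        change g y ∈ Metric.ball x r
        have := hq.1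
        rw [Metric.mem_ball] at this ⊢
        calc dist (g y) x ≤ dist (g y) (y + s • e) + dist ((y : Vec d) + s • e) x :=
              dist_triangle _ _ _
          _ < r := by rw [dist_comm (g y)]; linarith
      have hs : s ∈ Icc (h y - η') (h y + η') := by
        rw [abs_le] at h1; constructor <;> linarith [h1.1, h1.2]
      simp only [indicator_of_mem hq, indicator_of_mem hyA, indicator_of_mem hs, Pi.one_apply,
        mul_one]
      have h2 : F (y + s • e) = F (g y) + (F (y + s • e) - F (g y)) := by ring
      rw [h2]
      refine (enorm_add_le _ _).trans ?_
      gcongr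
      rw [← edist_eq_enorm_sub]
      refine (hF _ _).trans ?_
      gcongr
      rw [edist_dist]
      exact ENNReal.ofReal_le_ofReal hdist
    · rw [indicator_of_notMem hq]; exact zero_le
  have hFg : Measurable fun y : S => ‖F (g y)‖ₑ + L * ENNReal.ofReal η' :=
    (hFm.comp hg.measurable).add_const _
  calc ∫⁻ y in N, ‖F y‖ₑ = ∫⁻ y, N.indicator (fun y => ‖F y‖ₑ) y := (lintegral_indicator hNm _).symm
    _ = ∫⁻ q : S × ℝ, N.indicator (fun y => ‖F y‖ₑ) ((q.1 : Vec d) + q.2 • e)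
        ∂(volume.prod volume) := (hmp.lintegral_comp (hFm.indicator hNm)).symm
    _ ≤ ∫⁻ q : S × ℝ, A.indicator (fun y => ‖F (g y)‖ₑ + L * ENNReal.ofReal η') q.1 *
        (Icc (h q.1 - η') (h q.1 + η')).indicator 1 q.2 ∂(volume.prod volume) := lintegral_mono hpt
    _ ≤ ∫⁻ y : S, ∫⁻ s : ℝ, A.indicator (fun y => ‖F (g y)‖ₑ + L * ENNReal.ofReal η') y *
        (Icc (h y - η') (h y + η')).indicator 1 s := lintegral_prod_le _
    _ = ∫⁻ y : S, A.indicator (fun y => ‖F (g y)‖ₑ + L * ENNReal.ofReal η') y *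
        ENNReal.ofReal (2 * η') := by
        refine lintegral_congr fun y => ?_
        rw [lintegral_const_mul _ (measurable_one.indicator measurableSet_Icc),
          lintegral_indicator_one measurableSet_Icc, Real.volume_Icc]
        congr 2; ring
    _ = (∫⁻ y in A, (‖F (g y)‖ₑ + L * ENNReal.ofReal η')) * ENNReal.ofReal (2 * η') := by
        rw [lintegral_mul_const _ (hFg.indicator hAm), lintegral_indicator hAm]
    _ = ((∫⁻ y in A, ‖F (g y)‖ₑ) + L * ENNReal.ofReal η' * volume A) * ENNReal.ofReal (2 * η') := by
        rw [lintegral_add_right _ measurable_const, lintegral_const, Measure.restrict_apply_univ]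
    _ = _ := by
        have h1 : ENNReal.ofReal η' = (1 + K) * ENNReal.ofReal η := by
          rw [hη', ENNReal.ofReal_mul (by positivity), ENNReal.ofReal_add zero_le_one hK]
          simp
        have h2 : ENNReal.ofReal (2 * η') = 2 * ((1 + K) * ENNReal.ofReal η) := by
          rw [ENNReal.ofReal_mul (by norm_num), h1]
          simp
        rw [lintegral_smul_measure, lintegral_map hFm hg.measurable, h1, h2]
        have hVA : ((volume A).toNNReal : ENNReal) = volume A := ENNReal.coe_toNNReal hAfin.ne
        rw [ENNReal.smul_def]
        push_cast
        rw [hVA, smul_eq_mul]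
        ring

/-- Integral over a thin neighbourhood of a Lipschitz boundary, in terms of the boundary values, up
to a term of second order in the thickness. -/
theorem exists_lintegral_cthickening_le {Ω : Set (Vec d)} (hΩ : IsLipschitzDomain Ω) :
    ∃ ν : Measure (Vec d), IsFiniteMeasure ν ∧ (∃ c : ℝ≥0, ν ≤ c • surf Ω) ∧
      ∃ C : ℝ≥0, ∃ η₀ > 0, ∀ η, 0 < η → η < η₀ → ∀ (L : ℝ≥0) (F : Vec d → ℝ), LipschitzWith L F →
        ∫⁻ y in Metric.cthickening η (frontier Ω), ‖F y‖ₑ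
          ≤ ENNReal.ofReal η * (∫⁻ y, ‖F y‖ₑ ∂ν) + C * L * ENNReal.ofReal η ^ 2 := by
  have hfc : IsCompact (frontier Ω) :=
    (hΩ.2.1.isCompact_closure).of_isClosed_subset isClosed_frontier frontier_subset_closure
  have key : ∃ U : Set (Vec d), IsOpen U ∧ frontier Ω ⊆ U ∧ ∃ ν : Measure (Vec d),
      IsFiniteMeasure ν ∧ (∃ c : ℝ≥0, ν ≤ c • surf Ω) ∧
      ∃ C : ℝ≥0, ∃ η₀ > 0, ∀ η, 0 < η → η < η₀ → ∀ (L : ℝ≥0) (F : Vec d → ℝ), LipschitzWith L F →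
        ∫⁻ y in U ∩ Metric.cthickening η (frontier Ω), ‖F y‖ₑ
          ≤ ENNReal.ofReal η * (∫⁻ y, ‖F y‖ₑ ∂ν) + C * L * ENNReal.ofReal η ^ 2 := by
    refine hfc.induction_on (p := fun s => ∃ U : Set (Vec d), IsOpen U ∧ s ⊆ U ∧
      ∃ ν : Measure (Vec d), IsFiniteMeasure ν ∧ (∃ c : ℝ≥0, ν ≤ c • surf Ω) ∧
      ∃ C : ℝ≥0, ∃ η₀ > 0, ∀ η, 0 < η → η < η₀ → ∀ (L : ℝ≥0) (F : Vec d → ℝ), LipschitzWith L F →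
        ∫⁻ y in U ∩ Metric.cthickening η (frontier Ω), ‖F y‖ₑ
          ≤ ENNReal.ofReal η * (∫⁻ y, ‖F y‖ₑ ∂ν) + C * L * ENNReal.ofReal η ^ 2) ?_ ?_ ?_ ?_
    · exact ⟨∅, isOpen_empty, subset_rfl, 0, inferInstance, ⟨0, by simp⟩, 0, 1, one_pos,
        fun η _ _ L F _ => by simp⟩
    · rintro s t hst ⟨U, hU, htU, h⟩
      exact ⟨U, hU, hst.trans htU, h⟩
    · rintro s t ⟨U, hU, hsU, ν, hν, ⟨c, hc⟩, C, η₀, hη₀, h⟩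
        ⟨U', hU', hsU', ν', hν', ⟨c', hc'⟩, C', η₀', hη₀', h'⟩
      refine ⟨U ∪ U', hU.union hU', union_subset_union hsU hsU', ν + ν', inferInstance,
        ⟨c + c', by rw [add_smul]; exact add_le_add hc hc'⟩, C + C', min η₀ η₀',
        lt_min hη₀ hη₀', fun η hη hηl L F hF => ?_⟩
      have h1 := h η hη (hηl.trans_le (min_le_left _ _)) L F hF
      have h2 := h' η hη (hηl.trans_le (min_le_right _ _)) L F hF
      rw [union_inter_distrib_right, lintegral_add_measure]
      refine (lintegral_union_le _ _ _).trans ((add_le_add h1 h2).trans (le_of_eq ?_))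
      push_cast
      ring
    · intro x hx
      obtain ⟨ρ, hρ, ν, h⟩ := exists_lintegral_cthickening_le_local hΩ hx
      exact ⟨Metric.ball x ρ, mem_nhdsWithin_of_mem_nhds (Metric.ball_mem_nhds x hρ),
        Metric.ball x ρ, Metric.isOpen_ball, subset_rfl, ν, h⟩
  obtain ⟨U, hU, hsub, ν, hν, hc, C, η₀, hη₀, h⟩ := key
  obtain ⟨δ, hδ, hδU⟩ := hfc.exists_cthickening_subset_open hU hsub
  refine ⟨ν, hν, hc, C, min η₀ δ, lt_min hη₀ hδ, fun η hη hηl L F hF => ?_⟩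
  have h1 := h η hη (hηl.trans_le (min_le_left _ _)) L F hF
  rwa [inter_eq_right.2 ((Metric.cthickening_mono (hηl.trans_le (min_le_right _ _)).le _).trans
    hδU)] at h1

theorem inter_frontier_nonempty_of_isPreconnected {X : Type*} [TopologicalSpace X] {s t : Set X}
    (hs : IsPreconnected s) (h1 : (s ∩ t).Nonempty) (h2 : (s ∩ tᶜ).Nonempty) :
    (s ∩ frontier t).Nonempty := by
  by_contra hcon
  have hf : ∀ x ∈ s, x ∉ frontier t := fun x hx hxf => hcon ⟨x, hx, hxf⟩
  have hint : ∀ x ∈ s, x ∈ closure t → x ∈ interior t := fun x hx hc => by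
    by_contra h
    exact hf x hx ⟨hc, h⟩
  obtain ⟨x, hx, hxt⟩ := h1
  obtain ⟨y, hy, hyt⟩ := h2
  obtain ⟨z, -, hz1, hz2⟩ := hs (interior t) (closure t)ᶜ isOpen_interior
    isClosed_closure.isOpen_compl
    (fun z hz => (em (z ∈ closure t)).imp (hint z hz) id)
    ⟨x, hx, hint x hx (subset_closure hxt)⟩
    ⟨y, hy, fun hc => hyt (interior_subset (hint y hy hc))⟩
  exact hz2 (subset_closure (interior_subset hz1))

/-- Points whose membership in `Ω` changes under a translation are close to the boundary. -/
theorem mem_cthickening_frontier_of_add {Ω : Set (Vec d)} {x a : Vec d} {η : ℝ} (ha : ‖a‖ ≤ η)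
    (h : ¬ (x ∈ Ω ↔ x + a ∈ Ω)) : x ∈ Metric.cthickening η (frontier Ω) := by
  have hne : (segment ℝ x (x + a) ∩ frontier Ω).Nonempty := by
    have hpre : IsPreconnected (segment ℝ x (x + a)) := (convex_segment x (x + a)).isPreconnected
    by_cases hx : x ∈ Ω
    · exact inter_frontier_nonempty_of_isPreconnected hpre ⟨x, left_mem_segment ℝ _ _, hx⟩
        ⟨x + a, right_mem_segment ℝ _ _, fun h2 => h ⟨fun _ => h2, fun _ => hx⟩⟩
    · refine inter_frontier_nonempty_of_isPreconnected hpre ⟨x + a, right_mem_segment ℝ _ _, ?_⟩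
        ⟨x, left_mem_segment ℝ _ _, hx⟩
      by_contra h2
      exact h ⟨fun h3 => absurd h3 hx, fun h3 => absurd h3 h2⟩
  obtain ⟨b, hb, hbf⟩ := hne
  refine Metric.mem_cthickening_of_dist_le x b η _ hbf ?_
  obtain ⟨θ, ⟨h0, h1⟩, rfl⟩ := (segment_eq_image' ℝ x (x + a) ▸ hb :)
  have : x - (x + θ • (x + a - x)) = -(θ • a) := by
    rw [add_sub_cancel_left]; abel
  rw [dist_eq_norm, this, norm_neg, norm_smul, Real.norm_eq_abs, abs_of_nonneg h0]
  nlinarith [norm_nonneg a]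

/-- A bound of the mean of a directional derivative by the boundary values, the part of the
divergence theorem needed here. The left side is the limit of
`∫_Ω (F(x + ε a) - F(x)) / ε`, and a translation by `ε a` changes the integral of `F` over `Ω` only
through points within `ε` of the boundary. -/
theorem exists_abs_integral_lineDeriv_le {Ω : Set (Vec d)} (hΩ : IsLipschitzDomain Ω) :
    ∃ ν : Measure (Vec d), IsFiniteMeasure ν ∧ (∃ c : ℝ≥0, ν ≤ c • surf Ω) ∧
      ∀ (L : ℝ≥0) (F : Vec d → ℝ), LipschitzWith L F → ∀ a : Vec d, ‖a‖ = 1 →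
        ENNReal.ofReal |∫ x in Ω, lineDeriv ℝ F x a| ≤ ∫⁻ x, ‖F x‖ₑ ∂ν := by
  obtain ⟨ν, hν, hc, C, η₀, hη₀, h⟩ := exists_lintegral_cthickening_le hΩ
  refine ⟨ν, hν, hc, fun L F hF a ha => ?_⟩
  have hΩm := hΩ.1.measurableSet
  have hΩfin : volume Ω < ⊤ := hΩ.2.1.measure_lt_top
  have hlim := hF.integral_inv_smul_sub_mul_tendsto_integral_lineDeriv_mul (μ := volume)
    (g := Ω.indicator 1) ((integrable_indicator_iff hΩm).2 (integrableOn_const hΩfin.ne)) a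
  have hrhs : ∫ x, lineDeriv ℝ F x a * Ω.indicator 1 x = ∫ x in Ω, lineDeriv ℝ F x a := by
    rw [← integral_indicator hΩm]
    congr 1; ext x
    by_cases hx : x ∈ Ω <;> simp [hx]
  rw [hrhs] at hlim
  have hbound : ∀ᶠ t : ℝ in 𝓝[>] 0,
      ENNReal.ofReal |∫ x, (t⁻¹ • (F (x + t • a) - F x)) * Ω.indicator 1 x|
        ≤ (∫⁻ y, ‖F y‖ₑ ∂ν) + C * L * ENNReal.ofReal t := by
    filter_upwards [self_mem_nhdsWithin, Ioo_mem_nhdsGT hη₀] with t (ht0 : 0 < t) ht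
    have hFint : ∀ z : Vec d, IntegrableOn (fun x => F (x + z)) Ω := fun z =>
      ((hF.continuous.comp (continuous_add_const z)).continuousOn.integrableOn_compact
        hΩ.2.1.isCompact_closure).mono_set subset_closure
    have hF0 : Integrable (Ω.indicator F) := by
      rw [integrable_indicator_iff hΩm]; simpa using hFint 0
    have hF1 : Integrable (fun x => Ω.indicator (fun x => F (x + t • a)) x) := by
      rw [integrable_indicator_iff hΩm]; exact hFint _
    have htr : ∫ x, Ω.indicator (fun x => F (x + t • a)) x
        = ∫ x, Ω.indicator (fun x => F (x + t • a)) (x - t • a) :=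
      (integral_sub_right_eq_self _ _).symm
    have hF2 : Integrable (fun x => Ω.indicator (fun x => F (x + t • a)) (x - t • a)) :=
      hF1.comp_sub_right (t • a)
    have e1 : ∫ x, (t⁻¹ • (F (x + t • a) - F x)) * Ω.indicator 1 x
        = t⁻¹ * ∫ x, (Ω.indicator (fun x => F (x + t • a)) (x - t • a) - Ω.indicator F x) := by
      rw [integral_sub hF2 hF0, ← htr, ← integral_sub hF1 hF0, ← integral_const_mul]
      congr 1; ext x
      by_cases hx : x ∈ Ω <;> simp [hx]
    have hN : MeasurableSet (Metric.cthickening t (frontier Ω)) :=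
      Metric.isClosed_cthickening.measurableSet
    -- the integrand vanishes unless the translation moves the point across the boundary
    have e2 : ENNReal.ofReal |∫ x, (Ω.indicator (fun x => F (x + t • a)) (x - t • a)
        - Ω.indicator F x)| ≤ ∫⁻ x in Metric.cthickening t (frontier Ω), ‖F x‖ₑ := by
      rw [← Real.enorm_eq_ofReal_abs]
      refine (enorm_integral_le_lintegral_enorm _).trans ?_
      rw [← lintegral_indicator hN]
      refine lintegral_mono fun x => ?_
      by_cases hx : x ∈ Metric.cthickening t (frontier Ω)
      · rw [indicator_of_mem hx]
        by_cases h1 : x ∈ Ω <;> by_cases h2 : x - t • a ∈ Ω <;> simp [h1, h2]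
      · rw [indicator_of_notMem hx]
        have hiff : x ∈ Ω ↔ x - t • a ∈ Ω := by
          by_contra hcon
          refine hx (mem_cthickening_frontier_of_add (a := -(t • a)) ?_ ?_)
          · rw [norm_neg, norm_smul, ha, mul_one, Real.norm_eq_abs, abs_of_pos ht0]
          · rwa [← sub_eq_add_neg]
        by_cases h1 : x ∈ Ω
        · have h2 := hiff.1 h1
          simp [h1, h2]
        · have h2 : x - t • a ∉ Ω := fun h3 => h1 (hiff.2 h3)
          simp [h1, h2]
    rw [e1, abs_mul, ENNReal.ofReal_mul (abs_nonneg _), abs_of_pos (inv_pos.2 ht0),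
      ENNReal.ofReal_inv_of_pos ht0]
    have ht0' : ENNReal.ofReal t ≠ 0 := by simpa using ht0
    calc (ENNReal.ofReal t)⁻¹ * ENNReal.ofReal |∫ x, (Ω.indicator (fun x => F (x + t • a))
          (x - t • a) - Ω.indicator F x)|
        ≤ (ENNReal.ofReal t)⁻¹ * (ENNReal.ofReal t * (∫⁻ y, ‖F y‖ₑ ∂ν)
          + C * L * ENNReal.ofReal t ^ 2) := by
          gcongr
          exact e2.trans (h t ht0 ht.2 L F hF)
      _ = (ENNReal.ofReal t)⁻¹ * ENNReal.ofReal t * ((∫⁻ y, ‖F y‖ₑ ∂ν)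
          + C * L * ENNReal.ofReal t) := by ring
      _ = _ := by rw [ENNReal.inv_mul_cancel ht0' ENNReal.ofReal_ne_top, one_mul]
  have hlim1 := (ENNReal.continuous_ofReal.tendsto _).comp hlim.abs
  have hlim2 : Tendsto (fun t : ℝ => (∫⁻ y, ‖F y‖ₑ ∂ν) + C * L * ENNReal.ofReal t) (𝓝[>] 0)
      (𝓝 ((∫⁻ y, ‖F y‖ₑ ∂ν) + C * L * ENNReal.ofReal 0)) := by
    refine Tendsto.mono_left ?_ nhdsWithin_le_nhds
    refine tendsto_const_nhds.add (ENNReal.Tendsto.const_mul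
      (ENNReal.continuous_ofReal.tendsto 0) (Or.inr ?_))
    exact ENNReal.mul_ne_top ENNReal.coe_ne_top ENNReal.coe_ne_top
  have := le_of_tendsto_of_tendsto hlim1 hlim2 hbound
  simpa using this

/-- The divergence of a locally Lipschitz field has mean at most the size of its boundary values. -/
theorem exists_abs_integral_div_le {Ω : Set (Vec d)} (hΩ : IsLipschitzDomain Ω) :
    ∃ ν : Measure (Vec d), IsFiniteMeasure ν ∧ (∃ c : ℝ≥0, ν ≤ c • surf Ω) ∧
      ∀ F : Vec d → Vec d, LocallyLipschitz F →
        ENNReal.ofReal |∫ x in Ω, trTensor (classicalGrad F x)| ≤ d * ∫⁻ x, ‖F x‖ₑ ∂ν := by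
  obtain ⟨ν, hν, ⟨c, hc⟩, h⟩ := exists_abs_integral_lineDeriv_le hΩ
  refine ⟨ν, hν, ⟨c, hc⟩, fun F hF => ?_⟩
  have hΩfin : IsFiniteMeasure (volume.restrict Ω) := ⟨by simpa using hΩ.2.1.measure_lt_top⟩
  obtain ⟨R, hR⟩ := hΩ.2.1.isCompact_closure.isBounded.subset_closedBall (0 : Vec d)
  obtain ⟨K, hK⟩ := (hF.locallyLipschitzOn (s := Metric.closedBall 0 (R + 1))
    ).exists_lipschitzOnWith_of_compact (isCompact_closedBall 0 (R + 1))
  -- only the values near the closure of `Ω` matter, so `F` may be taken globally Lipschitz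
  obtain ⟨G, hG, hGF⟩ := hK.extend_finite_dimension
  have hνae : ∀ᵐ x ∂ν, x ∈ frontier Ω := by
    have h2 : ∀ᵐ x ∂(surf Ω), x ∈ frontier Ω := ae_restrict_mem isClosed_frontier.measurableSet
    have h3 : ν ≪ surf Ω := (Measure.absolutelyContinuous_of_le hc).trans
      (Measure.AbsolutelyContinuous.rfl.smul_left c)
    exact h3.ae_le h2
  have hcl : ∀ x ∈ closure Ω, x ∈ Metric.ball (0 : Vec d) (R + 1) := fun x hx => by
    have := hR hx
    rw [mem_closedBall_zero_iff] at this
    rw [mem_ball_zero_iff]; linarith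
  have hGj : ∀ j, LipschitzWith _ (fun x => G x j) := fun j =>
    (EuclideanSpace.proj (𝕜 := ℝ) j).lipschitz.comp hG
  have hint : ∀ j, IntegrableOn (fun x => lineDeriv ℝ (fun x => G x j) x
      (EuclideanSpace.single j 1)) Ω := fun j =>
    (((hGj j).memLp_lineDeriv (μ := volume) (EuclideanSpace.single j 1)).mono_measure
      Measure.restrict_le_self).integrable le_top
  have h5 : ∫ x in Ω, trTensor (classicalGrad F x)
      = ∑ j, ∫ x in Ω, lineDeriv ℝ (fun x => G x j) x (EuclideanSpace.single j 1) := by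
    rw [← integral_finsetSum _ fun j _ => hint j]
    refine integral_congr_ae ?_
    filter_upwards [ae_restrict_of_ae hG.ae_differentiableAt, ae_restrict_mem hΩ.1.measurableSet]
      with x hx hxΩ
    have hev : F =ᶠ[𝓝 x] G := by
      filter_upwards [Metric.isOpen_ball.mem_nhds (hcl x (subset_closure hxΩ))] with y hy
      exact hGF (Metric.ball_subset_closedBall hy)
    rw [trTensor]
    refine Finset.sum_congr rfl fun j _ => ?_
    have h6 : HasFDerivAt (fun x => G x j)
        ((EuclideanSpace.proj (𝕜 := ℝ) j).comp (fderiv ℝ G x)) x :=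
      (EuclideanSpace.proj (𝕜 := ℝ) j).hasFDerivAt.comp x hx.hasFDerivAt
    rw [(h6.hasLineDerivAt _).lineDeriv, classicalGrad, hev.fderiv_eq]
    rfl
  have h4 : ∀ j, ∫⁻ x, ‖G x j‖ₑ ∂ν ≤ ∫⁻ x, ‖F x‖ₑ ∂ν := fun j => by
    refine lintegral_mono_ae ?_
    filter_upwards [hνae] with x hx
    rw [hGF (Metric.ball_subset_closedBall (hcl x (frontier_subset_closure hx)))]
    exact enorm_le_iff_norm_le.2 (PiLp.norm_apply_le (G x) j)
  rw [h5]
  calc ENNReal.ofReal |∑ j, ∫ x in Ω, lineDeriv ℝ (fun x => G x j) x (EuclideanSpace.single j 1)|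
      ≤ ENNReal.ofReal (∑ j, |∫ x in Ω,
          lineDeriv ℝ (fun x => G x j) x (EuclideanSpace.single j 1)|) :=
        ENNReal.ofReal_le_ofReal (Finset.abs_sum_le_sum_abs _ _)
    _ = ∑ j, ENNReal.ofReal |∫ x in Ω,
          lineDeriv ℝ (fun x => G x j) x (EuclideanSpace.single j 1)| :=
        ENNReal.ofReal_sum_of_nonneg fun _ _ => abs_nonneg _
    _ ≤ ∑ _j : Fin d, ∫⁻ x, ‖F x‖ₑ ∂ν := Finset.sum_le_sum fun j _ =>
        (h _ _ (hGj j) _ (by simp)).trans (h4 j)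
    _ = d * ∫⁻ x, ‖F x‖ₑ ∂ν := by simp

/-! ### Transport of kinetic energy across the moving boundary -/


/-- Limit of pairings of a bounded, almost everywhere convergent sequence with a sequence that
converges in `L²`. -/
theorem tendsto_integral_inner_of_bounded {α E : Type*} [MeasurableSpace α] {μ : Measure α}
    [IsFiniteMeasure μ] [NormedAddCommGroup E] [InnerProductSpace ℝ E]
    {A : ℕ → α → E} {A₀ : α → E} {G : ℕ → α → E} {G₀ : α → E} {C : ℝ}
    (hA : ∀ n, AEStronglyMeasurable (A n) μ) (hAC : ∀ n, ∀ᵐ x ∂μ, ‖A n x‖ ≤ C)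
    (hlim : ∀ᵐ x ∂μ, Tendsto (fun n => A n x) atTop (𝓝 (A₀ x)))
    (hG : ∀ n, MemLp (G n) 2 μ) (hG₀ : MemLp G₀ 2 μ)
    (hGlim : Tendsto (fun n => eLpNorm (fun x => G n x - G₀ x) 2 μ) atTop (𝓝 0)) :
    Tendsto (fun n => ∫ x, (inner ℝ (A n x) (G n x) : ℝ) ∂μ) atTop
      (𝓝 (∫ x, inner ℝ (A₀ x) (G₀ x) ∂μ)) := by
  have hAmem : ∀ n, MemLp (A n) 2 μ := fun n => MemLp.of_bound (hA n) C (hAC n)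
  have h1 : Tendsto (fun n => ∫ x, (inner ℝ (A n x) (G₀ x) : ℝ) ∂μ) atTop
      (𝓝 (∫ x, inner ℝ (A₀ x) (G₀ x) ∂μ)) := by
    refine tendsto_integral_of_dominated_convergence (fun x => C * ‖G₀ x‖)
      (fun n => (hA n).inner hG₀.1) ((hG₀.integrable (by norm_num)).norm.const_mul C)
      (fun n => ?_) ?_
    · filter_upwards [hAC n] with x hx
      exact (norm_inner_le_norm _ _).trans (by gcongr)
    · filter_upwards [hlim] with x hx
      exact hx.inner tendsto_const_nhds
  have h2 : Tendsto (fun n => ∫ x, (inner ℝ (A n x) (G n x - G₀ x) : ℝ) ∂μ) atTop (𝓝 0) := by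
    have hL1 : Tendsto (fun n => ∫ x, ‖G n x - G₀ x‖ ∂μ) atTop (𝓝 0) := by
      have h3 : Tendsto (fun n => eLpNorm (fun x => G n x - G₀ x) 1 μ) atTop (𝓝 0) := by
        have h4 : Tendsto (fun n => eLpNorm (fun x => G n x - G₀ x) 2 μ *
            μ univ ^ (1 / (1 : ENNReal).toReal - 1 / (2 : ENNReal).toReal)) atTop (𝓝 0) := by
          have := ENNReal.Tendsto.mul_const
            (b := μ univ ^ (1 / (1 : ENNReal).toReal - 1 / (2 : ENNReal).toReal)) hGlim
            (Or.inr (ENNReal.rpow_ne_top_of_nonneg (by norm_num) (measure_ne_top μ univ)))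
          simpa using this
        exact tendsto_of_tendsto_of_tendsto_of_le_of_le tendsto_const_nhds h4 (fun _ => zero_le)
          fun n => eLpNorm_le_eLpNorm_mul_rpow_measure_univ (by norm_num) ((hG n).1.sub hG₀.1)
      have h5 := (ENNReal.tendsto_toReal ENNReal.zero_ne_top).comp h3
      refine h5.congr fun n => ?_
      have h6 := integral_norm_eq_lintegral_enorm ((hG n).1.sub hG₀.1)
      simp only [Pi.sub_apply] at h6
      rw [h6, Function.comp_apply, eLpNorm_one_eq_lintegral_enorm]
    refine squeeze_zero_norm (fun n => ?_) (by simpa using hL1.const_mul C)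
    rw [← integral_const_mul]
    refine norm_integral_le_of_norm_le
      ((((hG n).sub hG₀).integrable (by norm_num)).norm.const_mul C) ?_
    filter_upwards [hAC n] with x hx
    exact (norm_inner_le_norm _ _).trans (by gcongr)
  have h3 := h1.add h2
  rw [add_zero] at h3
  refine h3.congr fun n => ?_
  have hsub : MemLp (fun x => G n x - G₀ x) 2 μ := (hG n).sub hG₀
  rw [← integral_add (integrable_inner_of_memLp (hAmem n) hG₀)
    (integrable_inner_of_memLp (hAmem n) hsub)]
  refine integral_congr_ae (Eventually.of_forall fun x => ?_)
  simp [inner_sub_right]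

/-- Bounded truncation `r / (1 + δ r)` of `r ≥ 0`. -/
noncomputable def satur (δ r : ℝ) : ℝ := r / (1 + δ * r)

/-- Truncated flux `β(|U|²) (y - U)` of `|U|²` relative to a boundary moving with velocity `y`,
where `β` is the bounded truncation `r ↦ r / (1 + δ r)`. -/
noncomputable def saturFlux (δ : ℝ) (U y : Vec d) : Vec d := satur δ (‖U‖ ^ 2) • (y - U)

/-- The coefficients of `∇U` in the divergence of `saturFlux δ U y`. -/
noncomputable def saturFluxCoeff (δ : ℝ) (U y : Vec d) : Tensor d :=
  (2 / (1 + δ * ‖U‖ ^ 2) ^ 2) • WithLp.toLp 2 (fun ij : Fin d × Fin d => U ij.1 * (y - U) ij.2)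
    - satur δ (‖U‖ ^ 2) • idTensor d

theorem inner_saturFluxCoeff (δ : ℝ) (U y : Vec d) (G : Tensor d) :
    inner ℝ (saturFluxCoeff δ U y) G
      = 2 / (1 + δ * ‖U‖ ^ 2) ^ 2 * inner ℝ (mulVec G (y - U)) U
        - satur δ (‖U‖ ^ 2) * trTensor G := by
  rw [saturFluxCoeff, inner_sub_left, real_inner_smul_left, real_inner_smul_left, inner_idTensor,
    inner_mulVec_tensor, inner_tensor]
  congr 2
  refine Finset.sum_congr rfl fun i _ => Finset.sum_congr rfl fun j _ => ?_
  simp; ring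

theorem satur_nonneg {δ r : ℝ} (hδ : 0 ≤ δ) (hr : 0 ≤ r) : 0 ≤ satur δ r := by
  unfold satur; positivity

theorem satur_le_inv {δ r : ℝ} (hδ : 0 < δ) (hr : 0 ≤ r) : satur δ r ≤ δ⁻¹ := by
  rw [satur, div_le_iff₀ (by positivity), inv_mul_eq_div, le_div_iff₀ hδ]
  linarith

theorem satur_le_self {δ r : ℝ} (hδ : 0 ≤ δ) (hr : 0 ≤ r) : satur δ r ≤ r :=
  div_le_self hr (by nlinarith [mul_nonneg hδ hr])

theorem continuous_satur_norm_sq {δ : ℝ} (hδ : 0 ≤ δ) :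
    Continuous fun U : Vec d => satur δ (‖U‖ ^ 2) := by
  unfold satur
  refine Continuous.div (by fun_prop) (by fun_prop) fun U => ?_
  positivity

theorem continuous_saturFluxCoeff {δ : ℝ} (hδ : 0 ≤ δ) :
    Continuous fun q : Vec d × Vec d => saturFluxCoeff δ q.1 q.2 := by
  unfold saturFluxCoeff
  have h1 : Continuous fun q : Vec d × Vec d => 2 / (1 + δ * ‖q.1‖ ^ 2) ^ 2 := by
    refine Continuous.div (by fun_prop) (by fun_prop) fun U => ?_
    positivity
  have h2 : Continuous fun q : Vec d × Vec d =>
      (WithLp.toLp 2 (fun ij : Fin d × Fin d => q.1 ij.1 * (q.2 - q.1) ij.2) : Tensor d) := by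
    refine (PiLp.continuous_toLp 2 _).comp (continuous_pi fun ij => ?_)
    fun_prop
  exact (h1.smul h2).sub
    (((continuous_satur_norm_sq hδ).comp continuous_fst).smul continuous_const)

theorem norm_mul_add_le {δ B a : ℝ} (hδ : 0 < δ) (hB : 0 ≤ B) :
    a * (B + a) ≤ (B * (1 + δ⁻¹) + δ⁻¹) * (1 + δ * a ^ 2) := by
  have h1 : δ⁻¹ * δ = 1 := inv_mul_cancel₀ hδ.ne'
  have h2 : (B * (1 + δ⁻¹) + δ⁻¹) * (1 + δ * a ^ 2)
      = B + B * δ⁻¹ + B * δ * a ^ 2 + B * (δ⁻¹ * δ) * a ^ 2 + δ⁻¹ + (δ⁻¹ * δ) * a ^ 2 := by ring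
  rw [h2, h1]
  have h3 : 0 < δ⁻¹ := inv_pos.2 hδ
  have h4 : a * B ≤ B + B * 1 * a ^ 2 := by nlinarith [sq_nonneg (a - 1), sq_nonneg a]
  nlinarith [mul_nonneg hB h3.le, mul_nonneg (mul_nonneg hB hδ.le) (sq_nonneg a)]

theorem norm_toLp_mul (U z : Vec d) :
    ‖(WithLp.toLp 2 (fun ij : Fin d × Fin d => U ij.1 * z ij.2) : Tensor d)‖ = ‖U‖ * ‖z‖ := by
  rw [EuclideanSpace.norm_eq, EuclideanSpace.norm_eq, EuclideanSpace.norm_eq,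
    ← Real.sqrt_mul (by positivity)]
  congr 1
  rw [Fintype.sum_prod_type, Finset.sum_mul_sum]
  simp [mul_pow]

theorem norm_saturFluxCoeff_le {δ B : ℝ} (hδ : 0 < δ) {U y : Vec d} (hy : ‖y‖ ≤ B) :
    ‖saturFluxCoeff δ U y‖ ≤ 2 * (B * (1 + δ⁻¹) + δ⁻¹) + δ⁻¹ * ‖idTensor d‖ := by
  have hB : 0 ≤ B := (norm_nonneg y).trans hy
  have hden : 0 < 1 + δ * ‖U‖ ^ 2 := by positivity
  have hden1 : 1 ≤ 1 + δ * ‖U‖ ^ 2 := le_add_of_nonneg_right (by positivity)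
  refine (norm_sub_le _ _).trans (add_le_add ?_ ?_)
  · rw [norm_smul, norm_toLp_mul, Real.norm_eq_abs, abs_of_nonneg (by positivity)]
    have h1 : ‖U‖ * ‖y - U‖ ≤ (B * (1 + δ⁻¹) + δ⁻¹) * (1 + δ * ‖U‖ ^ 2) := by
      refine le_trans ?_ (norm_mul_add_le hδ hB)
      gcongr
      exact (norm_sub_le _ _).trans (by linarith)
    rw [div_mul_eq_mul_div, div_le_iff₀ (by positivity)]
    have hC : 0 ≤ B * (1 + δ⁻¹) + δ⁻¹ := by positivity
    nlinarith [mul_nonneg hC hden.le, mul_le_mul_of_nonneg_left hden1 (mul_nonneg hC hden.le)]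
  · rw [norm_smul, Real.norm_eq_abs, abs_of_nonneg (satur_nonneg hδ.le (by positivity))]
    gcongr
    exact satur_le_inv hδ (by positivity)

/-- The truncated flux is controlled by the distance of `U` to a value at which it vanishes: either
zero or the boundary velocity. -/
theorem norm_saturFlux_le {δ B : ℝ} (hδ : 0 < δ) {U V y : Vec d} (hy : ‖y‖ ≤ B)
    (hV : V = 0 ∨ V = y) :
    ‖saturFlux δ U y‖ ≤ (B * (1 + δ⁻¹) + δ⁻¹) * ‖U - V‖ := by
  have hB : 0 ≤ B := (norm_nonneg y).trans hy
  rw [saturFlux, norm_smul, Real.norm_eq_abs, abs_of_nonneg (satur_nonneg hδ.le (by positivity))]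
  rcases hV with rfl | rfl
  · rw [sub_zero, satur, div_mul_eq_mul_div, div_le_iff₀ (by positivity)]
    have h1 : ‖U‖ * ‖y - U‖ ≤ (B * (1 + δ⁻¹) + δ⁻¹) * (1 + δ * ‖U‖ ^ 2) := by
      refine le_trans ?_ (norm_mul_add_le hδ hB)
      gcongr
      exact (norm_sub_le _ _).trans (by linarith)
    calc ‖U‖ ^ 2 * ‖y - U‖ = ‖U‖ * (‖U‖ * ‖y - U‖) := by ring
      _ ≤ ‖U‖ * ((B * (1 + δ⁻¹) + δ⁻¹) * (1 + δ * ‖U‖ ^ 2)) := by gcongr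
      _ = _ := by ring
  · rw [norm_sub_rev]
    gcongr
    refine (satur_le_inv hδ (by positivity)).trans (le_add_of_nonneg_left (by positivity))

/-- The divergence of the truncated flux. -/
theorem trTensor_classicalGrad_saturFlux {δ : ℝ} (hδ : 0 ≤ δ) {U b : Vec d → Vec d} {x : Vec d}
    (hU : DifferentiableAt ℝ U x) (hb : DifferentiableAt ℝ b x) :
    trTensor (classicalGrad (fun x => saturFlux δ (U x) (b x)) x)
      = inner ℝ (saturFluxCoeff δ (U x) (b x)) (classicalGrad U x)
        + satur δ (‖U x‖ ^ 2) * trTensor (classicalGrad b x) := by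
  have hden : 1 + δ * ‖U x‖ ^ 2 ≠ 0 := by positivity
  have hs : HasDerivAt (satur δ) (1 / (1 + δ * ‖U x‖ ^ 2) ^ 2) (‖U x‖ ^ 2) := by
    have h1 := (hasDerivAt_id (‖U x‖ ^ 2)).div
      (((hasDerivAt_id (‖U x‖ ^ 2)).const_mul δ).const_add 1) hden
    refine h1.congr_deriv ?_
    simp only [id]; ring
  have hn : HasFDerivAt (fun x => ‖U x‖ ^ 2) (2 • (innerSL ℝ (U x)).comp (fderiv ℝ U x)) x :=
    hU.hasFDerivAt.norm_sq
  have hF := (hs.comp_hasFDerivAt x hn).smul (hb.hasFDerivAt.sub hU.hasFDerivAt)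
  have hF' : fderiv ℝ (fun x => saturFlux δ (U x) (b x)) x = _ := hF.fderiv
  rw [inner_saturFluxCoeff, inner_mulVec_tensor, Finset.sum_comm, trTensor, trTensor, trTensor,
    Finset.mul_sum, Finset.mul_sum, Finset.mul_sum, ← Finset.sum_sub_distrib,
    ← Finset.sum_add_distrib]
  refine Finset.sum_congr rfl fun j _ => ?_
  simp only [classicalGrad, hF']
  simp [PiLp.inner_apply, Finset.mul_sum, Finset.sum_mul]
  have hsum : ∀ f g : Fin d → ℝ, (∀ i, f i = g i) → ∑ i, f i = ∑ i, g i :=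
    fun f g h => Finset.sum_congr rfl fun i _ => h i
  rw [hsum _ (fun i => 2 / (1 + δ * ‖U x‖ ^ 2) ^ 2 * (fderiv ℝ U x (EuclideanSpace.single j 1) i
    * (b x j - U x j) * U x i)) fun i => by ring]
  ring

theorem continuous_classicalGrad {U : Vec d → Vec d} (hU : ContDiff ℝ 1 U) :
    Continuous (classicalGrad U) := by
  refine (PiLp.continuous_toLp 2 _).comp (continuous_pi fun ij => ?_)
  exact (EuclideanSpace.proj (𝕜 := ℝ) ij.1).continuous.comp
    ((hU.continuous_fderiv one_ne_zero).clm_apply continuous_const)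

theorem norm_classicalGrad_le {b : Vec d → Vec d} {K : ℝ≥0} (hb : LipschitzWith K b) (x : Vec d) :
    ‖classicalGrad b x‖ ≤ Real.sqrt (d * d) * K := by
  have h1 : ∀ ij, ‖classicalGrad b x ij‖ ≤ K := fun ij => by
    calc ‖classicalGrad b x ij‖ ≤ ‖fderiv ℝ b x (EuclideanSpace.single ij.2 1)‖ :=
          PiLp.norm_apply_le (fderiv ℝ b x (EuclideanSpace.single ij.2 1)) ij.1
      _ ≤ ‖fderiv ℝ b x‖ * ‖(EuclideanSpace.single ij.2 1 : Vec d)‖ :=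
          (fderiv ℝ b x).le_opNorm _
      _ ≤ K := by simpa using norm_fderiv_le_of_lipschitz ℝ hb
  rw [EuclideanSpace.norm_eq]
  calc Real.sqrt (∑ ij, ‖classicalGrad b x ij‖ ^ 2)
      ≤ Real.sqrt (∑ _ij : Fin d × Fin d, (K : ℝ) ^ 2) := by
        apply Real.sqrt_le_sqrt
        exact Finset.sum_le_sum fun ij _ => pow_le_pow_left₀ (norm_nonneg _) (h1 ij) 2
    _ = Real.sqrt (d * d) * K := by
        simp

theorem measurable_classicalGrad (b : Vec d → Vec d) : Measurable (classicalGrad b) := by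
  refine (WithLp.measurable_toLp 2 _).comp (measurable_pi_iff.2 fun ij => ?_)
  exact (EuclideanSpace.proj (𝕜 := ℝ) ij.1).continuous.measurable.comp
    (measurable_fderiv_apply_const ℝ b _)

theorem tendsto_lintegral_enorm_of_le_smul {α E : Type*} [MeasurableSpace α] [NormedAddCommGroup E]
    {ν μ : Measure α} [IsFiniteMeasure ν] {c : ℝ≥0} (hc : ν ≤ c • μ) {f : ℕ → α → E}
    (hf : ∀ n, AEStronglyMeasurable (f n) μ)
    (hlim : Tendsto (fun n => eLpNorm (f n) 2 μ) atTop (𝓝 0)) :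
    Tendsto (fun n => ∫⁻ x, ‖f n x‖ₑ ∂ν) atTop (𝓝 0) := by
  have hac : ν ≪ μ := (Measure.absolutelyContinuous_of_le hc).trans
    (Measure.AbsolutelyContinuous.rfl.smul_left c)
  have hle : ∀ n, ∫⁻ x, ‖f n x‖ₑ ∂ν ≤ ((c : ENNReal) ^ (1 / (2 : ENNReal)).toReal
      * eLpNorm (f n) 2 μ) * ν univ ^ (1 / (1 : ENNReal).toReal - 1 / (2 : ENNReal).toReal) := by
    intro n
    rw [← eLpNorm_one_eq_lintegral_enorm]
    refine (eLpNorm_le_eLpNorm_mul_rpow_measure_univ (p := 1) (q := 2) (by norm_num)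
      ((hf n).mono_ac hac)).trans ?_
    gcongr
    refine (eLpNorm_mono_measure _ hc).trans ?_
    have := eLpNorm_smul_measure_of_ne_top (p := 2) (by norm_num) (f n) (c : ENNReal) (μ := μ)
    rw [ENNReal.smul_def, this, smul_eq_mul]
  have hr : Tendsto (fun n => ((c : ENNReal) ^ (1 / (2 : ENNReal)).toReal
      * eLpNorm (f n) 2 μ) * ν univ ^ (1 / (1 : ENNReal).toReal - 1 / (2 : ENNReal).toReal))
      atTop (𝓝 0) := by
    have h1 := ENNReal.Tendsto.const_mul (a := (c : ENNReal) ^ (1 / (2 : ENNReal)).toReal) hlim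
      (Or.inr (ENNReal.rpow_ne_top_of_nonneg (by simp) ENNReal.coe_ne_top))
    have h2 := ENNReal.Tendsto.mul_const
      (b := ν univ ^ (1 / (1 : ENNReal).toReal - 1 / (2 : ENNReal).toReal)) h1
      (Or.inr (ENNReal.rpow_ne_top_of_nonneg (by norm_num) (measure_ne_top ν univ)))
    simpa using h2
  exact tendsto_of_tendsto_of_tendsto_of_le_of_le tendsto_const_nhds hr (fun _ => zero_le) hle

theorem contDiff_saturFlux {δ : ℝ} (hδ : 0 ≤ δ) :
    ContDiff ℝ 1 fun q : Vec d × Vec d => saturFlux δ q.1 q.2 := by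
  have h1 : ContDiff ℝ 1 fun q : Vec d × Vec d => ‖q.1‖ ^ 2 := contDiff_fst.norm_sq ℝ
  have h2 : ContDiff ℝ 1 fun q : Vec d × Vec d => 1 + δ * ‖q.1‖ ^ 2 :=
    contDiff_const.add (contDiff_const.mul h1)
  have h3 : ContDiff ℝ 1 fun q : Vec d × Vec d => ‖q.1‖ ^ 2 / (1 + δ * ‖q.1‖ ^ 2) :=
    h1.div h2 fun q => by positivity
  exact h3.smul (contDiff_snd.sub contDiff_fst)

theorem locallyLipschitz_saturFlux {δ : ℝ} (hδ : 0 ≤ δ) {U b : Vec d → Vec d}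
    (hU : LocallyLipschitz U) (hb : LocallyLipschitz b) :
    LocallyLipschitz fun x => saturFlux δ (U x) (b x) := by
  have h1 : LocallyLipschitz fun q : Vec d × Vec d => saturFlux δ q.1 q.2 :=
    (contDiff_saturFlux hδ).locallyLipschitz
  have h2 : LocallyLipschitz fun x => (U x, b x) := hU.prodMk hb
  simpa only [Function.comp_def] using h1.comp h2

/-- The mean divergence of the truncated flux tends to zero along approximations `U_n` whose
boundary values converge to a `γ` that is everywhere either zero or the boundary velocity. -/
theorem tendsto_integral_div_saturFlux_zero {Ω : Set (Vec d)} (hΩ : IsLipschitzDomain Ω)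
    {γ b : Vec d → Vec d} {U : ℕ → Vec d → Vec d} (hγm : MemLp γ 2 (surf Ω))
    (hUc : ∀ n, ContDiff ℝ 1 (U n))
    (hU3 : Tendsto (fun n => eLpNorm (fun x => U n x - γ x) 2 (surf Ω)) atTop (𝓝 0)) {K : ℝ≥0}
    (hb : LipschitzWith K b) (hbd : ∀ x ∈ frontier Ω, γ x = 0 ∨ γ x = b x) {δ : ℝ} (hδ : 0 < δ) :
    Tendsto (fun n => ENNReal.ofReal
      |∫ x in Ω, trTensor (classicalGrad (fun x => saturFlux δ (U n x) (b x)) x)|) atTop (𝓝 0) := by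
  obtain ⟨ν, hν, ⟨c, hc⟩, hdiv⟩ := exists_abs_integral_div_le hΩ
  have hcl : IsCompact (closure Ω) := hΩ.2.1.isCompact_closure
  obtain ⟨B, hB⟩ := hcl.exists_bound_of_continuousOn hb.continuous.continuousOn
  have h1 : Tendsto (fun n => ∫⁻ x, ‖U n x - γ x‖ₑ ∂ν) atTop (𝓝 0) :=
    tendsto_lintegral_enorm_of_le_smul hc
      (fun n => (hUc n).continuous.aestronglyMeasurable.sub hγm.1) hU3
  set M := B * (1 + δ⁻¹) + δ⁻¹ with hM
  have h2 : Tendsto (fun n => (d : ENNReal) * (ENNReal.ofReal M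
      * ∫⁻ x, ‖U n x - γ x‖ₑ ∂ν)) atTop (𝓝 0) := by
    have h3 := ENNReal.Tendsto.const_mul (a := ENNReal.ofReal M) h1 (Or.inr ENNReal.ofReal_ne_top)
    have h4 := ENNReal.Tendsto.const_mul (a := (d : ENNReal)) h3
      (Or.inr (ENNReal.natCast_ne_top d))
    rwa [mul_zero, mul_zero] at h4
  refine tendsto_of_tendsto_of_tendsto_of_le_of_le tendsto_const_nhds h2 (fun _ => zero_le)
    fun n => ?_
  have hll := locallyLipschitz_saturFlux hδ.le (hUc n).locallyLipschitz hb.locallyLipschitz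
  refine (hdiv _ hll).trans (mul_le_mul_right ?_ _)
  have hνae : ∀ᵐ x ∂ν, x ∈ frontier Ω := by
    have h2 : ∀ᵐ x ∂(surf Ω), x ∈ frontier Ω := ae_restrict_mem isClosed_frontier.measurableSet
    have h3 : ν ≪ surf Ω := (Measure.absolutelyContinuous_of_le hc).trans
      (Measure.AbsolutelyContinuous.rfl.smul_left c)
    exact h3.ae_le h2
  rw [← lintegral_const_mul' _ _ ENNReal.ofReal_ne_top]
  refine lintegral_mono_ae ?_
  filter_upwards [hνae] with x hx
  have h5 := norm_saturFlux_le hδ (U := U n x) (hB x (frontier_subset_closure hx)) (hbd x hx)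
  rw [← ofReal_norm, ← ofReal_norm, ← ENNReal.ofReal_mul']
  · exact ENNReal.ofReal_le_ofReal h5
  · exact norm_nonneg _

/-- The truncated flux `β(|u|²) (b - u)` has zero normal trace, hence a divergence of mean zero.
It is obtained from the `C¹` approximations in the definition of the trace. -/
theorem integral_div_saturFlux_eq_zero {Ω : Set (Vec d)} (hΩ : IsLipschitzDomain Ω)
    {u γ b : Vec d → Vec d} (hu : MemH1 Ω u) (hγ : HasTrace Ω u γ) {K : ℝ≥0}
    (hb : LipschitzWith K b) (hbd : ∀ x ∈ frontier Ω, γ x = 0 ∨ γ x = b x) {δ : ℝ} (hδ : 0 < δ) :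
    ∫ x in Ω, (inner ℝ (saturFluxCoeff δ (u x) (b x)) (weakGrad Ω u x)
      + satur δ (‖u x‖ ^ 2) * trTensor (classicalGrad b x)) = 0 := by
  obtain ⟨hγm, U, hUc, hU1, hU2, hU3⟩ := hγ
  have hΩfin : IsFiniteMeasure (volume.restrict Ω) := ⟨by simpa using hΩ.2.1.measure_lt_top⟩
  have hcl : IsCompact (closure Ω) := hΩ.2.1.isCompact_closure
  obtain ⟨B, hB⟩ := hcl.exists_bound_of_continuousOn hb.continuous.continuousOn
  have hBΩ : ∀ᵐ x ∂(volume.restrict Ω), ‖b x‖ ≤ B := by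
    filter_upwards [ae_restrict_mem hΩ.1.measurableSet] with x hx
    exact hB x (subset_closure hx)
  -- a subsequence along which the approximations converge almost everywhere
  have hUm : TendstoInMeasure (volume.restrict Ω) U atTop u :=
    tendstoInMeasure_of_tendsto_eLpNorm (by norm_num)
      (fun n => (hUc n).continuous.aestronglyMeasurable) hu.2.1.1 hU1
  obtain ⟨ns, hns, hae⟩ := hUm.exists_seq_tendsto_ae
  have hbdry := tendsto_integral_div_saturFlux_zero hΩ hγm hUc hU3 hb hbd hδ
  -- integrability of the two parts of the divergence
  have hAm : ∀ {f : Vec d → Vec d}, AEStronglyMeasurable f (volume.restrict Ω) →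
      AEStronglyMeasurable (fun x => saturFluxCoeff δ (f x) (b x)) (volume.restrict Ω) := by
    intro f hf
    have h1 : AEStronglyMeasurable (fun x => (f x, b x)) (volume.restrict Ω) :=
      hf.prodMk hb.continuous.aestronglyMeasurable
    simpa only [Function.comp_def] using
      (continuous_saturFluxCoeff (d := d) hδ.le).comp_aestronglyMeasurable h1
  have hAC : ∀ f : Vec d → Vec d, ∀ᵐ x ∂(volume.restrict Ω), ‖saturFluxCoeff δ (f x) (b x)‖
      ≤ 2 * (B * (1 + δ⁻¹) + δ⁻¹) + δ⁻¹ * ‖idTensor d‖ := fun f =>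
    hBΩ.mono fun x hx => norm_saturFluxCoeff_le hδ hx
  have hSm : ∀ {f : Vec d → Vec d}, AEStronglyMeasurable f (volume.restrict Ω) →
      AEStronglyMeasurable (fun x => satur δ (‖f x‖ ^ 2) * trTensor (classicalGrad b x))
        (volume.restrict Ω) := fun hf =>
    ((continuous_satur_norm_sq hδ.le).comp_aestronglyMeasurable hf).mul
      (continuous_trTensor.measurable.comp (measurable_classicalGrad b)).aestronglyMeasurable
  have hSC : ∀ (f : Vec d → Vec d) (x : Vec d),
      ‖satur δ (‖f x‖ ^ 2) * trTensor (classicalGrad b x)‖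
        ≤ δ⁻¹ * (d * (Real.sqrt (d * d) * K)) := fun f x => by
    rw [norm_mul, Real.norm_eq_abs, abs_of_nonneg (satur_nonneg hδ.le (by positivity))]
    gcongr
    · exact satur_le_inv hδ (by positivity)
    · exact (abs_trTensor_le _).trans (by gcongr; exact norm_classicalGrad_le hb x)
  have hSi : ∀ {f : Vec d → Vec d}, AEStronglyMeasurable f (volume.restrict Ω) →
      Integrable (fun x => satur δ (‖f x‖ ^ 2) * trTensor (classicalGrad b x))
        (volume.restrict Ω) := fun {f} hf =>
    Integrable.of_bound (hSm hf) _ (Eventually.of_forall (hSC f))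
  have hAi : ∀ {f : Vec d → Vec d} {G : Vec d → Tensor d},
      AEStronglyMeasurable f (volume.restrict Ω) → MemLp G 2 (volume.restrict Ω) →
      Integrable (fun x => (inner ℝ (saturFluxCoeff δ (f x) (b x)) (G x) : ℝ))
        (volume.restrict Ω) := fun {f G} hf hG =>
    integrable_inner_of_memLp (MemLp.of_bound (hAm hf) _ (hAC f)) hG
  have hUsm : ∀ n, AEStronglyMeasurable (U n) (volume.restrict Ω) :=
    fun n => (hUc n).continuous.aestronglyMeasurable
  have hGmem : ∀ n, MemLp (classicalGrad (U n)) 2 (volume.restrict Ω) := fun n => by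
    have hcg := continuous_classicalGrad (hUc n)
    obtain ⟨M, hM⟩ := hcl.exists_bound_of_continuousOn hcg.continuousOn
    refine MemLp.of_bound hcg.aestronglyMeasurable M ?_
    filter_upwards [ae_restrict_mem hΩ.1.measurableSet] with x hx
    exact hM x (subset_closure hx)
  have hrhs : ∀ n, ∫ x in Ω, trTensor (classicalGrad (fun x => saturFlux δ (U n x) (b x)) x)
      = (∫ x in Ω, inner ℝ (saturFluxCoeff δ (U n x) (b x)) (classicalGrad (U n) x))
        + ∫ x in Ω, satur δ (‖U n x‖ ^ 2) * trTensor (classicalGrad b x) := fun n => by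
    rw [← integral_add (hAi (hUsm n) (hGmem n)) (hSi (hUsm n))]
    refine integral_congr_ae ?_
    filter_upwards [ae_restrict_of_ae hb.ae_differentiableAt] with x hx
    exact trTensor_classicalGrad_saturFlux hδ.le ((hUc n).differentiable one_ne_zero x) hx
  have hlim : Tendsto (fun k => ∫ x in Ω,
      trTensor (classicalGrad (fun x => saturFlux δ (U (ns k) x) (b x)) x)) atTop
      (𝓝 ((∫ x in Ω, inner ℝ (saturFluxCoeff δ (u x) (b x)) (weakGrad Ω u x))
        + ∫ x in Ω, satur δ (‖u x‖ ^ 2) * trTensor (classicalGrad b x))) := by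
    simp only [hrhs]
    refine Tendsto.add ?_ ?_
    · refine tendsto_integral_inner_of_bounded (fun k => hAm (hUsm (ns k)))
        (fun k => hAC (U (ns k))) ?_ (fun k => hGmem (ns k)) hu.2.2 (hU2.comp hns.tendsto_atTop)
      filter_upwards [hae] with x hx
      have h1 := ((continuous_saturFluxCoeff hδ.le).tendsto (u x, b x)).comp
        (hx.prodMk_nhds (tendsto_const_nhds (x := b x)))
      simpa only [Function.comp_def] using h1
    · refine tendsto_integral_of_dominated_convergence _ (fun k => hSm (hUsm (ns k)))
        (integrable_const _) (fun k => Eventually.of_forall (hSC (U (ns k)))) ?_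
      filter_upwards [hae] with x hx
      have h1 := ((continuous_satur_norm_sq hδ.le).tendsto (u x)).comp hx
      simp only [Function.comp_def] at h1
      exact h1.mul_const _
  rw [integral_add (hAi hu.2.1.1 hu.2.2) (hSi hu.2.1.1)]
  have h2 := (ENNReal.continuous_ofReal.tendsto _).comp hlim.abs
  have h3 := hbdry.comp hns.tendsto_atTop
  simp only [Function.comp_def] at h2 h3
  have h1 := tendsto_nhds_unique h2 h3
  exact abs_nonpos_iff.1 (ENNReal.ofReal_eq_zero.1 h1)

theorem memLp_mulVec_weakGrad {Ω : Set (Vec d)} (hΩ : IsOpen Ω) (hbdd : Bornology.IsBounded Ω)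
    {u b : Vec d → Vec d} (hu : MemH1 Ω u) (hb : Continuous b) :
    MemLp (fun x => mulVec (weakGrad Ω u x) (b x)) 2 (volume.restrict Ω) := by
  obtain ⟨B, hB⟩ := hbdd.isCompact_closure.exists_bound_of_continuousOn hb.continuousOn
  refine (hu.2.2.norm.const_mul B).mono' (continuous_mulVec.comp_aestronglyMeasurable
    (hu.2.2.1.prodMk hb.aestronglyMeasurable)) ?_
  filter_upwards [ae_restrict_mem hΩ.measurableSet] with x hx
  refine (norm_mulVec_le _ _).trans ?_
  rw [mul_comm]
  gcongr
  exact hB x (subset_closure hx)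

/-- For a solenoidal `u` that vanishes on the fixed part of the boundary and moves with velocity `b`
on the rest, `∫ div(|u|² (b - u)) = 0`: no kinetic energy crosses the boundary. As `|u|² u` need not
be integrable, `|u|²` is truncated first. -/
theorem integral_kineticFlux_eq_zero {Ω : Set (Vec d)} (hΩ : IsLipschitzDomain Ω)
    {u γ b : Vec d → Vec d} (hu : MemH1 Ω u) (hγ : HasTrace Ω u γ) {K : ℝ≥0}
    (hb : LipschitzWith K b) (hbd : ∀ x ∈ frontier Ω, γ x = 0 ∨ γ x = b x)
    (hdiv : ∀ᵐ x ∂(volume.restrict Ω), weakDiv Ω u x = 0)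
    (hconv : IntegrableOn (fun x => (inner ℝ (mulVec (weakGrad Ω u x) (u x)) (u x) : ℝ)) Ω) :
    IntegrableOn (fun x => (inner ℝ (mulVec (weakGrad Ω u x) (b x)) (u x) : ℝ)) Ω ∧
    IntegrableOn (fun x => trTensor (classicalGrad b x) * ‖u x‖ ^ 2) Ω ∧
    2 * (∫ x in Ω, inner ℝ (mulVec (weakGrad Ω u x) (b x)) (u x))
      + (∫ x in Ω, trTensor (classicalGrad b x) * ‖u x‖ ^ 2)
    = 2 * ∫ x in Ω, inner ℝ (mulVec (weakGrad Ω u x) (u x)) (u x) := by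
  have hGb := memLp_mulVec_weakGrad hΩ.1 hΩ.2.1 hu hb.continuous
  have hi1 : IntegrableOn (fun x => (inner ℝ (mulVec (weakGrad Ω u x) (b x)) (u x) : ℝ)) Ω :=
    integrable_inner_of_memLp hGb hu.2.1
  have hu2 : Integrable (fun x => ‖u x‖ ^ 2) (volume.restrict Ω) := by
    simpa using integrable_inner_of_memLp hu.2.1 hu.2.1
  have hi2 : IntegrableOn (fun x => trTensor (classicalGrad b x) * ‖u x‖ ^ 2) Ω := by
    refine hu2.bdd_mul (c := d * (Real.sqrt (d * d) * K))
      (continuous_trTensor.measurable.comp (measurable_classicalGrad b)).aestronglyMeasurable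
      (Eventually.of_forall fun x => ?_)
    exact (abs_trTensor_le _).trans (by gcongr; exact norm_classicalGrad_le hb x)
  refine ⟨hi1, hi2, ?_⟩
  have hmv : ∀ x, (inner ℝ (mulVec (weakGrad Ω u x) (b x - u x)) (u x) : ℝ)
      = inner ℝ (mulVec (weakGrad Ω u x) (b x)) (u x)
        - inner ℝ (mulVec (weakGrad Ω u x) (u x)) (u x) := fun x => by
    rw [← inner_sub_left]
    congr 1
    ext i
    simp [mulVec, mul_sub]
  have hi3 : IntegrableOn
      (fun x => (inner ℝ (mulVec (weakGrad Ω u x) (b x - u x)) (u x) : ℝ)) Ω := by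
    simp only [hmv]; exact hi1.sub hconv
  -- remove the truncation, by dominated convergence as `δ → 0`
  let δ : ℕ → ℝ := fun n => 1 / ((n : ℝ) + 1)
  have hδ : ∀ n, 0 < δ n := fun n => by positivity
  have hδlim : Tendsto δ atTop (𝓝 0) := tendsto_one_div_add_atTop_nhds_zero_nat
  have hzero : ∀ n, ∫ x in Ω, (2 / (1 + δ n * ‖u x‖ ^ 2) ^ 2
      * inner ℝ (mulVec (weakGrad Ω u x) (b x - u x)) (u x)
      + satur (δ n) (‖u x‖ ^ 2) * trTensor (classicalGrad b x)) = 0 := fun n => by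
    rw [← integral_div_saturFlux_eq_zero hΩ hu hγ hb hbd (hδ n)]
    refine integral_congr_ae ?_
    filter_upwards [hdiv] with x hx
    rw [inner_saturFluxCoeff]
    rw [weakDiv] at hx
    rw [hx]; ring
  have hlim : Tendsto (fun n => ∫ x in Ω, (2 / (1 + δ n * ‖u x‖ ^ 2) ^ 2
      * inner ℝ (mulVec (weakGrad Ω u x) (b x - u x)) (u x)
      + satur (δ n) (‖u x‖ ^ 2) * trTensor (classicalGrad b x))) atTop
      (𝓝 (∫ x in Ω, (2 * inner ℝ (mulVec (weakGrad Ω u x) (b x - u x)) (u x)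
        + trTensor (classicalGrad b x) * ‖u x‖ ^ 2))) := by
    refine tendsto_integral_of_dominated_convergence
      (fun x => 2 * |(inner ℝ (mulVec (weakGrad Ω u x) (b x - u x)) (u x) : ℝ)|
        + |trTensor (classicalGrad b x) * ‖u x‖ ^ 2|) (fun n => ?_)
      ((hi3.abs.const_mul 2).add hi2.abs) (fun n => Eventually.of_forall fun x => ?_)
      (Eventually.of_forall fun x => ?_)
    · have h1 : Continuous fun U : Vec d => 2 / (1 + δ n * ‖U‖ ^ 2) ^ 2 := by
        refine Continuous.div (by fun_prop) (by fun_prop) fun U => ?_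
        have := hδ n
        positivity
      exact ((h1.comp_aestronglyMeasurable hu.2.1.1).mul hi3.1).add
        (((continuous_satur_norm_sq (hδ n).le).comp_aestronglyMeasurable hu.2.1.1).mul
          (continuous_trTensor.measurable.comp (measurable_classicalGrad b)).aestronglyMeasurable)
    · have hden : 1 ≤ 1 + δ n * ‖u x‖ ^ 2 :=
        le_add_of_nonneg_right (mul_nonneg (hδ n).le (by positivity))
      refine (norm_add_le _ _).trans (add_le_add ?_ ?_)
      · rw [norm_mul, Real.norm_eq_abs, Real.norm_eq_abs, abs_of_nonneg (by positivity)]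
        gcongr
        exact div_le_self (by norm_num) (one_le_pow₀ hden)
      · rw [norm_mul, Real.norm_eq_abs, Real.norm_eq_abs, abs_mul,
          abs_of_nonneg (satur_nonneg (hδ n).le (by positivity)), mul_comm, abs_pow, abs_norm]
        gcongr
        exact satur_le_self (hδ n).le (by positivity)
    · have h1 : Tendsto (fun n => 1 + δ n * ‖u x‖ ^ 2) atTop (𝓝 1) := by
        simpa using (hδlim.mul_const (‖u x‖ ^ 2)).const_add 1
      have h2 : Tendsto (fun n => 2 / (1 + δ n * ‖u x‖ ^ 2) ^ 2) atTop (𝓝 2) := by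
        have := (tendsto_const_nhds (x := (2 : ℝ)) (f := atTop)).div (h1.pow 2) (by norm_num)
        rwa [one_pow, div_one] at this
      have h3 : Tendsto (fun n => satur (δ n) (‖u x‖ ^ 2)) atTop (𝓝 (‖u x‖ ^ 2)) := by
        have := (tendsto_const_nhds (x := ‖u x‖ ^ 2) (f := atTop)).div h1 one_ne_zero
        rwa [div_one] at this
      rw [mul_comm (trTensor _)]
      exact (h2.mul_const _).add (h3.mul_const _)
  simp only [hzero] at hlim
  have h0 := tendsto_nhds_unique hlim tendsto_const_nhds
  rw [integral_add (hi3.const_mul 2) hi2, integral_const_mul] at h0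
  simp only [hmv] at h0
  rw [integral_sub hi1 hconv] at h0
  linarith

/-! ### Expansion of the Jacobian determinant -/


/-- The trace of an endomorphism of `ℝ^d`, in the standard basis. -/
noncomputable def trCLM (A : Vec d →L[ℝ] Vec d) : ℝ := ∑ i, A (EuclideanSpace.single i 1) i

theorem det_eq_det_matrix (A : Vec d →L[ℝ] Vec d) :
    A.det = Matrix.det (Matrix.of fun i j => A (EuclideanSpace.single j 1) i) := by
  rw [ContinuousLinearMap.det, ← LinearMap.det_toMatrix (EuclideanSpace.basisFun (Fin d) ℝ).toBasis]
  congr 1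

theorem contDiff_clm_det : ContDiff ℝ 1 fun A : Vec d →L[ℝ] Vec d => (1 + A).det := by
  simp only [det_eq_det_matrix, Matrix.det_apply]
  refine ContDiff.sum fun σ _ => ContDiff.const_smul _ (contDiff_prod fun i _ => ?_)
  have h1 : ContDiff ℝ 1 fun A : Vec d →L[ℝ] Vec d => (1 + A) (EuclideanSpace.single i 1) :=
    (contDiff_const.add contDiff_id).clm_apply contDiff_const
  exact (EuclideanSpace.proj (𝕜 := ℝ) (σ i)).contDiff.comp h1

theorem hasDerivAt_det_one_add_smul (A : Vec d →L[ℝ] Vec d) :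
    HasDerivAt (fun r : ℝ => (1 + r • A).det) (trCLM A) 0 := by
  set M : Matrix (Fin d) (Fin d) ℝ := Matrix.of fun i j => A (EuclideanSpace.single j 1) i with hM
  have h1 : ∀ r : ℝ, (1 + r • A).det = (1 + r • M).det := fun r => by
    rw [det_eq_det_matrix]
    congr 1
    ext i j
    simp [hM, Matrix.one_apply]
  have htr : M.trace = trCLM A := rfl
  have h3 : (fun r : ℝ => (1 + r • A).det) = fun r => 1 + trCLM A * r +
      (1 + (Polynomial.X : Polynomial ℝ) • M.map Polynomial.C).det.divX.divX.eval r * r ^ 2 := by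
    funext r
    rw [h1, Matrix.det_one_add_smul, htr]
  rw [h3]
  have h2 := (((hasDerivAt_id (0 : ℝ)).const_mul (trCLM A)).const_add 1).add
    (((Polynomial.hasDerivAt ((1 + (Polynomial.X : Polynomial ℝ) •
      M.map Polynomial.C).det.divX.divX) 0)).mul ((hasDerivAt_id (0 : ℝ)).pow 2))
  refine h2.congr_deriv ?_
  simp

/-- `det (1 + A) = 1 + tr A + o(A)`. -/
theorem exists_abs_det_one_add_sub_le {η : ℝ} (hη : 0 < η) :
    ∃ δ > 0, ∀ A : Vec d →L[ℝ] Vec d, ‖A‖ < δ → |(1 + A).det - 1 - trCLM A| ≤ η * ‖A‖ := by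
  have hd := (contDiff_clm_det (d := d)).differentiable one_ne_zero 0
  have hL : ∀ A, fderiv ℝ (fun A : Vec d →L[ℝ] Vec d => (1 + A).det) 0 A = trCLM A := by
    intro A
    have h1 := hd.hasFDerivAt.hasLineDerivAt A
    rw [HasLineDerivAt] at h1
    simp only [zero_add] at h1
    exact h1.unique (hasDerivAt_det_one_add_smul A)
  have h2 := hasFDerivAt_iff_isLittleO.1 hd.hasFDerivAt
  rw [Asymptotics.isLittleO_iff] at h2
  obtain ⟨δ, hδ, h3⟩ := Metric.eventually_nhds_iff.1 (h2 hη)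
  refine ⟨δ, hδ, fun A hA => ?_⟩
  have h4 := h3 (y := A) (by simpa using hA)
  rw [hL] at h4
  have h5 : ContinuousLinearMap.det (1 : Vec d →L[ℝ] Vec d) = 1 := by
    rw [ContinuousLinearMap.det]; simp
  simpa [h5] using h4

theorem abs_trCLM_le (A : Vec d →L[ℝ] Vec d) : |trCLM A| ≤ d * ‖A‖ := by
  calc |trCLM A| ≤ ∑ i, |A (EuclideanSpace.single i 1) i| := Finset.abs_sum_le_sum_abs _ _
    _ ≤ ∑ _i : Fin d, ‖A‖ := Finset.sum_le_sum fun i _ => by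
        calc |A (EuclideanSpace.single i 1) i| ≤ ‖A (EuclideanSpace.single i 1)‖ :=
              PiLp.norm_apply_le (A (EuclideanSpace.single i 1)) i
          _ ≤ ‖A‖ * ‖(EuclideanSpace.single i 1 : Vec d)‖ := A.le_opNorm _
          _ = ‖A‖ := by simp
    _ = d * ‖A‖ := by simp

/-! ### Lipschitz changes of variables -/

theorem volume_image_le_of_lipschitzOnWith {f : Vec d → Vec d} {K : ℝ≥0} {s : Set (Vec d)}
    (hf : LipschitzOnWith K f s) : volume (f '' s) ≤ (K ^ d : ℝ≥0) * volume s := by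
  rw [← EuclideanSpace.euclideanHausdorffMeasure_eq_volume, Measure.euclideanHausdorffMeasure_def,
    Measure.smul_apply, Measure.smul_apply, mul_smul_comm]
  refine smul_le_smul_of_nonneg_left ?_ zero_le
  simpa using hf.hausdorffMeasure_image_le (d := (d : ℝ)) (by positivity)

/-- A bi-Lipschitz map distorts Lebesgue measure by a bounded factor. -/
theorem map_restrict_le_of_lipschitz {Ω Ω' : Set (Vec d)} {Ψ Θ : Vec d → Vec d} {K : ℝ≥0}
    (hΨ : Continuous Ψ) (hΘ : LipschitzOnWith K Θ Ω') (himg : MapsTo Ψ Ω Ω')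
    (hinv : ∀ x ∈ Ω, Θ (Ψ x) = x) :
    (volume.restrict Ω).map Ψ ≤ (K ^ d : ℝ≥0) • volume.restrict Ω' := by
  refine Measure.le_iff.2 fun s hs => ?_
  rw [Measure.map_apply hΨ.measurable hs, Measure.restrict_apply (hΨ.measurable hs),
    Measure.smul_apply, Measure.restrict_apply hs]
  have hsub : Ψ ⁻¹' s ∩ Ω ⊆ Θ '' (s ∩ Ω') := fun x hx => ⟨Ψ x, ⟨hx.1, himg hx.2⟩, hinv x hx.2⟩
  refine (measure_mono hsub).trans ?_
  exact volume_image_le_of_lipschitzOnWith (hΘ.mono inter_subset_right)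

theorem eLpNorm_comp_le_of_lipschitz {Ω Ω' : Set (Vec d)} {Ψ Θ : Vec d → Vec d} {K : ℝ≥0}
    (hΨ : Continuous Ψ) (hΘ : LipschitzOnWith K Θ Ω') (himg : MapsTo Ψ Ω Ω')
    (hinv : ∀ x ∈ Ω, Θ (Ψ x) = x) {f : Vec d → Vec d}
    (hf : AEStronglyMeasurable f (volume.restrict Ω')) :
    AEStronglyMeasurable (fun x => f (Ψ x)) (volume.restrict Ω) ∧
      eLpNorm (fun x => f (Ψ x)) 2 (volume.restrict Ω)
        ≤ ((K ^ d : ℝ≥0) : ENNReal) ^ (1 / (2 : ENNReal)).toReal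
          * eLpNorm f 2 (volume.restrict Ω') := by
  have hle := map_restrict_le_of_lipschitz hΨ hΘ himg hinv
  have hac : (volume.restrict Ω).map Ψ ≪ volume.restrict Ω' :=
    (Measure.absolutelyContinuous_of_le hle).trans (Measure.AbsolutelyContinuous.rfl.smul_left _)
  have hfm := hf.mono_ac hac
  refine ⟨hfm.comp_measurable hΨ.measurable, ?_⟩
  have h1 := eLpNorm_map_measure (p := 2) hfm hΨ.aemeasurable
  have h2 : eLpNorm (fun x => f (Ψ x)) 2 (volume.restrict Ω)
      = eLpNorm f 2 ((volume.restrict Ω).map Ψ) := h1.symm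
  rw [h2]
  refine (eLpNorm_mono_measure _ hle).trans (le_of_eq ?_)
  rw [ENNReal.smul_def, eLpNorm_smul_measure_of_ne_top (by norm_num), smul_eq_mul]

theorem memLp_comp_of_lipschitz {Ω Ω' : Set (Vec d)} {Ψ Θ : Vec d → Vec d} {K : ℝ≥0}
    (hΨ : Continuous Ψ) (hΘ : LipschitzOnWith K Θ Ω') (himg : MapsTo Ψ Ω Ω')
    (hinv : ∀ x ∈ Ω, Θ (Ψ x) = x) {f : Vec d → Vec d} (hf : MemLp f 2 (volume.restrict Ω')) :
    MemLp (fun x => f (Ψ x)) 2 (volume.restrict Ω) := by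
  obtain ⟨h1, h2⟩ := eLpNorm_comp_le_of_lipschitz hΨ hΘ himg hinv hf.1
  refine ⟨h1, h2.trans_lt (ENNReal.mul_lt_top ?_ hf.2)⟩
  exact (ENNReal.rpow_ne_top_of_nonneg (by simp) ENNReal.coe_ne_top).lt_top

/-- The area formula for an injective Lipschitz map. -/
theorem integral_image_eq_of_lipschitz {Ω : Set (Vec d)} (hΩ : MeasurableSet Ω)
    {Ψ : Vec d → Vec d} {K : ℝ≥0} (hΨ : LipschitzWith K Ψ) (hinj : InjOn Ψ Ω) (g : Vec d → ℝ) :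
    ∫ y in Ψ '' Ω, g y = ∫ x in Ω, |(fderiv ℝ Ψ x).det| * g (Ψ x) := by
  set S := Ω ∩ {x | DifferentiableAt ℝ Ψ x} with hS
  have hSm : MeasurableSet S := hΩ.inter (measurableSet_of_differentiableAt ℝ Ψ)
  have hnull : volume (Ω \ S) = 0 := by
    refine measure_mono_null ?_ (ae_iff.1 hΨ.ae_differentiableAt)
    rintro x ⟨hx, hxS⟩ hd
    exact hxS ⟨hx, hd⟩
  have hnull' : volume (Ψ '' (Ω \ S)) = 0 := by
    have := volume_image_le_of_lipschitzOnWith (hΨ.lipschitzOnWith (s := Ω \ S))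
    rw [hnull, mul_zero] at this
    exact le_antisymm this zero_le
  have hSΩ : S =ᵐ[volume] Ω := by
    rw [← union_sdiff_cancel (inter_subset_left : S ⊆ Ω)]
    exact (union_ae_eq_left_of_ae_eq_empty (ae_eq_empty.2 hnull)).symm
  have himg : Ψ '' S =ᵐ[volume] Ψ '' Ω := by
    conv_rhs => rw [← union_sdiff_cancel (inter_subset_left : S ⊆ Ω), image_union]
    exact (union_ae_eq_left_of_ae_eq_empty (ae_eq_empty.2 hnull')).symm
  rw [← setIntegral_congr_set himg, ← setIntegral_congr_set hSΩ,
    integral_image_eq_integral_abs_det_fderiv_smul volume hSm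
      (fun x hx => hx.2.hasFDerivAt.hasFDerivWithinAt) (hinj.mono inter_subset_left)]
  simp [smul_eq_mul]

/-! ### Transport of the kinetic energy by a domain motion -/


/-- If `Ψ s = id + (s - t) b + o(|s - t|)` in the Lipschitz seminorm, then the Jacobian of `Ψ s` is
`1 + (s - t) div b + o(|s - t|)`, uniformly almost everywhere. -/
theorem eventually_abs_jacobian_sub_le {Ω : Set (Vec d)} (hΩ : IsOpen Ω) {I : Set ℝ} {t : ℝ}
    {Ψ : ℝ → Vec d → Vec d} (hΨ : ∀ s ∈ I, ∃ K, LipschitzWith K (Ψ s))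
    {b : Vec d → Vec d} {L : ℝ≥0} (hb : LipschitzWith L b)
    (hder : ∀ ε > 0, ∀ᶠ s in 𝓝[I] t, ∀ x ∈ Ω, ∀ y ∈ Ω,
      ‖(Ψ s x - x - (s - t) • b x) - (Ψ s y - y - (s - t) • b y)‖ ≤ ε * |s - t| * ‖x - y‖)
    {ε : ℝ} (hε : 0 < ε) :
    ∀ᶠ s in 𝓝[I] t, ∀ᵐ x ∂(volume.restrict Ω),
      |(|(fderiv ℝ (Ψ s) x).det|) - 1 - (s - t) * trCLM (fderiv ℝ b x)| ≤ ε * |s - t| := by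
  have hL : (0 : ℝ) ≤ L := L.2
  set ε' : ℝ := min 1 (ε / (2 * (d + 1))) with hε'
  have hε'0 : 0 < ε' := by positivity
  have hε'1 : ε' ≤ 1 := min_le_left _ _
  have hε'2 : d * ε' ≤ ε / 2 := by
    have h1 : ε' ≤ ε / (2 * (d + 1)) := min_le_right _ _
    rw [le_div_iff₀ (by positivity)] at h1
    nlinarith
  obtain ⟨δ, hδ, hdet⟩ := exists_abs_det_one_add_sub_le (d := d)
    (η := ε / (2 * (1 + L))) (by positivity)
  have hsmall : ∀ a > (0 : ℝ), ∀ᶠ s in 𝓝[I] t, |s - t| < a := fun a ha =>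
    mem_nhdsWithin_of_mem_nhds (Metric.ball_mem_nhds t ha)
  filter_upwards [hder ε' hε'0, hsmall (δ / (1 + L)) (by positivity),
    hsmall (1 / (ε + d * L + 1)) (by positivity), self_mem_nhdsWithin] with s h1 h2 h3 hsI
  obtain ⟨K, hK⟩ := hΨ s hsI
  filter_upwards [ae_restrict_of_ae hK.ae_differentiableAt,
    ae_restrict_of_ae hb.ae_differentiableAt, ae_restrict_mem hΩ.measurableSet] with x hx1 hx2 hxΩ
  set A : Vec d →L[ℝ] Vec d := fderiv ℝ (Ψ s) x - 1 with hA
  set B : Vec d →L[ℝ] Vec d := fderiv ℝ b x with hB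
  have hBn : ‖B‖ ≤ L := norm_fderiv_le_of_lipschitz ℝ hb
  have hR : HasFDerivAt (fun x => Ψ s x - x - (s - t) • b x) (A - (s - t) • B) x :=
    (hx1.hasFDerivAt.sub (hasFDerivAt_id x)).sub (hx2.hasFDerivAt.const_smul (s - t))
  have hRn : ‖A - (s - t) • B‖ ≤ ε' * |s - t| := by
    have hlip : LipschitzOnWith (Real.toNNReal (ε' * |s - t|))
        (fun x => Ψ s x - x - (s - t) • b x) Ω :=
      LipschitzOnWith.of_dist_le_mul fun y hy z hz => by
        rw [Real.coe_toNNReal _ (by positivity), dist_eq_norm, dist_eq_norm]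
        exact h1 y hy z hz
    have := norm_fderiv_le_of_lipschitzOn ℝ (hΩ.mem_nhds hxΩ) hlip
    rwa [hR.fderiv, Real.coe_toNNReal _ (by positivity)] at this
  have hAn : ‖A‖ ≤ (1 + L) * |s - t| := by
    calc ‖A‖ = ‖(A - (s - t) • B) + (s - t) • B‖ := by rw [sub_add_cancel]
      _ ≤ ‖A - (s - t) • B‖ + ‖(s - t) • B‖ := norm_add_le _ _
      _ ≤ ε' * |s - t| + |s - t| * L := by
          rw [norm_smul, Real.norm_eq_abs]; gcongr
      _ ≤ 1 * |s - t| + |s - t| * L := by gcongr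
      _ = (1 + L) * |s - t| := by ring
  have hAδ : ‖A‖ < δ := hAn.trans_lt (by rwa [lt_div_iff₀' (by positivity)] at h2)
  have hd1 := hdet A hAδ
  have hd2 : |(1 + A).det - 1 - trCLM A| ≤ ε / 2 * |s - t| := by
    refine hd1.trans ?_
    calc ε / (2 * (1 + L)) * ‖A‖ ≤ ε / (2 * (1 + L)) * ((1 + L) * |s - t|) := by gcongr
      _ = ε / 2 * |s - t| := by field_simp
  have hd3 : |trCLM A - (s - t) * trCLM B| ≤ ε / 2 * |s - t| := by
    have h5 : trCLM A - (s - t) * trCLM B = trCLM (A - (s - t) • B) := by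
      simp [trCLM, Finset.mul_sum, Finset.sum_sub_distrib]
    rw [h5]
    calc |trCLM (A - (s - t) • B)| ≤ d * ‖A - (s - t) • B‖ := abs_trCLM_le _
      _ ≤ d * (ε' * |s - t|) := by gcongr
      _ = d * ε' * |s - t| := by ring
      _ ≤ ε / 2 * |s - t| := by gcongr
  have hdetA : (1 + A).det = (fderiv ℝ (Ψ s) x).det := by rw [hA, add_sub_cancel]
  have hd4 : |(fderiv ℝ (Ψ s) x).det - 1 - (s - t) * trCLM B| ≤ ε * |s - t| := by
    rw [← hdetA]
    calc |(1 + A).det - 1 - (s - t) * trCLM B|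
        = |((1 + A).det - 1 - trCLM A) + (trCLM A - (s - t) * trCLM B)| := by congr 1; ring
      _ ≤ _ := abs_add_le _ _
      _ ≤ ε / 2 * |s - t| + ε / 2 * |s - t| := add_le_add hd2 hd3
      _ = ε * |s - t| := by ring
  -- for `s` close to `t` the determinant is positive
  have hpos : 0 < (fderiv ℝ (Ψ s) x).det := by
    have h6 : |(s - t) * trCLM B| ≤ |s - t| * (d * L) := by
      rw [abs_mul]
      gcongr
      exact (abs_trCLM_le B).trans (by gcongr)
    have h7 : |s - t| * (ε + d * L + 1) < 1 := by rwa [lt_div_iff₀ (by positivity)] at h3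
    have h8 := (abs_le.1 hd4).1
    have h9 := (abs_le.1 h6).1
    have h10 := abs_nonneg (s - t)
    nlinarith
  rwa [abs_of_pos hpos]

/-- The maps of a domain motion, and their inverses, extend to Lipschitz maps of the whole space. -/
theorem IsDomainMotion.exists_extension {T : ℝ} {Ωf : ℝ → Set (Vec d)} {Φ w : ℝ → Vec d → Vec d}
    (h : IsDomainMotion T Ωf Φ w) {s : ℝ} (hs : s ∈ Icc 0 T) :
    ∃ (F G : Vec d → Vec d) (K : ℝ≥0), LipschitzWith K F ∧ LipschitzWith K G ∧
      (∀ X ∈ closure (Ωf 0), F X = Φ s X) ∧ ∀ X ∈ closure (Ωf 0), G (Φ s X) = X := by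
  obtain ⟨K, hK⟩ := h.biLipschitz s hs
  have hKle : K ≤ (K.toNNReal : ℝ) := Real.le_coe_toNNReal K
  have h1 : LipschitzOnWith K.toNNReal (Φ s) (closure (Ωf 0)) :=
    LipschitzOnWith.of_dist_le_mul fun X hX Y hY => by
      rw [dist_eq_norm, dist_eq_norm]
      exact (hK X hX Y hY).1.trans (by gcongr)
  have hinj : InjOn (Φ s) (closure (Ωf 0)) := fun X hX Y hY hXY => by
    have := (hK X hX Y hY).2
    rw [hXY, sub_self, norm_zero, mul_zero] at this
    exact sub_eq_zero.1 (norm_le_zero_iff.1 this)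
  have h2 : LipschitzOnWith K.toNNReal (Function.invFunOn (Φ s) (closure (Ωf 0)))
      (Φ s '' closure (Ωf 0)) := by
    refine LipschitzOnWith.of_dist_le_mul ?_
    rintro _ ⟨X, hX, rfl⟩ _ ⟨Y, hY, rfl⟩
    rw [hinj.leftInvOn_invFunOn hX, hinj.leftInvOn_invFunOn hY, dist_eq_norm, dist_eq_norm]
    exact (hK X hX Y hY).2.trans (by gcongr)
  obtain ⟨F, hF, hFe⟩ := h1.extend_finite_dimension
  obtain ⟨G, hG, hGe⟩ := h2.extend_finite_dimension
  refine ⟨F, G, _, hF, hG, fun X hX => (hFe hX).symm, fun X hX => ?_⟩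
  rw [← hGe ⟨X, hX, rfl⟩, hinj.leftInvOn_invFunOn hX]

/-- The material velocity is Lipschitz, as a limit of difference quotients in the Lipschitz norm. -/
theorem IsDomainMotion.exists_lipschitzOnWith_velocity {T : ℝ} {Ωf : ℝ → Set (Vec d)}
    {Φ w : ℝ → Vec d → Vec d} (h : IsDomainMotion T Ωf Φ w) (hT : 0 < T) {t : ℝ}
    (ht : t ∈ Icc 0 T) : ∃ K, LipschitzOnWith K (w t) (closure (Ωf 0)) := by
  have hacc : (𝓝[Icc 0 T \ {t}] t).NeBot := by
    have := uniqueDiffWithinAt_iff_accPt.1 (uniqueDiffOn_Icc hT t ht)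
    rw [accPt_principal_iff_nhdsWithin] at this
    exact this
  -- `[0, T]` has no isolated points, so there is a difference quotient at some `s ≠ t`
  obtain ⟨s, ⟨hd, hs⟩⟩ := (((h.deriv t ht 1 one_pos).filter_mono
    (nhdsWithin_mono t (sdiff_subset (t := {t})))).and self_mem_nhdsWithin).exists
  obtain ⟨Ks, hKs⟩ := h.biLipschitz s hs.1
  obtain ⟨Kt, hKt⟩ := h.biLipschitz t ht
  have hst : 0 < |s - t| := abs_pos.2 (sub_ne_zero.2 hs.2)
  refine ⟨((Ks + Kt) / |s - t| + 1).toNNReal, LipschitzOnWith.of_dist_le_mul fun X hX Y hY => ?_⟩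
  rw [dist_eq_norm, dist_eq_norm]
  refine le_trans ?_ (mul_le_mul_of_nonneg_right (Real.le_coe_toNNReal _) (norm_nonneg _))
  have h1 := (hd X hX).2 Y hY
  have h2 := (hKs X hX Y hY).1
  have h3 := (hKt X hX Y hY).1
  have h4 : |s - t| * ‖w t X - w t Y‖ ≤ (Ks + Kt) * ‖X - Y‖ + 1 * |s - t| * ‖X - Y‖ := by
    rw [← Real.norm_eq_abs, ← norm_smul]
    have h5 : (s - t) • (w t X - w t Y) = (Φ s X - Φ s Y) - (Φ t X - Φ t Y)
        - ((Φ s X - Φ t X - (s - t) • w t X) - (Φ s Y - Φ t Y - (s - t) • w t Y)) := by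
      rw [smul_sub]; abel
    rw [h5]
    refine (norm_sub_le _ _).trans (add_le_add ((norm_sub_le _ _).trans ?_) h1)
    linarith
  have h6 : ((Ks + Kt) / |s - t| + 1) * ‖X - Y‖
      = ((Ks + Kt) * ‖X - Y‖ + 1 * |s - t| * ‖X - Y‖) / |s - t| := by field_simp
  rw [h6, le_div_iff₀ hst]
  linarith

/-- Transport theorem for the kinetic energy: if the pullback of `u` by the domain motion is
differentiable in `L²` with derivative `g ∘ Φ t`, then
`d/dt ‖u‖² = 2 ⟨u, g⟩ + ⟨div b, |u|²⟩`, where `b` is the Eulerian velocity of the motion. -/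
theorem IsDomainMotion.exists_hasDerivWithinAt_sqNorm {T : ℝ} {Ωf : ℝ → Set (Vec d)}
    {Φ w : ℝ → Vec d → Vec d} (h : IsDomainMotion T Ωf Φ w) (hT : 0 < T)
    (hΩ : ∀ s ∈ Icc 0 T, IsOpen (Ωf s)) {t : ℝ} (ht : t ∈ Icc 0 T) :
    ∃ (b : Vec d → Vec d) (K : ℝ≥0), LipschitzWith K b ∧
      (∀ X ∈ closure (Ωf 0), b (Φ t X) = w t X) ∧
      ∀ (u : ℝ → Vec d → Vec d) (g : Vec d → Vec d),
        (∀ s ∈ Icc 0 T, MemLp (u s) 2 (volume.restrict (Ωf s))) →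
        HasL2DerivWithinAt (Ωf 0) (fun s X => u s (Φ s X)) (fun X => g (Φ t X)) (Icc 0 T) t →
        MemLp g 2 (volume.restrict (Ωf t)) ∧
        HasDerivWithinAt (fun s => sqNorm (Ωf s) (u s))
          (2 * (∫ x in Ωf t, inner ℝ (u t x) (g x))
            + ∫ x in Ωf t, trTensor (classicalGrad b x) * ‖u t x‖ ^ 2) (Icc 0 T) t := by
  have hex : ∀ s, ∃ (F G : Vec d → Vec d) (K : ℝ≥0), s ∈ Icc 0 T → LipschitzWith K F ∧
      LipschitzWith K G ∧ (∀ X ∈ closure (Ωf 0), F X = Φ s X) ∧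
      ∀ X ∈ closure (Ωf 0), G (Φ s X) = X := fun s => by
    by_cases hs : s ∈ Icc 0 T
    · obtain ⟨F, G, K, hFG⟩ := h.exists_extension hs
      exact ⟨F, G, K, fun _ => hFG⟩
    · exact ⟨id, id, 1, fun hs' => absurd hs' hs⟩
  choose F G K hFG using hex
  have hF := fun s hs => (hFG s hs).1
  have hG := fun s hs => (hFG s hs).2.1
  have hFe := fun s hs => (hFG s hs).2.2.1
  have hGe := fun s hs => (hFG s hs).2.2.2
  obtain ⟨Lw, hLw⟩ := h.exists_lipschitzOnWith_velocity hT ht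
  obtain ⟨W, hW, hWe⟩ := hLw.extend_finite_dimension
  set L : ℝ≥0 := _ * K t with hL
  have hb : LipschitzWith L (fun x => W (G t x)) := hW.comp (hG t ht)
  have hbe : ∀ X ∈ closure (Ωf 0), W (G t (Φ t X)) = w t X := fun X hX => by
    rw [hGe t ht X hX, hWe hX]
  refine ⟨fun x => W (G t x), L, hb, hbe, fun u g hu hder => ?_⟩
  set b : Vec d → Vec d := fun x => W (G t x) with hbdef
  set Ψ : ℝ → Vec d → Vec d := fun s x => F s (G t x) with hΨ
  have h0 : (0 : ℝ) ∈ Icc 0 T := ⟨le_rfl, hT.le⟩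
  have hrep : ∀ s ∈ Icc 0 T, ∀ x ∈ Ωf s, ∃ X ∈ Ωf 0, Φ s X = x := fun s hs x hx => by
    rw [← h.image s hs] at hx
    exact hx
  have hΦm : ∀ s ∈ Icc 0 T, ∀ X ∈ Ωf 0, Φ s X ∈ Ωf s := fun s hs X hX => by
    rw [← h.image s hs]
    exact mem_image_of_mem _ hX
  have hΨΦ : ∀ s ∈ Icc 0 T, ∀ X ∈ Ωf 0, Ψ s (Φ t X) = Φ s X := fun s hs X hX => by
    simp only [hΨ]
    rw [hGe t ht X (subset_closure hX), hFe s hs X (subset_closure hX)]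
  have hΨL : ∀ s ∈ Icc 0 T, LipschitzWith (K s * K t) (Ψ s) := fun s hs =>
    (hF s hs).comp (hG t ht)
  have hΨinj : ∀ s ∈ Icc 0 T, InjOn (Ψ s) (Ωf t) := fun s hs x hx y hy hxy => by
    obtain ⟨X, hX, rfl⟩ := hrep t ht x hx
    obtain ⟨Y, hY, rfl⟩ := hrep t ht y hy
    rw [hΨΦ s hs X hX, hΨΦ s hs Y hY] at hxy
    have := congrArg (G s) hxy
    rw [hGe s hs X (subset_closure hX), hGe s hs Y (subset_closure hY)] at this
    rw [this]
  have hΨimg : ∀ s ∈ Icc 0 T, Ψ s '' Ωf t = Ωf s := fun s hs => by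
    rw [← h.image t ht, ← h.image s hs, image_image]
    exact image_congr fun X hX => hΨΦ s hs X hX
  have hΨt : ∀ x ∈ Ωf t, Ψ t x = x := fun x hx => by
    obtain ⟨X, hX, rfl⟩ := hrep t ht x hx
    exact hΨΦ t ht X hX
  have hmt : MeasurableSet (Ωf t) := (hΩ t ht).measurableSet
  -- the pullback of the velocities to `Ωf t`
  have hf : ∀ s ∈ Icc 0 T, MemLp (fun x => u s (Ψ s x)) 2 (volume.restrict (Ωf t)) := fun s hs => by
    have hΘ : LipschitzWith (K t * K s) (fun y => F t (G s y)) := (hF t ht).comp (hG s hs)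
    refine memLp_comp_of_lipschitz (hΨL s hs).continuous hΘ.lipschitzOnWith ?_ ?_ (hu s hs)
    · rw [← hΨimg s hs]
      exact mapsTo_image _ _
    · intro x hx
      obtain ⟨X, hX, rfl⟩ := hrep t ht x hx
      rw [hΨΦ s hs X hX, hGe s hs X (subset_closure hX), hFe t ht X (subset_closure hX)]
  have hGt : MapsTo (G t) (Ωf t) (Ωf 0) := fun x hx => by
    obtain ⟨X, hX, rfl⟩ := hrep t ht x hx
    rwa [hGe t ht X (subset_closure hX)]
  have hΦG : ∀ x ∈ Ωf t, Φ t (G t x) = x := fun x hx => by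
    obtain ⟨X, hX, rfl⟩ := hrep t ht x hx
    rw [hGe t ht X (subset_closure hX)]
  have hFGt : ∀ x ∈ Ωf t, F t (G t x) = x := hΨt
  have hg : MemLp g 2 (volume.restrict (Ωf t)) := by
    refine (memLp_congr_ae ?_).1 (memLp_comp_of_lipschitz (hG t ht).continuous
      (hF t ht).lipschitzOnWith hGt hFGt hder.1)
    filter_upwards [ae_restrict_mem hmt] with x hx
    rw [hΦG x hx]
  have hlim : Tendsto (fun s => eLpNorm (fun x => (s - t)⁻¹ • (u s (Ψ s x) - u t (Ψ t x)) - g x) 2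
      (volume.restrict (Ωf t))) (𝓝[Icc 0 T \ {t}] t) (𝓝 0) := by
    have hC : ((K t ^ d : ℝ≥0) : ENNReal) ^ (1 / (2 : ENNReal)).toReal ≠ ⊤ :=
      ENNReal.rpow_ne_top_of_nonneg (by simp) ENNReal.coe_ne_top
    have hz := ENNReal.Tendsto.const_mul hder.2 (Or.inr hC)
    rw [mul_zero] at hz
    refine tendsto_of_tendsto_of_tendsto_of_le_of_le' tendsto_const_nhds hz
      (Eventually.of_forall fun _ => zero_le) ?_
    filter_upwards [self_mem_nhdsWithin] with s hs
    have hpull : ∀ r ∈ Icc 0 T,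
        AEStronglyMeasurable (fun X => u r (Φ r X)) (volume.restrict (Ωf 0)) := fun r hr => by
      have h1 := memLp_comp_of_lipschitz (Ω := Ωf 0) (hF r hr).continuous
        (hG r hr).lipschitzOnWith (fun X hX => by
          rw [hFe r hr X (subset_closure hX)]; exact hΦm r hr X hX)
        (fun X hX => by
          rw [hFe r hr X (subset_closure hX), hGe r hr X (subset_closure hX)]) (hu r hr)
      refine h1.1.congr ?_
      filter_upwards [ae_restrict_mem (hΩ 0 h0).measurableSet] with X hX
      rw [hFe r hr X (subset_closure hX)]
    have h2 := (eLpNorm_comp_le_of_lipschitz (hG t ht).continuous (hF t ht).lipschitzOnWith hGt hFGt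
      ((((hpull s hs.1).sub (hpull t ht)).const_smul (s - t)⁻¹).sub hder.1.1)).2
    refine le_trans (le_of_eq (eLpNorm_congr_ae ?_)) h2
    filter_upwards [ae_restrict_mem hmt] with x hx
    obtain ⟨X, hX, rfl⟩ := hrep t ht x hx
    simp only [Pi.sub_apply, Pi.smul_apply, hGe t ht X (subset_closure hX), hΨΦ s hs.1 X hX,
      hΨΦ t ht X hX]
  -- the Jacobian of the transport from time `t` to time `s`
  have hJ : ∀ ε > 0, ∀ᶠ s in 𝓝[Icc 0 T] t, ∀ᵐ x ∂(volume.restrict (Ωf t)),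
      |(|(fderiv ℝ (Ψ s) x).det|) - 1 - (s - t) * trTensor (classicalGrad b x)| ≤ ε * |s - t| := by
    intro ε hε
    refine eventually_abs_jacobian_sub_le (hΩ t ht) (fun s hs => ⟨_, hΨL s hs⟩) hb ?_ hε
    intro η hη
    filter_upwards [h.deriv t ht (η / (K t + 1)) (by positivity), self_mem_nhdsWithin]
      with s hs hsI x hx y hy
    obtain ⟨X, hX, rfl⟩ := hrep t ht x hx
    obtain ⟨Y, hY, rfl⟩ := hrep t ht y hy
    simp only [hΨΦ s hsI X hX, hΨΦ s hsI Y hY, hbdef, hbe X (subset_closure hX),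
      hbe Y (subset_closure hY)]
    refine ((hs X (subset_closure hX)).2 Y (subset_closure hY)).trans ?_
    have h1 : ‖X - Y‖ ≤ (K t + 1) * ‖Φ t X - Φ t Y‖ := by
      have h2 := (hG t ht).dist_le_mul (Φ t X) (Φ t Y)
      rw [hGe t ht X (subset_closure hX), hGe t ht Y (subset_closure hY), dist_eq_norm,
        dist_eq_norm] at h2
      nlinarith [norm_nonneg (Φ t X - Φ t Y)]
    calc η / (K t + 1) * |s - t| * ‖X - Y‖
        ≤ η / (K t + 1) * |s - t| * ((K t + 1) * ‖Φ t X - Φ t Y‖) := by gcongr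
      _ = η * |s - t| * ‖Φ t X - Φ t Y‖ := by field_simp
  have hJm : ∀ s, AEStronglyMeasurable (fun x => |(fderiv ℝ (Ψ s) x).det|)
      (volume.restrict (Ωf t)) := fun s =>
    (((ContinuousLinearMap.continuous_det.measurable.comp
      (measurable_fderiv ℝ (Ψ s))).norm).aestronglyMeasurable :)
  have hc : MemLp (fun x => trTensor (classicalGrad b x)) ⊤ (volume.restrict (Ωf t)) :=
    memLp_top_of_bound
      (continuous_trTensor.measurable.comp (measurable_classicalGrad b)).aestronglyMeasurable
      (d * (Real.sqrt (d * d) * L)) (Eventually.of_forall fun x =>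
        (abs_trTensor_le _).trans (by gcongr; exact norm_classicalGrad_le hb x))
  have hmain := hasDerivWithinAt_integral_mul_norm_sq ht hf hg hlim hc (fun s _ => hJm s) hJ
  refine ⟨hg, ?_⟩
  -- the kinetic energy at time `s`, as an integral over the fixed domain `Ωf t`
  have hval : ∀ s ∈ Icc 0 T, sqNorm (Ωf s) (u s)
      = ∫ x in Ωf t, |(fderiv ℝ (Ψ s) x).det| * ‖u s (Ψ s x)‖ ^ 2 := fun s hs => by
    rw [sqNorm, ← hΨimg s hs]
    exact integral_image_eq_of_lipschitz hmt (hΨL s hs) (hΨinj s hs) _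
  refine (hmain.congr hval (hval t ht)).congr_deriv ?_
  congr 1
  · congr 1
    exact setIntegral_congr_fun hmt fun x hx => by simp only [hΨt x hx]
  · exact setIntegral_congr_fun hmt fun x hx => by simp only [hΨt x hx]

/-! ### Consequences of the weak formulation -/


theorem HasL2DerivWithinAt.congr_deriv {Ω : Set (Vec d)} {f : ℝ → Vec d → Vec d}
    {f' g' : Vec d → Vec d} {I : Set ℝ} {t : ℝ} (h : HasL2DerivWithinAt Ω f f' I t)
    (hfg : f' =ᵐ[volume.restrict Ω] g') : HasL2DerivWithinAt Ω f g' I t := by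
  refine ⟨(memLp_congr_ae hfg).1 h.1, h.2.congr fun s => eLpNorm_congr_ae ?_⟩
  filter_upwards [hfg] with x hx
  rw [hx]

theorem hasDerivWithinAt_integral_Icc {E : Type*} [NormedAddCommGroup E] [NormedSpace ℝ E]
    [CompleteSpace E] {T : ℝ} (hT : 0 ≤ T) {f : ℝ → E} (hf : ContinuousOn f (Icc 0 T)) {t : ℝ}
    (ht : t ∈ Icc 0 T) :
    HasDerivWithinAt (fun s => ∫ τ in (0 : ℝ)..s, f τ) (f t) (Icc 0 T) t := by
  set g : ℝ → E := IccExtend hT ((Icc 0 T).domRestrict f) with hg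
  have hgc : Continuous g := (continuousOn_iff_continuous_domRestrict.1 hf).Icc_extend'
  have hgf : ∀ s ∈ Icc 0 T, g s = f s := fun s hs => IccExtend_of_mem hT _ hs
  have hint : ∀ s ∈ Icc 0 T, ∫ τ in (0 : ℝ)..s, f τ = ∫ τ in (0 : ℝ)..s, g τ := fun s hs => by
    refine intervalIntegral.integral_congr fun τ hτ => (hgf τ ?_).symm
    rw [uIcc_of_le hs.1] at hτ
    exact ⟨hτ.1, hτ.2.trans hs.2⟩
  rw [← hgf t ht]
  exact (hgc.integral_hasStrictDerivAt 0 t).hasDerivAt.hasDerivWithinAt.congr hint (hint t ht)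

namespace Data

variable {D : Data d}

/-- Testing with pressures only shows that the fluid velocity is divergence free. -/
theorem WeakForm.weakDiv_ae_eq_zero {t : ℝ} {φ u ut vt : Vec d → Vec d} {p : Vec d → ℝ}
    (h : D.WeakForm t φ u ut p vt) (hΩ : IsOpen (D.Ωf t)) (hΩs : IsOpen D.Ωs)
    (hu : MemH1 (D.Ωf t) u) :
    ∀ᵐ x ∂(volume.restrict (D.Ωf t)), weakDiv (D.Ωf t) u x = 0 := by
  have hq : MemLp (weakDiv (D.Ωf t) u) 2 (volume.restrict (D.Ωf t)) :=
    (hu.2.2.norm.const_mul (d : ℝ)).mono' (continuous_trTensor.comp_aestronglyMeasurable hu.2.2.1)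
      (Eventually.of_forall fun x => abs_trTensor_le _)
  obtain ⟨-, -, -, -, -, -, heq⟩ := h (fun _ => 0) (fun _ => 0) (weakDiv (D.Ωf t) u) (fun _ => 0)
    ⟨memH1_zero hΩ, hasTrace_zero hΩ, hq, memW1inf_zero hΩs, fun _ _ => rfl⟩
    (fun _ _ => rfl) (fun _ _ => rfl)
  have h1 : ∫ x in D.Ωf t, inner ℝ (D.σf (weakGrad (D.Ωf t) u x) (p x))
      (weakGrad (D.Ωf t) (fun _ => (0 : Vec d)) x) = (0 : ℝ) := by
    refine integral_eq_zero_of_ae ?_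
    filter_upwards [weakGrad_zero_ae (d := d) hΩ] with x hx
    rw [hx]; simp
  have h2 : ∫ z in D.Ωs, inner ℝ (D.σs (weakGrad D.Ωs φ z))
      (weakGrad D.Ωs (fun _ => (0 : Vec d)) z) = (0 : ℝ) := by
    refine integral_eq_zero_of_ae ?_
    filter_upwards [weakGrad_zero_ae (d := d) hΩs] with x hx
    rw [hx]; simp
  rw [h1, h2] at heq
  simp only [inner_zero_right, integral_zero, mul_zero, add_zero, zero_sub,
    neg_eq_zero] at heq
  have h3 : Integrable (fun x => weakDiv (D.Ωf t) u x * weakDiv (D.Ωf t) u x)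
      (volume.restrict (D.Ωf t)) := hq.integrable_mul hq
  have h4 := (integral_eq_zero_iff_of_nonneg (fun x => mul_self_nonneg _) h3).1 heq
  filter_upwards [h4] with x hx
  exact mul_self_eq_zero.1 hx

/-- On the interface the fluid domain moves with the velocity of the solid. -/
theorem IsWeakSolution.velocity_interface {Φ w u ut v vt : ℝ → Vec d → Vec d}
    {p : ℝ → Vec d → ℝ} (h : D.IsWeakSolution Φ w u ut p v vt) (hT : 0 < D.T) {t : ℝ}
    (ht : t ∈ Icc 0 D.T) {z : Vec d} (hz : z ∈ D.Γ) :
    D.φ₀ z ∈ closure (D.Ωf 0) ∧ w t (D.φ₀ z) = v t z := by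
  have h0 : (0 : ℝ) ∈ Icc 0 D.T := ⟨le_rfl, hT.le⟩
  have hcl : D.φ₀ z ∈ closure (D.Ωf 0) := by
    have h1 := frontier_subset_closure (h.interface_subset 0 h0 (mem_image_of_mem _ hz))
    simpa [pos] using h1
  refine ⟨hcl, ?_⟩
  have hw : HasDerivWithinAt (fun s => D.pos v s z) (w t (D.φ₀ z)) (Icc 0 D.T) t := by
    rw [hasDerivWithinAt_iff_isLittleO, Asymptotics.isLittleO_iff]
    intro ε hε
    filter_upwards [h.motion.deriv t ht ε hε, self_mem_nhdsWithin] with s hs hsI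
    rw [← h.motion_interface s hsI z hz, ← h.motion_interface t ht z hz]
    exact (hs _ hcl).1
  have hcv : ContinuousOn (fun s => v s z) (Icc 0 D.T) :=
    h.cont_v.comp (f := fun s => (s, z)) (by fun_prop)
      fun s hs => ⟨hs, frontier_subset_closure hz.2⟩
  exact (uniqueDiffOn_Icc hT t ht).eq_deriv _ hw
    ((hasDerivWithinAt_integral_Icc hT.le hcv ht).const_add _)

end Data

end FSI

theorem theorem2p4 {d : ℕ} (hd : 1 ≤ d) (D : FSI.Data d) (hD : D.Admissible)
    (W : FSI.Tensor d → ℝ) (hW : ContDiff ℝ 1 W) (hσ : ∀ F, D.σs F = gradient W F)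
    (hub : ∀ t ∈ Icc 0 D.T, ∀ x ∈ D.S₁, D.ub t x = 0)
    (hS₂ : D.S₂ = ∅)
    (hφb : ∀ t ∈ Icc 0 D.T, ∀ z ∈ D.S₃,
      HasDerivWithinAt (fun s => D.φb s z) 0 (Icc 0 D.T) t)
    (Φ w u ut : ℝ → FSI.Vec d → FSI.Vec d) (p : ℝ → FSI.Vec d → ℝ)
    (v vt : ℝ → FSI.Vec d → FSI.Vec d) (hsol : D.IsWeakSolution Φ w u ut p v vt) :
    ∀ t ∈ Icc 0 D.T,
      DifferentiableWithinAt ℝ (fun s => FSI.sqNorm (D.Ωf s) (u s)) (Icc 0 D.T) t ∧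
      DifferentiableWithinAt ℝ (fun s => FSI.sqNorm D.Ωs (v s)) (Icc 0 D.T) t ∧
      DifferentiableWithinAt ℝ (fun s => FSI.strainEnergy W D.Ωs (D.pos v s)) (Icc 0 D.T) t ∧
      D.ρf / 2 * derivWithin (fun s => FSI.sqNorm (D.Ωf s) (u s)) (Icc 0 D.T) t
        + D.ρf * D.νf / 2 * (∫ x in D.Ωf t,
            ‖FSI.weakGrad (D.Ωf t) (u t) x + FSI.transp (FSI.weakGrad (D.Ωf t) (u t) x)‖ ^ 2)
        + D.ρs / 2 * derivWithin (fun s => FSI.sqNorm D.Ωs (v s)) (Icc 0 D.T) t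
        + derivWithin (fun s => FSI.strainEnergy W D.Ωs (D.pos v s)) (Icc 0 D.T) t
      = D.ρf * (∫ x in D.Ωf t, inner ℝ (D.gf t x) (u t x))
        + D.ρs * (∫ z in D.Ωs, inner ℝ (D.gs t z) (v t z))
        + (∫ z in D.S₄, inner ℝ (D.σbs t z) (v t z) ∂(FSI.surf D.Ωs)) := by
  intro t ht
  have hT := hD.T_pos
  have hud := uniqueDiffOn_Icc hT t ht
  have hΩ := hD.lipschitz_f t ht
  have hΩs := hD.lipschitz_s
  obtain ⟨γ, hV, hγ₁⟩ := hsol.mem t ht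
  have ⟨hu, hγ, _, _, hΓ⟩ := hV
  have hweak := hsol.weak t ht
  have hdiv := hweak.weakDiv_ae_eq_zero hΩ.1 hΩs.1 hu
  have hγ₀ : ∀ x ∈ D.S₁, γ x = 0 := fun x hx => (hγ₁ x hx).trans (hub t ht x hx)
  have hv₀ : ∀ z ∈ D.S₃, v t z = 0 := fun z hz =>
    hud.eq_deriv _ (hsol.dirichlet_s t ht z hz) (hφb t ht z hz)
  -- the energy test: the solution itself is an admissible test triple
  obtain ⟨hconv, -, -, -, -, -, heq⟩ := hweak (u t) γ (p t) (v t) hV hγ₀ hv₀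
  -- kinetic energy of the fluid
  obtain ⟨b, K, hb, hbw, htransport⟩ :=
    hsol.motion.exists_hasDerivWithinAt_sqNorm hT (fun s hs => (hD.lipschitz_f s hs).1) ht
  obtain ⟨hg, hdu⟩ := htransport u
    (fun x => ut t x + FSI.mulVec (FSI.weakGrad (D.Ωf t) (u t) x) (b x))
    (fun s hs => by
      obtain ⟨_, hVs, -⟩ := hsol.mem s hs
      exact hVs.1.2.1)
    ((hsol.deriv_u t ht).congr_deriv (by
      filter_upwards [ae_restrict_mem (hD.lipschitz_f 0 ⟨le_rfl, hT.le⟩).1.measurableSet] with X hX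
      rw [hbw X (subset_closure hX)]))
  have hbd : ∀ x ∈ frontier (D.Ωf t), γ x = 0 ∨ γ x = b x := fun x hx => by
    by_cases hxΓ : x ∈ D.pos v t '' D.Γ
    · obtain ⟨z, hz, rfl⟩ := hxΓ
      obtain ⟨hcl, hwv⟩ := hsol.velocity_interface hT ht hz
      right
      rw [hΓ z hz, ← hsol.motion_interface t ht z hz, hbw _ hcl, hwv]
    · have h1 : x ∈ D.S₁ ∪ D.S₂ := hsol.boundary_f t ht ▸ ⟨hx, hxΓ⟩
      rw [hS₂, union_empty] at h1
      exact Or.inl (hγ₀ x h1)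
  have hGb := FSI.memLp_mulVec_weakGrad hΩ.1 hΩ.2.1 hu hb.continuous
  have hut : MemLp (ut t) 2 (volume.restrict (D.Ωf t)) := by
    refine (memLp_congr_ae (Eventually.of_forall fun x => ?_)).1 (hg.sub hGb)
    simp
  have hutu := FSI.integrable_inner_of_memLp hut hu.2.1
  have hGu : IntegrableOn (fun x => (inner ℝ
      (FSI.mulVec (FSI.weakGrad (D.Ωf t) (u t) x) (u t x)) (u t x) : ℝ)) (D.Ωf t) := by
    refine (Integrable.sub hconv hutu).congr (Eventually.of_forall fun x => ?_)
    simp [inner_add_left]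
  obtain ⟨hi1, -, hflux⟩ := FSI.integral_kineticFlux_eq_zero hΩ hu hγ hb hbd hdiv hGu
  have e1 : ∫ x in D.Ωf t, inner ℝ (ut t x
        + FSI.mulVec (FSI.weakGrad (D.Ωf t) (u t) x) (u t x)) (u t x)
      = (∫ x in D.Ωf t, inner ℝ (ut t x) (u t x)) + ∫ x in D.Ωf t,
        inner ℝ (FSI.mulVec (FSI.weakGrad (D.Ωf t) (u t) x) (u t x)) (u t x) := by
    rw [← integral_add hutu hGu]
    simp only [inner_add_left]
  have e2 : ∫ x in D.Ωf t, inner ℝ (u t x) (ut t x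
        + FSI.mulVec (FSI.weakGrad (D.Ωf t) (u t) x) (b x))
      = (∫ x in D.Ωf t, inner ℝ (ut t x) (u t x)) + ∫ x in D.Ωf t,
        inner ℝ (FSI.mulVec (FSI.weakGrad (D.Ωf t) (u t) x) (b x)) (u t x) := by
    rw [← integral_add hutu hi1]
    refine integral_congr_ae (Eventually.of_forall fun x => ?_)
    simp only [← inner_add_left]
    exact real_inner_comm _ _
  -- viscous dissipation; the pressure does no work, since `div u = 0`
  have e3 : ∫ x in D.Ωf t, inner ℝ (D.σf (FSI.weakGrad (D.Ωf t) (u t) x) (p t x))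
        (FSI.weakGrad (D.Ωf t) (u t) x)
      = D.ρf * D.νf / 2 * ∫ x in D.Ωf t,
        ‖FSI.weakGrad (D.Ωf t) (u t) x + FSI.transp (FSI.weakGrad (D.Ωf t) (u t) x)‖ ^ 2 := by
    rw [← integral_const_mul]
    refine integral_congr_ae ?_
    filter_upwards [hdiv] with x hx
    rw [FSI.weakDiv] at hx
    rw [FSI.Data.inner_σf, hx, zero_mul, sub_zero]
  have e4 : ∫ x in D.Ωf t, FSI.weakDiv (D.Ωf t) (u t) x * p t x = 0 := by
    refine integral_eq_zero_of_ae ?_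
    filter_upwards [hdiv] with x hx
    simp [hx]
  -- kinetic energy and strain energy of the solid
  have : IsFiniteMeasure (volume.restrict D.Ωs) :=
    ⟨by simpa using hΩs.2.1.measure_lt_top⟩
  have hW1 : ∀ s ∈ Icc 0 D.T, FSI.MemW1inf D.Ωs (v s) := fun s hs => by
    obtain ⟨_, hVs, -⟩ := hsol.mem s hs
    exact hVs.2.2.2.1
  have hdv : HasDerivWithinAt (fun s => FSI.sqNorm D.Ωs (v s))
      (2 * ∫ z in D.Ωs, inner ℝ (v t z) (vt t z)) (Icc 0 D.T) t :=
    FSI.hasDerivWithinAt_integral_norm_sq ht (fun s hs => (hW1 s hs).2.2.1.mono_exponent le_top)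
      (hsol.deriv_v t ht).1 (hsol.deriv_v t ht).2
  obtain ⟨M, hM⟩ := hsol.bdd_grad_v
  have hdI : HasDerivWithinAt (fun s => FSI.strainEnergy W D.Ωs (D.pos v s))
      (∫ z in D.Ωs, inner ℝ (gradient W (FSI.weakGrad D.Ωs (D.pos v t) z))
        (FSI.weakGrad D.Ωs (v t) z)) (Icc 0 D.T) t :=
    FSI.hasDerivWithinAt_strainEnergy hΩs.1 hΩs.2.1 hW hD.φ₀_mem hW1 hsol.cont_v hM
      hsol.cont_grad_v ht
  refine ⟨hdu.differentiableWithinAt, hdv.differentiableWithinAt, hdI.differentiableWithinAt, ?_⟩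
  rw [hdu.derivWithin hud, hdv.derivWithin hud, hdI.derivWithin hud]
  rw [e1, e3, e4, hS₂] at heq
  simp only [Measure.restrict_empty, integral_zero_measure, hσ] at heq
  rw [e2]
  simp only [real_inner_comm (vt t _)]
  linear_combination heq + D.ρf / 2 * hflux
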